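/- All Hilbert spaces are complex and separable, and the Hilbert space of a quantum system is nonzero. Let $\mathcal H$ be a Hilbert space; ancillary systems have arbitrary Hilbert spaces $\mathcal K,\mathcal K_1,\mathcal K_2,\dots$, and $\mathcal H\otimes\mathbb C$ is identified with $\mathcal H$. A *quantum channel* $T:\mathcal B(\mathcal H_2)\to\mathcal B(\mathcal H_1)$ is a normal unital completely positive map. An *instrument* with countable outcome space $X$ is a family $(T_x)_{x\in X}$ of normal completely positive maps $T_x:\mathcal B(\mathcal H_2)\to\mathcal B(\mathcal H_1)$ such that $\sum_x T_x$ is a quantum channel. Channels are identified with instruments with a single outcome. For an operator $v:\mathcal H_1\to\mathcal H_2$ write $\mathrm{Ad}(v^*)(a)=v^*av$. An *agent* with partial access to the system $\mathcal H$ is specified by the collection of the instruments $(T_x)_{x\in X}$, $T_x:\mathcal B(\mathcal H\otimes\mathcal K_2)\to\mathcal B(\mathcal H\otimes\mathcal K_1)$ (for arbitrary $\mathcal K_1,\mathcal K_2,X$), that they can implement. Consider the following axioms. - **(A0) Consistency.** If $(T_x)_{x\in X}$, $T_x:\mathcal B(\mathcal H\otimes\mathcal K_2)\to\mathcal B(\mathcal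 H\otimes\mathcal K_1)$, and $(S_y)_{y\in Y}$, $S_y:\mathcal B(\mathcal H\otimes\mathcal K_3)\to\mathcal B(\mathcal H\otimes\mathcal K_2)$, are implementable, then so is $(T_x\circ S_y)_{(x,y)\in X\times Y}$. Implementability does not depend on the names of the outcomes, and if $(T_x)$ is implementable, then so is the channel $\sum_xT_x$ (the classical outcome may be discarded). - **(A1) Limits.** For all $\mathcal K_1,\mathcal K_2$, the set of implementable channels $\mathcal B(\mathcal H\otimes\mathcal K_2)\to\mathcal B(\mathcal H\otimes\mathcal K_1)$ is closed, in the set of all channels, in the topology of convergence in expectation values ($T_\alpha\to T$ iff $\phi(T_\alpha(a))\to\phi(T(a))$ for all normal states $\phi$ and all bounded operators $a$). - **(A2) Ancillas.** For every instrument $(S_x)$, $S_x:\mathcal B(\mathcal K_2)\to\mathcal B(\mathcal K_1)$, between ancillary systems, the instrument $(\mathrm{id}_{\mathcal B(\mathcal H)}\otimes S_x)$ is implementable (this includes preparing and discarding ancillas). - **(A3) Reversibility.** If $u:\mathcal H\otimes\mathcal K_1\to\mathcal H\otimes\mathcal K_2$ is unitary and $\mathrm{Ad}(u^*)$ is implementable,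 then $\mathrm{Ad}(u)$ is implementable. - **(A4) Dilations.** For every implementable channel $T:\mathcal B(\mathcal H\otimes\mathcal K_2)\to\mathcal B(\mathcal H\otimes\mathcal K_1)$ there are ancillary Hilbert spaces $\tilde{\mathcal K}_1,\tilde{\mathcal K}_2$, a unit vector $\Omega\in\tilde{\mathcal K}_1$ and a unitary $u:\mathcal H\otimes\mathcal K_1\otimes\tilde{\mathcal K}_1\to\mathcal H\otimes\mathcal K_2\otimes\tilde{\mathcal K}_2$ with $\mathrm{Ad}(u^*)$ implementable such that $T(a)=(1\otimes\langle\Omega|)\,u^*(a\otimes1)u\,(1\otimes|\Omega\rangle)$ for all $a$. - **(A5) Selection-completeness.** If $T^y=(T^y_x)_{x\in X_y}$, $y\in Y$, is a finite collection of implementable instruments with $T^y_x:\mathcal B(\mathcal H\otimes\mathcal K_2)\to\mathcal B(\mathcal H\otimes\mathcal K_1)$, and $x_y\in X_y$ are outcomes with $\sum_{y}T^y_{x_y}(1)\le1$, then there is an implementable instrument $(S_y)_{y\in Y\cup\{\perp\}}$ with $S_y=T^y_{x_y}$ for all $y\in Y$. For a von Neumann algebra $\mathcal M$ on $\mathcal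 H$, let $\mathcal M\bar\otimes\mathcal B(\mathcal K_1,\mathcal K_2)$ be the strongly closed linear span of the operators $a\otimes b:\mathcal H\otimes\mathcal K_1\to\mathcal H\otimes\mathcal K_2$ with $a\in\mathcal M$ and $b\in\mathcal B(\mathcal K_1,\mathcal K_2)$. An instrument $(T_x)$, $T_x:\mathcal B(\mathcal H\otimes\mathcal K_2)\to\mathcal B(\mathcal H\otimes\mathcal K_1)$, is *$\mathcal M$-inner* if each $T_x$ has a Kraus decomposition $T_x=\sum_i k_{i|x}^*(\,\cdot\,)k_{i|x}$ with countably many $k_{i|x}\in\mathcal M\bar\otimes\mathcal B(\mathcal K_1,\mathcal K_2)$. **Theorem.** An agent with partial access to $\mathcal H$ satisfies the axioms (A0)–(A5) if and only if there is a von Neumann algebra $\mathcal M$ on $\mathcal H$ such that, for all ancillary Hilbert spaces $\mathcal K_1,\mathcal K_2$ and all countable outcome spaces, the agent can implement an instrument $(T_x)$, $T_x:\mathcal B(\mathcal H\otimes\mathcal K_2)\to\mathcal B(\mathcal H\otimes\mathcal K_1)$, if and only if it is $\mathcal M$-inner. -/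

import Mathlib

open scoped TensorProduct InnerProductSpace ComplexOrder CStarAlgebra Topology

noncomputable section

namespace AgentAxioms

/-! ### Hilbert space tensor products -/

/-- The Hilbert space tensor product: the completion of the algebraic tensor product with respect
to the inner product determined by `⟪x ⊗ y, x' ⊗ y'⟫ = ⟪x, x'⟫ * ⟪y, y'⟫`. -/
def HTensor (H K : Type*) [NormedAddCommGroup H] [InnerProductSpace ℂ H]
    [NormedAddCommGroup K] [InnerProductSpace ℂ K] : Type _ :=
  UniformSpace.Completion (H ⊗[ℂ] K)

section Tensor

variable {H K L H' K' : Type*}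
  [NormedAddCommGroup H] [InnerProductSpace ℂ H]
  [NormedAddCommGroup K] [InnerProductSpace ℂ K]
  [NormedAddCommGroup L] [InnerProductSpace ℂ L]
  [NormedAddCommGroup H'] [InnerProductSpace ℂ H']
  [NormedAddCommGroup K'] [InnerProductSpace ℂ K']

instance : NormedAddCommGroup (HTensor H K) :=
  inferInstanceAs (NormedAddCommGroup (UniformSpace.Completion (H ⊗[ℂ] K)))

instance : InnerProductSpace ℂ (HTensor H K) :=
  inferInstanceAs (InnerProductSpace ℂ (UniformSpace.Completion (H ⊗[ℂ] K)))

instance : CompleteSpace (HTensor H K) :=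
  inferInstanceAs (CompleteSpace (UniformSpace.Completion (H ⊗[ℂ] K)))

/-- The canonical isometric embedding of the algebraic tensor product. -/
def HTensor.incl (H K : Type*) [NormedAddCommGroup H] [InnerProductSpace ℂ H]
    [NormedAddCommGroup K] [InnerProductSpace ℂ K] : H ⊗[ℂ] K →ₗᵢ[ℂ] HTensor H K :=
  UniformSpace.Completion.toComplₗᵢ (𝕜 := ℂ) (E := H ⊗[ℂ] K)

theorem HTensor.denseRange_incl : DenseRange (HTensor.incl H K) :=
  UniformSpace.Completion.denseRange_coe

/-- The elementary tensor `x ⊗ y` in the Hilbert space tensor product, as a bounded bilinear map. -/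
def tmulL : H →L[ℂ] K →L[ℂ] HTensor H K :=
  (ContinuousLinearMap.compL ℂ K (H ⊗[ℂ] K) (HTensor H K)
    (HTensor.incl H K).toContinuousLinearMap).comp (TensorProduct.mkL ℂ H K)

theorem tmulL_apply (x : H) (y : K) : tmulL x y = HTensor.incl H K (x ⊗ₜ[ℂ] y) := rfl

theorem inner_tmulL (x x' : H) (y y' : K) :
    ⟪tmulL x y, tmulL x' y'⟫_ℂ = ⟪x, x'⟫_ℂ * ⟪y, y'⟫_ℂ := by
  simp [tmulL_apply, LinearIsometry.inner_map_map]

theorem norm_tmulL (x : H) (y : K) : ‖tmulL x y‖ = ‖x‖ * ‖y‖ := by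
  simp [tmulL_apply]

theorem dense_span_tmulL :
    Dense (Submodule.span ℂ {z : HTensor H K | ∃ x y, z = tmulL x y} : Set (HTensor H K)) := by
  refine Dense.mono ?_ (HTensor.denseRange_incl (H := H) (K := K))
  rintro _ ⟨t, rfl⟩
  induction t using TensorProduct.induction_on with
  | zero => simp
  | tmul x y => exact Submodule.subset_span ⟨x, y, rfl⟩
  | add s t hs ht =>
    rw [map_add]
    exact Submodule.add_mem _ hs ht

/-- The tensor product `a ⊗ b` of two bounded operators. -/
def opTensor (a : H →L[ℂ] H') (b : K →L[ℂ] K') : HTensor H K →L[ℂ] HTensor H' K' :=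
  (TensorProduct.mapL a b).completion

@[simp]
theorem opTensor_tmulL (a : H →L[ℂ] H') (b : K →L[ℂ] K') (x : H) (y : K) :
    opTensor a b (tmulL x y) = tmulL (a x) (b y) :=
  ContinuousLinearMap.completion_apply_coe (TensorProduct.mapL a b) (x ⊗ₜ[ℂ] y)

instance [TopologicalSpace.SeparableSpace H] [TopologicalSpace.SeparableSpace K] :
    TopologicalSpace.SeparableSpace (HTensor H K) := by
  have h1 : TopologicalSpace.IsSeparable
      (Set.range fun p : H × K => (tmulL p.1 p.2 : HTensor H K)) :=
    TopologicalSpace.isSeparable_range (by fun_prop)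
  have h2 := (h1.span (R := ℂ)).closure
  rw [← TopologicalSpace.isSeparable_univ_iff]
  refine h2.mono ?_
  have h3 := (dense_span_tmulL (H := H) (K := K)).closure_eq
  rw [← h3]
  refine closure_mono (Submodule.span_mono ?_)
  rintro z ⟨x, y, rfl⟩
  exact ⟨(x, y), rfl⟩

instance [Nontrivial H] [Nontrivial K] : Nontrivial (HTensor H K) := by
  obtain ⟨x, hx⟩ := exists_ne (0 : H)
  obtain ⟨y, hy⟩ := exists_ne (0 : K)
  refine ⟨⟨tmulL x y, 0, fun h => ?_⟩⟩
  have h' := norm_tmulL x y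
  rw [h, norm_zero] at h'
  simp [hx, hy] at h'

/-- The isometric embedding `(x ⊗ y) ⊗ z ↦ (x ⊗ y) ⊗ z` of the algebraic triple tensor product. -/
def HTensor.inclLeft (H K L : Type*) [NormedAddCommGroup H] [InnerProductSpace ℂ H]
    [NormedAddCommGroup K] [InnerProductSpace ℂ K] [NormedAddCommGroup L] [InnerProductSpace ℂ L] :
    (H ⊗[ℂ] K) ⊗[ℂ] L →ₗᵢ[ℂ] HTensor (HTensor H K) L :=
  (HTensor.incl (HTensor H K) L).comp
    (TensorProduct.mapIsometry (HTensor.incl H K) (LinearIsometry.id (R := ℂ) (E := L)))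

/-- The isometric embedding `x ⊗ (y ⊗ z) ↦ x ⊗ (y ⊗ z)` of the algebraic triple tensor product. -/
def HTensor.inclRight (H K L : Type*) [NormedAddCommGroup H] [InnerProductSpace ℂ H]
    [NormedAddCommGroup K] [InnerProductSpace ℂ K] [NormedAddCommGroup L] [InnerProductSpace ℂ L] :
    H ⊗[ℂ] (K ⊗[ℂ] L) →ₗᵢ[ℂ] HTensor H (HTensor K L) :=
  (HTensor.incl H (HTensor K L)).comp
    (TensorProduct.mapIsometry (LinearIsometry.id (R := ℂ) (E := H)) (HTensor.incl K L))

theorem HTensor.denseRange_inclLeft : DenseRange (HTensor.inclLeft H K L) := by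
  have key : ∀ (x : HTensor H K) (z : L), (tmulL x z : HTensor (HTensor H K) L) ∈
      (LinearMap.range (HTensor.inclLeft H K L).toLinearMap).topologicalClosure := by
    intro x z
    refine (HTensor.denseRange_incl (H := H) (K := K)).induction_on
      (p := fun x => (tmulL x z : HTensor (HTensor H K) L) ∈
        (LinearMap.range (HTensor.inclLeft H K L).toLinearMap).topologicalClosure) x ?_ ?_
    · exact (Submodule.isClosed_topologicalClosure _).preimage (by fun_prop)
    · intro t
      exact Submodule.le_topologicalClosure _ ⟨t ⊗ₜ z, rfl⟩
  have h : Submodule.span ℂ {z : HTensor (HTensor H K) L | ∃ x y, z = tmulL x y} ≤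
      (LinearMap.range (HTensor.inclLeft H K L).toLinearMap).topologicalClosure := by
    refine Submodule.span_le.2 ?_
    rintro _ ⟨x, z, rfl⟩
    exact key x z
  exact dense_closure.1 ((dense_span_tmulL (H := HTensor H K) (K := L)).mono h)

theorem HTensor.denseRange_inclRight : DenseRange (HTensor.inclRight H K L) := by
  have key : ∀ (x : H) (z : HTensor K L), (tmulL x z : HTensor H (HTensor K L)) ∈
      (LinearMap.range (HTensor.inclRight H K L).toLinearMap).topologicalClosure := by
    intro x z
    refine (HTensor.denseRange_incl (H := K) (K := L)).induction_on
      (p := fun z => (tmulL x z : HTensor H (HTensor K L)) ∈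
        (LinearMap.range (HTensor.inclRight H K L).toLinearMap).topologicalClosure) z ?_ ?_
    · exact (Submodule.isClosed_topologicalClosure _).preimage (by fun_prop)
    · intro t
      exact Submodule.le_topologicalClosure _ ⟨x ⊗ₜ t, rfl⟩
  have h : Submodule.span ℂ {z : HTensor H (HTensor K L) | ∃ x y, z = tmulL x y} ≤
      (LinearMap.range (HTensor.inclRight H K L).toLinearMap).topologicalClosure := by
    refine Submodule.span_le.2 ?_
    rintro _ ⟨x, z, rfl⟩
    exact key x z
  exact dense_closure.1 ((dense_span_tmulL (H := H) (K := HTensor K L)).mono h)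

/-- The canonical identification of `(H ⊗ K) ⊗ L` with `H ⊗ (K ⊗ L)`. -/
def HTensor.assoc (H K L : Type*) [NormedAddCommGroup H] [InnerProductSpace ℂ H]
    [NormedAddCommGroup K] [InnerProductSpace ℂ K] [NormedAddCommGroup L] [InnerProductSpace ℂ L] :
    HTensor (HTensor H K) L ≃ₗᵢ[ℂ] HTensor H (HTensor K L) :=
  (TensorProduct.assoc ℂ H K L).extendOfIsometry
    (HTensor.inclLeft H K L).toLinearMap (HTensor.inclRight H K L).toLinearMap
    HTensor.denseRange_inclLeft HTensor.denseRange_inclRight (fun x => by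
      simp only [LinearIsometry.coe_toLinearMap, LinearIsometry.norm_map]
      exact TensorProduct.norm_assoc x)

@[simp]
theorem HTensor.assoc_tmulL (x : H) (y : K) (z : L) :
    HTensor.assoc H K L (tmulL (tmulL x y) z) = tmulL x (tmulL y z) :=
  LinearEquiv.extendOfIsometry_eq (TensorProduct.assoc ℂ H K L)
    (HTensor.inclLeft H K L).toLinearMap (HTensor.inclRight H K L).toLinearMap
    _ _ _ ((x ⊗ₜ[ℂ] y) ⊗ₜ[ℂ] z)

end Tensor

/-! ### Normal functionals, channels and instruments -/

section Maps

variable {H H₁ H₂ : Type*}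
  [NormedAddCommGroup H] [InnerProductSpace ℂ H] [CompleteSpace H]
  [NormedAddCommGroup H₁] [InnerProductSpace ℂ H₁] [CompleteSpace H₁]
  [NormedAddCommGroup H₂] [InnerProductSpace ℂ H₂] [CompleteSpace H₂]

/-- The elements of the predual of `B(H)`, i.e. the functionals `a ↦ tr (ρ a)` with `ρ` trace class,
written as `a ↦ ∑ₙ ⟪ξₙ, a ηₙ⟫` with square summable sequences `ξ`, `η` of vectors. -/
def IsNormalFunctional (φ : (H →L[ℂ] H) →ₗ[ℂ] ℂ) : Prop :=
  ∃ ξ η : ℕ → H, Summable (fun n => ‖ξ n‖ ^ 2) ∧ Summable (fun n => ‖η n‖ ^ 2) ∧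
    ∀ a : H →L[ℂ] H, HasSum (fun n => ⟪ξ n, a (η n)⟫_ℂ) (φ a)

/-- Normal states on `B(H)`. -/
def IsNormalState (φ : (H →L[ℂ] H) →ₗ[ℂ] ℂ) : Prop :=
  IsNormalFunctional φ ∧ (∀ a : H →L[ℂ] H, 0 ≤ a → 0 ≤ φ a) ∧ φ 1 = 1

variable (H) in
/-- The `σ`-weak operator topology on `B(H)`: the initial topology of the normal functionals. -/
@[reducible] def sigmaWeak : TopologicalSpace (H →L[ℂ] H) :=
  ⨅ (φ : (H →L[ℂ] H) →ₗ[ℂ] ℂ) (_ : IsNormalFunctional φ),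
    TopologicalSpace.induced (fun a => φ a) inferInstance

/-- Complete positivity. -/
def IsCP (T : (H₂ →L[ℂ] H₂) →ₗ[ℂ] (H₁ →L[ℂ] H₁)) : Prop :=
  ∃ S : (H₂ →L[ℂ] H₂) →CP (H₁ →L[ℂ] H₁), S.toLinearMap = T

/-- Normality: continuity for the `σ`-weak operator topologies. -/
def IsNormalMap (T : (H₂ →L[ℂ] H₂) →ₗ[ℂ] (H₁ →L[ℂ] H₁)) : Prop :=
  Continuous[sigmaWeak H₂, sigmaWeak H₁] T

/-- Quantum channels (Heisenberg picture): normal unital completely positive maps. -/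
structure IsChannel (T : (H₂ →L[ℂ] H₂) →ₗ[ℂ] (H₁ →L[ℂ] H₁)) : Prop where
  cp : IsCP T
  normal : IsNormalMap T
  unital : T 1 = 1

/-- `T = ∑ₓ Tₓ`, in the sense of pointwise weak convergence. -/
def IsMapSum {X : Type*} (T : X → (H₂ →L[ℂ] H₂) →ₗ[ℂ] (H₁ →L[ℂ] H₁))
    (S : (H₂ →L[ℂ] H₂) →ₗ[ℂ] (H₁ →L[ℂ] H₁)) : Prop :=
  ∀ (a : H₂ →L[ℂ] H₂) (ξ ψ : H₁), HasSum (fun x => ⟪ξ, T x a ψ⟫_ℂ) ⟪ξ, S a ψ⟫_ℂ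

/-- Instruments with outcome space `X`: families of normal completely positive maps whose sum is a
quantum channel. -/
structure IsInstrument {X : Type*} (T : X → (H₂ →L[ℂ] H₂) →ₗ[ℂ] (H₁ →L[ℂ] H₁)) : Prop where
  cp : ∀ x, IsCP (T x)
  normal : ∀ x, IsNormalMap (T x)
  channel : ∃ S, IsChannel S ∧ IsMapSum T S

/-- The completely positive map `Ad(v*) : a ↦ v* a v`. -/
def conjMap (v : H₁ →L[ℂ] H₂) : (H₂ →L[ℂ] H₂) →ₗ[ℂ] (H₁ →L[ℂ] H₁) where
  toFun a := ContinuousLinearMap.adjoint v ∘L a ∘L v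
  map_add' a b := by ext; simp
  map_smul' c a := by ext; simp

variable (H₁ H₂) in
/-- The topology of convergence in expectation values: `T i → T` iff `φ (T i a) → φ (T a)` for all
normal states `φ` and all `a`. -/
@[reducible] def expectationTopology : TopologicalSpace {T : (H₂ →L[ℂ] H₂) →ₗ[ℂ] (H₁ →L[ℂ] H₁) // IsChannel T} :=
  ⨅ (φ : (H₁ →L[ℂ] H₁) →ₗ[ℂ] ℂ) (_ : IsNormalState φ) (a : H₂ →L[ℂ] H₂),
    TopologicalSpace.induced (fun T => φ (T.1 a)) inferInstance

end Maps

/-! ### Ancillary systems and agents -/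

/-- The Hilbert space of an ancillary quantum system: separable and nonzero. -/
structure Ancilla where
  carrier : Type
  [normedAddCommGroup : NormedAddCommGroup carrier]
  [innerProductSpace : InnerProductSpace ℂ carrier]
  [completeSpace : CompleteSpace carrier]
  [separableSpace : TopologicalSpace.SeparableSpace carrier]
  [nontrivial : Nontrivial carrier]

namespace Ancilla

instance : CoeSort Ancilla Type := ⟨carrier⟩

attribute [instance] normedAddCommGroup innerProductSpace completeSpace separableSpace nontrivial

/-- The joint system of two ancillary systems. -/
@[reducible] def tensor (K L : Ancilla) : Ancilla := ⟨HTensor K L⟩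

end Ancilla

section Agents

variable (H : Type*) [NormedAddCommGroup H] [InnerProductSpace ℂ H] [CompleteSpace H]

/-- The Hilbert space `H ⊗ K` of the full system together with an ancillary system. -/
abbrev Joint (K : Ancilla) : Type _ := HTensor H K

/-- Linear maps `B(H ⊗ K₂) → B(H ⊗ K₁)`. -/
abbrev JointMap (K₁ K₂ : Ancilla) : Type _ :=
  (Joint H K₂ →L[ℂ] Joint H K₂) →ₗ[ℂ] (Joint H K₁ →L[ℂ] Joint H K₁)

/-- An agent with partial access to the full system with Hilbert space `H` is specified by the
collection of all instruments that they can implement, with arbitrary ancillary input and output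
systems and arbitrary countable outcome spaces. -/
structure Agent where
  Implementable : ∀ {K₁ K₂ : Ancilla} {X : Type} [Countable X], (X → JointMap H K₁ K₂) → Prop
  isInstrument : ∀ {K₁ K₂ : Ancilla} {X : Type} [Countable X] {T : X → JointMap H K₁ K₂},
    Implementable T → IsInstrument T

variable {H}

/-- `1 ⊗ |Ω⟩ : H ⊗ K → H ⊗ (K ⊗ L)`. -/
def ketMap {K L : Ancilla} (Ω : L) : Joint H K →L[ℂ] Joint H (K.tensor L) :=
  opTensor (ContinuousLinearMap.id ℂ H) ((tmulL (H := K) (K := L)).flip Ω)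

/-- `a ⊗ 1` as an operator on `H ⊗ (K ⊗ L)`, for `a` on `H ⊗ K`. -/
def ampliate {K : Ancilla} (L : Ancilla) (a : Joint H K →L[ℂ] Joint H K) :
    Joint H (K.tensor L) →L[ℂ] Joint H (K.tensor L) :=
  ((HTensor.assoc H K L).toContinuousLinearEquiv : _ →L[ℂ] HTensor H (HTensor K L)) ∘L
    opTensor a (ContinuousLinearMap.id ℂ L) ∘L
    ((HTensor.assoc H K L).symm.toContinuousLinearEquiv : HTensor H (HTensor K L) →L[ℂ] _)

/-- The channel `Ad(u*) : a ↦ u* a u` of a unitary `u : H ⊗ K₁ → H ⊗ K₂`. -/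
def unitaryMap {K₁ K₂ : Ancilla} (u : Joint H K₁ ≃ₗᵢ[ℂ] Joint H K₂) : JointMap H K₁ K₂ :=
  conjMap (u.toContinuousLinearEquiv : Joint H K₁ →L[ℂ] Joint H K₂)

namespace Agent

variable (A : Agent H)

/-- Channels are identified with instruments that have a single outcome. -/
def ImplementableChannel {K₁ K₂ : Ancilla} (T : JointMap H K₁ K₂) : Prop :=
  A.Implementable (fun _ : Unit => T)

/-- Consistency with the statistical interpretation: implementable operations can be composed, the
names of the classical outcomes are immaterial, and classical outcomes can be discarded. -/
structure Consistency : Prop where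
  comp : ∀ {K₁ K₂ K₃ : Ancilla} {X Y : Type} [Countable X] [Countable Y]
    (T : X → JointMap H K₁ K₂) (S : Y → JointMap H K₂ K₃),
    A.Implementable T → A.Implementable S →
      A.Implementable (fun p : X × Y => T p.1 ∘ₗ S p.2)
  relabel : ∀ {K₁ K₂ : Ancilla} {X Y : Type} [Countable X] [Countable Y] (e : Y ≃ X)
    (T : X → JointMap H K₁ K₂), A.Implementable T → A.Implementable (fun y => T (e y))
  discard : ∀ {K₁ K₂ : Ancilla} {X : Type} [Countable X] (T : X → JointMap H K₁ K₂)
    (S : JointMap H K₁ K₂), A.Implementable T → IsMapSum T S → A.ImplementableChannel S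

/-- Limits: the set of implementable channels is closed in the topology of convergence in
expectation values. -/
def Limits : Prop :=
  ∀ K₁ K₂ : Ancilla, IsClosed[expectationTopology (Joint H K₁) (Joint H K₂)]
    {T | A.ImplementableChannel T.1}

/-- Full control over ancillary systems: every instrument of the form `Tₓ = id ⊗ Sₓ`, where `(Sₓ)`
is an instrument between ancillary systems, is implementable. Since the `Tₓ` are normal, they are
determined by `Tₓ (a ⊗ b) = a ⊗ Sₓ b`. Preparing a state `ω` of an ancilla is the case
`S b = ω b • 1`, and discarding an ancilla is the case `S b = b ⊗ 1`. -/
def AncillaControl : Prop :=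
  ∀ {K₁ K₂ : Ancilla} {X : Type} [Countable X] (S : X → (K₂ →L[ℂ] K₂) →ₗ[ℂ] (K₁ →L[ℂ] K₁)),
    IsInstrument S → ∀ T : X → JointMap H K₁ K₂, IsInstrument T →
      (∀ (x : X) (a : H →L[ℂ] H) (b : K₂ →L[ℂ] K₂),
        T x (opTensor a b) = opTensor a (S x b)) →
      A.Implementable T

/-- Reversibility: the inverse of every implementable unitary channel is implementable. -/
def Reversibility : Prop :=
  ∀ {K₁ K₂ : Ancilla} (u : Joint H K₁ ≃ₗᵢ[ℂ] Joint H K₂),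
    A.ImplementableChannel (unitaryMap u) → A.ImplementableChannel (unitaryMap u.symm)

/-- Dilations: every implementable channel is of the form
`T = (1 ⊗ ⟨Ω|) u* (· ⊗ 1) u (1 ⊗ |Ω⟩)` with an implementable unitary `u`. -/
def Dilations : Prop :=
  ∀ {K₁ K₂ : Ancilla} (T : JointMap H K₁ K₂), A.ImplementableChannel T →
    ∃ (L₁ L₂ : Ancilla) (Ω : L₁) (u : Joint H (K₁.tensor L₁) ≃ₗᵢ[ℂ] Joint H (K₂.tensor L₂)),
      ‖Ω‖ = 1 ∧ A.ImplementableChannel (unitaryMap u) ∧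
        ∀ a, T a = conjMap (ketMap Ω) (unitaryMap u (ampliate L₂ a))

/-- Selection-completeness; the outcome `⊥` is `none`. -/
def SelectionCompleteness : Prop :=
  ∀ {K₁ K₂ : Ancilla} {Y : Type} [Fintype Y] {X : Y → Type} [∀ y, Countable (X y)]
    (T : ∀ y, X y → JointMap H K₁ K₂), (∀ y, A.Implementable (T y)) →
    ∀ x : ∀ y, X y, (∑ y, T y (x y)) 1 ≤ 1 →
      ∃ S : Option Y → JointMap H K₁ K₂, A.Implementable S ∧ ∀ y, S (some y) = T y (x y)

/-- The operational axioms (A0) to (A5). -/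
structure SatisfiesAxioms : Prop where
  consistency : A.Consistency
  limits : A.Limits
  ancillaControl : A.AncillaControl
  reversibility : A.Reversibility
  dilations : A.Dilations
  selectionCompleteness : A.SelectionCompleteness

end Agent

/-! ### Inner operations -/

/-- The space `M ⊗̄ B(K₁, K₂)` of `M`-operators: the strongly closed linear span of the operators
`a ⊗ b` with `a ∈ M` and `b ∈ B(K₁, K₂)`. -/
def mOperators (M : VonNeumannAlgebra H) (K₁ K₂ : Ancilla) : Set (Joint H K₁ →L[ℂ] Joint H K₂) :=
  {k | ContinuousLinearMap.toPointwiseConvergenceCLM ℂ (RingHom.id ℂ) (Joint H K₁) (Joint H K₂) k ∈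
    closure (ContinuousLinearMap.toPointwiseConvergenceCLM ℂ (RingHom.id ℂ)
      (Joint H K₁) (Joint H K₂) ''
        (Submodule.span ℂ {c | ∃ a ∈ M, ∃ b : K₁ →L[ℂ] K₂, c = opTensor a b} :
          Set (Joint H K₁ →L[ℂ] Joint H K₂)))}

/-- A completely positive map is `M`-inner if it has a Kraus decomposition `T = ∑ᵢ kᵢ* (·) kᵢ` with
`M`-operators `kᵢ`. -/
def IsInner (M : VonNeumannAlgebra H) {K₁ K₂ : Ancilla} (T : JointMap H K₁ K₂) : Prop :=
  ∃ (ι : Type) (_ : Countable ι) (k : ι → Joint H K₁ →L[ℂ] Joint H K₂),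
    (∀ i, k i ∈ mOperators M K₁ K₂) ∧ IsMapSum (fun i => conjMap (k i)) T

/-- `M`-inner instruments. -/
def IsInnerInstrument (M : VonNeumannAlgebra H) {K₁ K₂ : Ancilla} {X : Type}
    (T : X → JointMap H K₁ K₂) : Prop :=
  IsInstrument T ∧ ∀ x, IsInner M (T x)

end Agents

end AgentAxioms

end

/-!
For a von Neumann algebra `M` on `H`, the space `M ⊗̄ B(K₁, K₂)` consists of the operators that
intertwine the two actions of `M' ⊗ 1` (`mem_mOperators_iff_commute`), equivalently of those with all
slices in `M` (`mem_mOperators_iff_slice`). Normal completely positive maps have Kraus decompositions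
(`IsCP.exists_kraus`, by means of a reproducing kernel Hilbert space), and such a map `T` is `M`-inner
as soon as `T (m ⊗ 1) = (m ⊗ 1) T 1` for all `m ∈ M'` (`isInner_of_map_commutant`). The latter
condition is closed under limits and composition.

*Inner instruments satisfy the axioms.* Consistency, limits, ancillas and reversibility follow from
the description by the commutant. For selection-completeness, the missing outcome is built from the
square root of the defect `1 - ∑ T_y 1`, which belongs to `M ⊗̄ B(K₁)`. For dilations, the Stinespring
isometry of an inner channel is in `M ⊗̄ B(K₁, K₂ ⊗ L)`, because its coordinates are the Kraus
operators. It is completed to a unitary by a 3 × 3 block matrix (`exists_unitary_dilation`) whose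
entries are polynomials in the isometry, its adjoint and operators on ancillas
(`IsInner.exists_dilation`). Taking `L` infinite-dimensional makes all dimensions match.

*An agent that satisfies the axioms implements the inner instruments of some `M`.* Let
`A.kraus K₁ K₂` be the set of the compressions `(1 ⊗ p) u (1 ⊗ q)` of implementable unitaries `u`. A
Radon–Nikodym argument for the dilation axiom (`IsKraus.exists_eq_bra_comp`) shows that it contains all
Kraus operators of implementable instruments (`mem_kraus_of_implementable`). These sets form a
*-category: adjoints come from reversibility, products from composition, and sums from
selection-completeness, which puts multiples of two operators into one instrument and therefore under
one dilation (`adjoint_mem_kraus`, `comp_mem_kraus`, `add_mem_kraus`). Moreover, every contraction `k`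
in `A.kraus` occurs as an outcome `a ↦ k* a k` of an implementable instrument (`imp_of_mem_kraus`).

The slices of these operators form a unital *-algebra `systemAlgebra` on `H`, and `M` is its double
commutant (`agentAlgebra`). Implementable instruments are then `M`-inner. Conversely, the Stinespring
isometry `v` of an inner instrument is in `M ⊗̄ B(K₁, K₂ ⊗ L)`. By the double commutant theorem and
the Hahn–Banach theorem it is a strong-* limit of operators `y` in `A.kraus`, and the transform
`y ↦ 2 y (1 + y* y)⁻¹`, as in Kaplansky's density theorem, turns these into contractions that still
converge strongly to `v` (`mem_strongClosure_contractions`). The channels that dominate the operations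
`a ↦ k* a k` for these contractions `k` converge to `a ↦ v* a v`, since `k* k → 1` weakly, so this
channel is implementable by the limit axiom (`implementableChannel_of_mem_strongClosure`). The
instrument is recovered by measuring the ancilla `L` in a basis (`implementable_measurement`).
-/

set_option linter.unusedSectionVars false

noncomputable section

namespace AgentAxioms

open ContinuousLinearMap Filter

/-! ### Operators on Hilbert space tensor products -/

section TensorTools

variable {H K L H' K' H'' K'' : Type*}
  [NormedAddCommGroup H] [InnerProductSpace ℂ H]
  [NormedAddCommGroup K] [InnerProductSpace ℂ K]
  [NormedAddCommGroup L] [InnerProductSpace ℂ L]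
  [NormedAddCommGroup H'] [InnerProductSpace ℂ H']
  [NormedAddCommGroup K'] [InnerProductSpace ℂ K']
  [NormedAddCommGroup H''] [InnerProductSpace ℂ H'']
  [NormedAddCommGroup K''] [InnerProductSpace ℂ K'']

theorem HTensor.clm_ext {E : Type*} [NormedAddCommGroup E] [NormedSpace ℂ E]
    {f g : HTensor H K →L[ℂ] E} (h : ∀ x y, f (tmulL x y) = g (tmulL x y)) : f = g := by
  apply ContinuousLinearMap.ext_on (dense_span_tmulL (H := H) (K := K))
  rintro _ ⟨x, y, rfl⟩
  exact h x y

theorem HTensor.ext_inner {ζ η : HTensor H K}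
    (h : ∀ x y, ⟪tmulL x y, ζ⟫_ℂ = ⟪tmulL x y, η⟫_ℂ) : ζ = η := by
  have : innerSL ℂ ζ = innerSL ℂ η := HTensor.clm_ext fun x y => by
    simpa using congr(starRingEnd ℂ $(h x y))
  exact ext_inner_right ℂ fun v => congr($this v)

theorem opTensor_comp (a : H →L[ℂ] H') (b : K →L[ℂ] K') (a' : H' →L[ℂ] H'') (b' : K' →L[ℂ] K'') :
    opTensor a' b' ∘L opTensor a b = opTensor (a' ∘L a) (b' ∘L b) :=
  HTensor.clm_ext fun x y => by simp

theorem opTensor_id : opTensor (ContinuousLinearMap.id ℂ H) (ContinuousLinearMap.id ℂ K) =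
    ContinuousLinearMap.id ℂ _ :=
  HTensor.clm_ext fun x y => by simp

theorem opTensor_add_left (a a' : H →L[ℂ] H') (b : K →L[ℂ] K') :
    opTensor (a + a') b = opTensor a b + opTensor a' b :=
  HTensor.clm_ext fun x y => by simp

theorem opTensor_add_right (a : H →L[ℂ] H') (b b' : K →L[ℂ] K') :
    opTensor a (b + b') = opTensor a b + opTensor a b' :=
  HTensor.clm_ext fun x y => by simp

theorem opTensor_smul_left (c : ℂ) (a : H →L[ℂ] H') (b : K →L[ℂ] K') :
    opTensor (c • a) b = c • opTensor a b :=
  HTensor.clm_ext fun x y => by simp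

theorem opTensor_smul_right (c : ℂ) (a : H →L[ℂ] H') (b : K →L[ℂ] K') :
    opTensor a (c • b) = c • opTensor a b :=
  HTensor.clm_ext fun x y => by simp

theorem opTensor_adjoint [CompleteSpace H] [CompleteSpace K] [CompleteSpace H'] [CompleteSpace K']
    (a : H →L[ℂ] H') (b : K →L[ℂ] K') :
    adjoint (opTensor a b) = opTensor (adjoint a) (adjoint b) :=
  HTensor.clm_ext fun x y => HTensor.ext_inner fun x' y' => by
    simp [adjoint_inner_right, inner_tmulL]

theorem opTensor_id_adjoint [CompleteSpace H] [CompleteSpace H'] [CompleteSpace K]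
    (a : H →L[ℂ] H') : adjoint (opTensor a (.id ℂ K)) = opTensor (adjoint a) (.id ℂ K) := by
  rw [opTensor_adjoint, adjoint_id]

/-- The operator `1 ⊗ |y⟩ : H → H ⊗ K`. -/
def ket (H : Type*) [NormedAddCommGroup H] [InnerProductSpace ℂ H] (y : K) : H →L[ℂ] HTensor H K :=
  tmulL.flip y

@[simp]
theorem ket_apply (y : K) (x : H) : ket H y x = tmulL x y := rfl

variable [CompleteSpace H] [CompleteSpace H'] [CompleteSpace H'']

/-- The operator `1 ⊗ ⟨y| : H ⊗ K → H`. -/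
def bra (H : Type*) [NormedAddCommGroup H] [InnerProductSpace ℂ H] [CompleteSpace H] (y : K) :
    HTensor H K →L[ℂ] H :=
  adjoint (ket H y)

@[simp]
theorem bra_tmulL (y : K) (x : H) (z : K) : bra H y (tmulL x z) = ⟪y, z⟫_ℂ • x := by
  refine ext_inner_left ℂ fun w => ?_
  simp [bra, adjoint_inner_right, inner_tmulL, inner_smul_right, mul_comm]

theorem adjoint_ket (y : K) : adjoint (ket H y) = bra H y := rfl

theorem adjoint_bra (y : K) : adjoint (bra H y) = ket H y := adjoint_adjoint _

theorem inner_bra_right (y : K) (x : H) (ζ : HTensor H K) :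
    ⟪x, bra H y ζ⟫_ℂ = ⟪tmulL x y, ζ⟫_ℂ := by
  simp [bra, adjoint_inner_right]

/-- A vector of `H ⊗ K` is determined by its partial inner products with the vectors of `K`. -/
theorem HTensor.ext_bra {ζ η : HTensor H K} (h : ∀ y, bra H y ζ = bra H y η) : ζ = η :=
  HTensor.ext_inner fun x y => by rw [← inner_bra_right, ← inner_bra_right, h]

theorem bra_comp_ket (y z : K) : bra H y ∘L ket H z = ⟪y, z⟫_ℂ • ContinuousLinearMap.id ℂ H := by
  ext x; simp

theorem norm_bra_apply_le (y : K) (ζ : HTensor H K) : ‖bra H y ζ‖ ≤ ‖y‖ * ‖ζ‖ := by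
  refine (le_opNorm _ _).trans ?_
  gcongr
  rw [bra, LinearIsometryEquiv.norm_map]
  exact opNorm_le_bound _ (norm_nonneg _) fun x => by simp [norm_tmulL, mul_comm]

theorem bra_comp_opTensor [CompleteSpace K] [CompleteSpace K']
    (a : H →L[ℂ] H') (b : K →L[ℂ] K') (y : K') :
    bra H' y ∘L opTensor a b = a ∘L bra H (adjoint b y) :=
  HTensor.clm_ext fun x z => by simp [adjoint_inner_left]

theorem bra_opTensor [CompleteSpace K] [CompleteSpace K']
    (a : H →L[ℂ] H') (b : K →L[ℂ] K') (y : K') (ζ : HTensor H K) :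
    bra H' y (opTensor a b ζ) = a (bra H (adjoint b y) ζ) :=
  congr($(bra_comp_opTensor a b y) ζ)

/-- For `b = 1` no adjoint is needed, and `K` need not be complete. -/
theorem bra_opTensor_id (a : H →L[ℂ] H') (y : K) (ζ : HTensor H K) :
    bra H' y (opTensor a (ContinuousLinearMap.id ℂ K) ζ) = a (bra H y ζ) := by
  have : bra H' y ∘L opTensor a (ContinuousLinearMap.id ℂ K) = a ∘L bra H y :=
    HTensor.clm_ext fun x z => by simp
  exact congr($this ζ)

/-- The operator `|f⟩⟨e|`. -/
abbrev ketBra {E F : Type*} [NormedAddCommGroup E] [InnerProductSpace ℂ E]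
    [NormedAddCommGroup F] [InnerProductSpace ℂ F] (f : F) (e : E) : E →L[ℂ] F :=
  InnerProductSpace.rankOne ℂ f e

theorem opTensor_ketBra (a : H →L[ℂ] H') (f : K') (e : K) :
    opTensor a (ketBra f e) = ket H' f ∘L a ∘L bra H e :=
  HTensor.clm_ext fun x y => by simp

/-! The identification of `H ⊗ K` with a Hilbert sum of copies of `H`. -/

theorem norm_ket_apply_of_norm_eq_one {y : K} (hy : ‖y‖ = 1) (x : H) : ‖ket H y x‖ = ‖x‖ := by
  simp [norm_tmulL, hy]

/-- For a unit vector `y`, the isometry `1 ⊗ |y⟩`. -/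
def ketIsom (H : Type*) [NormedAddCommGroup H] [InnerProductSpace ℂ H] {y : K} (hy : ‖y‖ = 1) :
    H →ₗᵢ[ℂ] HTensor H K where
  toLinearMap := ket H y
  norm_map' x := by simp [norm_tmulL, hy]

variable {ι : Type*}

theorem orthogonalFamily_ketIsom {b : ι → K} (hb : Orthonormal ℂ b) :
    OrthogonalFamily ℂ (fun _ : ι => H) (fun i => ketIsom H (hb.1 i)) := by
  intro i j hij x y
  simp [ketIsom, inner_tmulL, hb.2 hij]

theorem isHilbertSum_ketIsom (b : HilbertBasis ι ℂ K) :
    IsHilbertSum ℂ (fun _ : ι => H) (fun i => ketIsom H (b.orthonormal.1 i)) := by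
  refine IsHilbertSum.mk (orthogonalFamily_ketIsom b.orthonormal) ?_
  rw [top_le_iff, Submodule.eq_top_iff']
  intro ζ
  have hd := dense_span_tmulL (H := H) (K := K) ζ
  refine closure_minimal ?_ (Submodule.isClosed_topologicalClosure _) hd
  refine Submodule.span_le.2 ?_
  rintro _ ⟨x, y, rfl⟩
  have h := (b.hasSum_repr y).mapL (tmulL (K := K) x)
  refine (Submodule.isClosed_topologicalClosure _).mem_of_tendsto h (Eventually.of_forall fun s => ?_)
  refine Submodule.sum_mem _ fun i _ => Submodule.le_topologicalClosure _ ?_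
  refine Submodule.mem_iSup_of_mem i ⟨b.repr y i • x, ?_⟩
  simp [ketIsom]

/-- The coordinates of a vector of `H ⊗ K` with respect to a Hilbert basis of `K`, as a unitary
operator. -/
def coordEquiv (H : Type*) [NormedAddCommGroup H] [InnerProductSpace ℂ H] [CompleteSpace H]
    (b : HilbertBasis ι ℂ K) : HTensor H K ≃ₗᵢ[ℂ] lp (fun _ : ι => H) 2 :=
  (isHilbertSum_ketIsom (H := H) b).linearIsometryEquiv

theorem coordEquiv_apply (b : HilbertBasis ι ℂ K) (ζ : HTensor H K) (i : ι) :
    coordEquiv H b ζ i = bra H (b i) ζ := by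
  classical
  refine ext_inner_left ℂ fun x => ?_
  rw [inner_bra_right, ← lp.inner_single_left (𝕜 := ℂ) i x (coordEquiv H b ζ),
    ← (coordEquiv H b).symm.inner_map_map]
  simp [coordEquiv, ketIsom]

/-- Parseval's identity for the decomposition of `H ⊗ K` along a Hilbert basis of `K`. -/
theorem hasSum_inner_bra (b : HilbertBasis ι ℂ K) (ζ η : HTensor H K) :
    HasSum (fun i => ⟪bra H (b i) ζ, bra H (b i) η⟫_ℂ) ⟪ζ, η⟫_ℂ := by
  have := lp.hasSum_inner (𝕜 := ℂ) (coordEquiv H b ζ) (coordEquiv H b η)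
  simpa [coordEquiv_apply] using this

theorem hasSum_ket_bra (b : HilbertBasis ι ℂ K) (ζ : HTensor H K) :
    HasSum (fun i => ket H (b i) (bra H (b i) ζ)) ζ := by
  have := (isHilbertSum_ketIsom (H := H) b).hasSum_linearIsometryEquiv_symm (coordEquiv H b ζ)
  simp only [coordEquiv_apply] at this
  simpa [coordEquiv, ketIsom] using this

/-! Slices of operators. -/

/-- The slice `(1 ⊗ ⟨e|) k (1 ⊗ |f⟩)` of an operator `k : H ⊗ K → H' ⊗ K'`. -/
def slice (k : HTensor H K →L[ℂ] HTensor H' K') (e : K') (f : K) : H →L[ℂ] H' :=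
  bra H' e ∘L k ∘L ket H f

theorem slice_apply (k : HTensor H K →L[ℂ] HTensor H' K') (e : K') (f : K) (x : H) :
    slice k e f x = bra H' e (k (tmulL x f)) := rfl

theorem adjoint_slice [CompleteSpace K] [CompleteSpace K']
    (k : HTensor H K →L[ℂ] HTensor H' K') (e : K') (f : K) :
    adjoint (slice k e f) = slice (adjoint k) f e := by
  simp only [slice, adjoint_comp, adjoint_bra, adjoint_ket]
  rfl

theorem ext_slice {k l : HTensor H K →L[ℂ] HTensor H' K'}
    (h : ∀ e f, slice k e f = slice l e f) : k = l :=
  HTensor.clm_ext fun x f => HTensor.ext_bra fun e => congr($(h e f) x)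

/-- An operator intertwines `m ⊗ 1` and `m' ⊗ 1` iff all its slices intertwine `m` and `m'`. -/
theorem intertwines_iff_slice (k : HTensor H K →L[ℂ] HTensor H' K') (m : H →L[ℂ] H)
    (m' : H' →L[ℂ] H') :
    k ∘L opTensor m (.id ℂ K) = opTensor m' (.id ℂ K') ∘L k ↔
      ∀ e f, slice k e f ∘L m = m' ∘L slice k e f := by
  constructor
  · intro h e f
    ext x
    have := congr(bra H' e ($h (tmulL x f)))
    simpa [slice_apply, bra_opTensor_id] using this
  · intro h
    refine ext_slice fun e f => ?_
    ext x
    have := congr($(h e f) x)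
    simpa [slice_apply, bra_opTensor_id] using this

end TensorTools

/-! ### Strong closures and `M`-operators -/

section StrongClosure

variable {E F G : Type*}
  [NormedAddCommGroup E] [InnerProductSpace ℂ E]
  [NormedAddCommGroup F] [InnerProductSpace ℂ F]
  [NormedAddCommGroup G] [InnerProductSpace ℂ G]

/-- The closure of a set of operators in the strong operator topology. -/
def strongClosure (C : Set (E →L[ℂ] F)) : Set (E →L[ℂ] F) :=
  {k | (k : E → F) ∈ closure ((fun l : E →L[ℂ] F => (l : E → F)) '' C)}

theorem strongClosure_of_tendsto {C : Set (E →L[ℂ] F)} {k : E →L[ℂ] F} {α : Type*} {l : Filter α}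
    [l.NeBot] {u : α → E →L[ℂ] F} (hu : ∀ x, Tendsto (fun i => u i x) l (𝓝 (k x)))
    (hC : ∀ i, u i ∈ C) : k ∈ strongClosure C :=
  mem_closure_of_tendsto (f := fun i => (u i : E → F)) (tendsto_pi_nhds.2 hu)
    (Eventually.of_forall fun i => ⟨u i, hC i, rfl⟩)

theorem strongClosure_minimal {C D : Set (E →L[ℂ] F)} (h : C ⊆ strongClosure D) :
    strongClosure C ⊆ strongClosure D := by
  intro k hk
  refine closure_minimal ?_ isClosed_closure hk
  rintro _ ⟨l, hl, rfl⟩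
  exact h hl

theorem subset_strongClosure (C : Set (E →L[ℂ] F)) : C ⊆ strongClosure C :=
  fun k hk => subset_closure ⟨k, hk, rfl⟩

/-- A condition on operators that is closed for pointwise convergence passes to the strong
closure. -/
theorem strongClosure_induction {C : Set (E →L[ℂ] F)} {P : (E → F) → Prop}
    (hP : IsClosed {g | P g}) (hC : ∀ k ∈ C, P k) {k : E →L[ℂ] F} (hk : k ∈ strongClosure C) :
    P k := by
  refine closure_minimal (t := {g | P g}) ?_ hP hk
  rintro _ ⟨l, hl, rfl⟩
  exact hC l hl

end StrongClosure

section MOperators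

variable {H K₁ K₂ : Type*}
  [NormedAddCommGroup H] [InnerProductSpace ℂ H] [CompleteSpace H]
  [NormedAddCommGroup K₁] [InnerProductSpace ℂ K₁] [CompleteSpace K₁]
  [NormedAddCommGroup K₂] [InnerProductSpace ℂ K₂] [CompleteSpace K₂]

/-- An operator is a strong limit of linear combinations of its slices, tensored with rank one
operators. -/
theorem mem_strongClosure_of_slice (k : HTensor H K₁ →L[ℂ] HTensor H K₂)
    {C : Set (H →L[ℂ] H)} (hk : ∀ e f, slice k e f ∈ C) :
    k ∈ strongClosure (Submodule.span ℂ {c | ∃ a ∈ C, ∃ (f : K₂) (e : K₁),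
      c = opTensor a (ketBra f e)} : Set (HTensor H K₁ →L[ℂ] HTensor H K₂)) := by
  obtain ⟨w₁, b₁, -⟩ := exists_hilbertBasis ℂ K₁
  obtain ⟨w₂, b₂, -⟩ := exists_hilbertBasis ℂ K₂
  set S := Submodule.span ℂ {c | ∃ a ∈ C, ∃ (f : K₂) (e : K₁), c = opTensor a (ketBra f e)}
  have h1 : k ∈ strongClosure (Set.range fun s : Finset w₁ =>
      ∑ j ∈ s, k ∘L ket H (b₁ j) ∘L bra H (b₁ j)) := by
    refine strongClosure_of_tendsto (l := atTop)
      (u := fun s : Finset w₁ => ∑ j ∈ s, k ∘L ket H (b₁ j) ∘L bra H (b₁ j)) (fun ζ => ?_)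
      (fun s => ⟨s, rfl⟩)
    have := (hasSum_ket_bra b₁ ζ).mapL k
    simpa [HasSum, _root_.sum_apply] using this
  refine strongClosure_minimal ?_ h1
  rintro _ ⟨s, rfl⟩
  refine strongClosure_of_tendsto (l := atTop)
      (u := fun t : Finset w₂ => ∑ i ∈ t, ∑ j ∈ s,
        opTensor (slice k (b₂ i) (b₁ j)) (ketBra (b₂ i) (b₁ j))) (fun ζ => ?_) (fun t => ?_)
  · have := hasSum_ket_bra b₂ ((∑ j ∈ s, k ∘L ket H (b₁ j) ∘L bra H (b₁ j)) ζ)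
    simpa only [HasSum, _root_.sum_apply, opTensor_ketBra, slice, map_sum,
      ContinuousLinearMap.comp_apply, SummationFilter.unconditional_filter] using this
  · refine S.sum_mem fun i _ => S.sum_mem fun j _ => Submodule.subset_span ⟨_, hk _ _, _, _, rfl⟩

end MOperators

section MOps

variable {H : Type*} [NormedAddCommGroup H] [InnerProductSpace ℂ H] [CompleteSpace H]

theorem mem_mOperators_iff_mem_strongClosure {M : VonNeumannAlgebra H} {K₁ K₂ : Ancilla}
    {k : Joint H K₁ →L[ℂ] Joint H K₂} :
    k ∈ mOperators M K₁ K₂ ↔ k ∈ strongClosure (Submodule.span ℂ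
      {c | ∃ a ∈ M, ∃ b : K₁ →L[ℂ] K₂, c = opTensor a b} :
          Set (Joint H K₁ →L[ℂ] Joint H K₂)) := by
  rw [mOperators, Set.mem_ofPred_eq,
    (PointwiseConvergenceCLM.isEmbedding_coeFn (RingHom.id ℂ) (Joint H K₁)
      (Joint H K₂)).closure_eq_preimage_closure_image, strongClosure, Set.mem_preimage,
    Set.image_image]
  rfl

theorem mem_commutant_iff' {M : VonNeumannAlgebra H} {m : H →L[ℂ] H} :
    m ∈ M.commutant ↔ ∀ a ∈ M, a ∘L m = m ∘L a := by
  rw [VonNeumannAlgebra.mem_commutant_iff]; rfl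

/-- The commutation theorem `M ⊗̄ B(K₁, K₂) = (M' ⊗ 1)'`. -/
theorem mem_mOperators_iff_commute {M : VonNeumannAlgebra H} {K₁ K₂ : Ancilla}
    {k : Joint H K₁ →L[ℂ] Joint H K₂} :
    k ∈ mOperators M K₁ K₂ ↔
      ∀ m ∈ M.commutant, k ∘L opTensor m (.id ℂ K₁) = opTensor m (.id ℂ K₂) ∘L k := by
  rw [mem_mOperators_iff_mem_strongClosure]
  constructor
  · intro hk m hm
    ext ζ
    refine strongClosure_induction (P := fun g : Joint H K₁ → Joint H K₂ =>
      g (opTensor m (.id ℂ K₁) ζ) = opTensor m (.id ℂ K₂) (g ζ)) ?_ ?_ hk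
    · exact isClosed_eq (by fun_prop) (by fun_prop)
    · intro l hl
      induction hl using Submodule.span_induction with
      | mem x h =>
        obtain ⟨a, ha, b, rfl⟩ := h
        have h1 := mem_commutant_iff'.1 hm a ha
        simp only [← ContinuousLinearMap.comp_apply, opTensor_comp]
        rw [h1]
        simp
      | zero => simp
      | add x y _ _ hx hy => simp [hx, hy]
      | smul c x _ hx => simp [hx]
  · intro h
    have hs : ∀ e f, slice k e f ∈ M := by
      intro e f
      rw [← VonNeumannAlgebra.commutant_commutant M, mem_commutant_iff']
      intro m hm
      exact ((intertwines_iff_slice k m m).1 (h m hm) e f).symm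
    refine strongClosure_minimal ?_ (mem_strongClosure_of_slice k hs)
    refine fun x hx => subset_strongClosure _ (Submodule.span_mono ?_ hx)
    rintro _ ⟨a, ha, f, e, rfl⟩
    exact ⟨a, ha, _, rfl⟩

/-- The operators in `M ⊗̄ B(K₁, K₂)` are those with all slices in `M`. -/
theorem mem_mOperators_iff_slice {M : VonNeumannAlgebra H} {K₁ K₂ : Ancilla}
    {k : Joint H K₁ →L[ℂ] Joint H K₂} :
    k ∈ mOperators M K₁ K₂ ↔ ∀ e f, slice k e f ∈ M := by
  rw [mem_mOperators_iff_commute]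
  constructor
  · intro h e f
    rw [← VonNeumannAlgebra.commutant_commutant M, mem_commutant_iff']
    intro m hm
    exact ((intertwines_iff_slice k m m).1 (h m hm) e f).symm
  · intro h m hm
    exact (intertwines_iff_slice k m m).2 fun e f => mem_commutant_iff'.1 hm _ (h e f)

theorem opTensor_mem_mOperators {M : VonNeumannAlgebra H} {K₁ K₂ : Ancilla}
    {a : H →L[ℂ] H} (ha : a ∈ M) (b : K₁ →L[ℂ] K₂) : opTensor a b ∈ mOperators M K₁ K₂ :=
  mem_mOperators_iff_mem_strongClosure.2
    (subset_strongClosure _ (Submodule.subset_span ⟨a, ha, b, rfl⟩))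

theorem comp_mem_mOperators {M : VonNeumannAlgebra H} {K₁ K₂ K₃ : Ancilla}
    {k : Joint H K₁ →L[ℂ] Joint H K₂} {l : Joint H K₂ →L[ℂ] Joint H K₃}
    (hl : l ∈ mOperators M K₂ K₃) (hk : k ∈ mOperators M K₁ K₂) :
    l ∘L k ∈ mOperators M K₁ K₃ := by
  rw [mem_mOperators_iff_commute] at *
  intro m hm
  rw [comp_assoc, hk m hm, ← comp_assoc, hl m hm, comp_assoc]

theorem adjoint_mem_mOperators {M : VonNeumannAlgebra H} {K₁ K₂ : Ancilla}
    {k : Joint H K₁ →L[ℂ] Joint H K₂} (hk : k ∈ mOperators M K₁ K₂) :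
    adjoint k ∈ mOperators M K₂ K₁ := by
  rw [mem_mOperators_iff_slice] at *
  intro e f
  rw [← adjoint_slice]
  exact star_mem (hk f e)

theorem add_mem_mOperators {M : VonNeumannAlgebra H} {K₁ K₂ : Ancilla}
    {k l : Joint H K₁ →L[ℂ] Joint H K₂} (hk : k ∈ mOperators M K₁ K₂)
    (hl : l ∈ mOperators M K₁ K₂) : k + l ∈ mOperators M K₁ K₂ := by
  rw [mem_mOperators_iff_commute] at *
  intro m hm
  rw [add_comp, comp_add, hk m hm, hl m hm]

end MOps

/-! ### Normal functionals and normal maps -/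

section Normality

variable {H H₁ H₂ : Type*}
  [NormedAddCommGroup H] [InnerProductSpace ℂ H] [CompleteSpace H]
  [NormedAddCommGroup H₁] [InnerProductSpace ℂ H₁] [CompleteSpace H₁]
  [NormedAddCommGroup H₂] [InnerProductSpace ℂ H₂] [CompleteSpace H₂]

theorem isNormalFunctional_of_hasSum {ι : Type*} [Countable ι] {φ : (H →L[ℂ] H) →ₗ[ℂ] ℂ}
    {ξ η : ι → H} (hξ : Summable fun i => ‖ξ i‖ ^ 2) (hη : Summable fun i => ‖η i‖ ^ 2)
    (h : ∀ a : H →L[ℂ] H, HasSum (fun i => ⟪ξ i, a (η i)⟫_ℂ) (φ a)) : IsNormalFunctional φ := by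
  obtain ⟨f, hf⟩ := exists_injective_nat ι
  have h0 : ∀ n ∉ Set.range f, Function.extend f ξ 0 n = 0 := fun n hn => by
    rw [Function.extend_apply' _ _ _ (by simpa using hn)]; rfl
  have h0' : ∀ n ∉ Set.range f, Function.extend f η 0 n = 0 := fun n hn => by
    rw [Function.extend_apply' _ _ _ (by simpa using hn)]; rfl
  refine ⟨Function.extend f ξ 0, Function.extend f η 0, ?_, ?_, fun a => ?_⟩
  · rw [← hf.summable_iff (fun n hn => by simp [h0 n hn])]
    simpa [Function.comp_def, hf.extend_apply] using hξ
  · rw [← hf.summable_iff (fun n hn => by simp [h0' n hn])]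
    simpa [Function.comp_def, hf.extend_apply] using hη
  · rw [← hf.hasSum_iff (fun n hn => by simp [h0 n hn])]
    simpa [Function.comp_def, hf.extend_apply] using h a

/-- The functional `a ↦ ⟪ξ, a ψ⟫`. -/
def vecFunctional (ξ ψ : H) : (H →L[ℂ] H) →ₗ[ℂ] ℂ where
  toFun a := ⟪ξ, a ψ⟫_ℂ
  map_add' a b := by simp
  map_smul' c a := by simp

@[simp]
theorem vecFunctional_apply (ξ ψ : H) (a : H →L[ℂ] H) : vecFunctional ξ ψ a = ⟪ξ, a ψ⟫_ℂ := rfl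

theorem isNormalFunctional_vecFunctional (ξ ψ : H) : IsNormalFunctional (vecFunctional ξ ψ) :=
  isNormalFunctional_of_hasSum (ι := Unit) (ξ := fun _ => ξ) (η := fun _ => ψ)
    (Summable.of_finite) (Summable.of_finite) fun a => by
      simp

/-- Convergence in the σ-weak topology is convergence of all normal functionals. -/
theorem tendsto_sigmaWeak_iff {α : Type*} {l : Filter α} {u : α → H →L[ℂ] H} {a : H →L[ℂ] H} :
    Tendsto u l (@nhds _ (sigmaWeak H) a) ↔
      ∀ φ : (H →L[ℂ] H) →ₗ[ℂ] ℂ, IsNormalFunctional φ → Tendsto (fun i => φ (u i)) l (𝓝 (φ a)) := by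
  simp only [nhds_iInf, nhds_induced, tendsto_iInf, tendsto_comap_iff,
    Function.comp_def]

theorem Summable.norm_mul_norm {ι : Type*} {ξ η : ι → H} (hξ : Summable fun i => ‖ξ i‖ ^ 2)
    (hη : Summable fun i => ‖η i‖ ^ 2) : Summable fun i => ‖ξ i‖ * ‖η i‖ := by
  refine Summable.of_nonneg_of_le (fun i => by positivity) (fun i => ?_) (hξ.add hη)
  nlinarith [sq_nonneg (‖ξ i‖ - ‖η i‖), sq_nonneg (‖ξ i‖), sq_nonneg (‖η i‖)]

/-- On bounded sets, normal functionals are continuous for the weak operator topology. -/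
theorem IsNormalFunctional.tendsto {φ : (H →L[ℂ] H) →ₗ[ℂ] ℂ} (hφ : IsNormalFunctional φ)
    {α : Type*} {l : Filter α} {u : α → H →L[ℂ] H} {a : H →L[ℂ] H} {C : ℝ}
    (hC : ∀ i, ‖u i‖ ≤ C)
    (hu : ∀ ξ ψ, Tendsto (fun i => ⟪ξ, u i ψ⟫_ℂ) l (𝓝 ⟪ξ, a ψ⟫_ℂ)) :
    Tendsto (fun i => φ (u i)) l (𝓝 (φ a)) := by
  obtain ⟨ξ, η, hξ, hη, h⟩ := hφ
  simp only [fun a => (h a).tsum_eq.symm]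
  refine tendsto_tsum_of_dominated_convergence (bound := fun n => C * (‖ξ n‖ * ‖η n‖))
    ((Summable.norm_mul_norm hξ hη).mul_left C) (fun n => hu _ _) (Eventually.of_forall fun i n => ?_)
  calc ‖⟪ξ n, u i (η n)⟫_ℂ‖ ≤ ‖ξ n‖ * ‖u i (η n)‖ := norm_inner_le_norm _ _
    _ ≤ ‖ξ n‖ * (C * ‖η n‖) := by
        gcongr
        exact (le_opNorm _ _).trans (by gcongr; exact hC i)
    _ = _ := by ring

theorem isNormalMap_of_comp {T : (H₂ →L[ℂ] H₂) →ₗ[ℂ] (H₁ →L[ℂ] H₁)}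
    (h : ∀ φ : (H₁ →L[ℂ] H₁) →ₗ[ℂ] ℂ, IsNormalFunctional φ → IsNormalFunctional (φ ∘ₗ T)) :
    IsNormalMap T := by
  refine continuous_iInf_rng.2 fun φ => continuous_iInf_rng.2 fun hφ => continuous_induced_rng.2 ?_
  exact continuous_iInf_dom (i := φ ∘ₗ T) (continuous_iInf_dom (i := h φ hφ) continuous_induced_dom)

theorem IsNormalMap.tendsto {T : (H₂ →L[ℂ] H₂) →ₗ[ℂ] (H₁ →L[ℂ] H₁)} (hT : IsNormalMap T)
    {α : Type*} {l : Filter α} {u : α → H₂ →L[ℂ] H₂} {a : H₂ →L[ℂ] H₂} {C : ℝ}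
    (hC : ∀ i, ‖u i‖ ≤ C)
    (hu : ∀ ξ ψ, Tendsto (fun i => ⟪ξ, u i ψ⟫_ℂ) l (𝓝 ⟪ξ, a ψ⟫_ℂ)) (ξ ψ : H₁) :
    Tendsto (fun i => ⟪ξ, T (u i) ψ⟫_ℂ) l (𝓝 ⟪ξ, T a ψ⟫_ℂ) := by
  have h1 : Tendsto u l (@nhds _ (sigmaWeak H₂) a) :=
    tendsto_sigmaWeak_iff.2 fun φ hφ => hφ.tendsto hC hu
  have h2 := (@Continuous.tendsto _ _ (sigmaWeak H₂) (sigmaWeak H₁) _ hT a).comp h1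
  exact tendsto_sigmaWeak_iff.1 h2 _ (isNormalFunctional_vecFunctional ξ ψ)

@[simp]
theorem conjMap_apply (v : H₁ →L[ℂ] H₂) (a : H₂ →L[ℂ] H₂) :
    conjMap v a = adjoint v ∘L a ∘L v := rfl

theorem inner_conjMap (v : H₁ →L[ℂ] H₂) (a : H₂ →L[ℂ] H₂) (ξ ψ : H₁) :
    ⟪ξ, conjMap v a ψ⟫_ℂ = ⟪v ξ, a (v ψ)⟫_ℂ := by
  simp [adjoint_inner_right]

theorem conjMap_comp {H₃ : Type*} [NormedAddCommGroup H₃] [InnerProductSpace ℂ H₃]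
    [CompleteSpace H₃] (v : H₁ →L[ℂ] H₂) (w : H₂ →L[ℂ] H₃) :
    conjMap v ∘ₗ conjMap w = conjMap (w ∘L v) := by
  ext a : 1
  simp [adjoint_comp, comp_assoc]

/-- `k` is a family of Kraus operators of `T`. -/
abbrev IsKraus {ι : Type*} (k : ι → H₁ →L[ℂ] H₂) (T : (H₂ →L[ℂ] H₂) →ₗ[ℂ] (H₁ →L[ℂ] H₁)) : Prop :=
  IsMapSum (fun i => conjMap (k i)) T

theorem IsKraus.hasSum_inner {ι : Type*} {k : ι → H₁ →L[ℂ] H₂}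
    {T : (H₂ →L[ℂ] H₂) →ₗ[ℂ] (H₁ →L[ℂ] H₁)} (h : IsKraus k T) (a : H₂ →L[ℂ] H₂) (ξ ψ : H₁) :
    HasSum (fun i => ⟪k i ξ, a (k i ψ)⟫_ℂ) ⟪ξ, T a ψ⟫_ℂ := by
  simpa only [inner_conjMap] using h a ξ ψ

theorem IsKraus.hasSum_norm_sq {ι : Type*} {k : ι → H₁ →L[ℂ] H₂}
    {T : (H₂ →L[ℂ] H₂) →ₗ[ℂ] (H₁ →L[ℂ] H₁)} (h : IsKraus k T) (ξ : H₁) :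
    HasSum (fun i => ‖k i ξ‖ ^ 2) (RCLike.re ⟪ξ, T 1 ξ⟫_ℂ) := by
  have := (h.hasSum_inner 1 ξ ξ).mapL (RCLike.reCLM (K := ℂ))
  simpa [← inner_self_eq_norm_sq (𝕜 := ℂ)] using this

theorem IsKraus.isNormalMap {ι : Type*} [Countable ι] {k : ι → H₁ →L[ℂ] H₂}
    {T : (H₂ →L[ℂ] H₂) →ₗ[ℂ] (H₁ →L[ℂ] H₁)} (h : IsKraus k T) : IsNormalMap T := by
  refine isNormalMap_of_comp fun φ ⟨ξ, η, hξ, hη, hφ⟩ => ?_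
  have key : ∀ ζ : ℕ → H₁, Summable (fun n => ‖ζ n‖ ^ 2) →
      Summable fun p : ℕ × ι => ‖k p.2 (ζ p.1)‖ ^ 2 := by
    intro ζ hζ
    rw [summable_prod_of_nonneg fun _ => by positivity]
    refine ⟨fun n => (h.hasSum_norm_sq (ζ n)).summable, ?_⟩
    simp only [fun n => (h.hasSum_norm_sq (ζ n)).tsum_eq]
    refine Summable.of_nonneg_of_le (fun n => ?_) (fun n => ?_) (hζ.mul_left ‖T 1‖)
    · exact (h.hasSum_norm_sq (ζ n)).nonneg fun _ => by positivity
    · calc RCLike.re ⟪ζ n, T 1 (ζ n)⟫_ℂ ≤ ‖ζ n‖ * ‖T 1 (ζ n)‖ :=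
            re_inner_le_norm _ _
        _ ≤ ‖ζ n‖ * (‖T 1‖ * ‖ζ n‖) := by gcongr; exact le_opNorm _ _
        _ = _ := by ring
  refine isNormalFunctional_of_hasSum (key ξ hξ) (key η hη) fun a => ?_
  have hs : Summable fun p : ℕ × ι => ⟪k p.2 (ξ p.1), a (k p.2 (η p.1))⟫_ℂ := by
    refine Summable.of_norm_bounded ((Summable.norm_mul_norm (key ξ hξ) (key η hη)).mul_left ‖a‖)
      fun p => ?_
    calc _ ≤ ‖k p.2 (ξ p.1)‖ * ‖a (k p.2 (η p.1))‖ := norm_inner_le_norm _ _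
      _ ≤ ‖k p.2 (ξ p.1)‖ * (‖a‖ * ‖k p.2 (η p.1)‖) := by gcongr; exact le_opNorm _ _
      _ = _ := by ring
  have h1 := hs.hasSum.prod_fiberwise fun n => h.hasSum_inner a (ξ n) (η n)
  rw [LinearMap.comp_apply, ← h1.unique (hφ (T a))]
  exact hs.hasSum

end Normality

/-! ### Complete positivity -/

section CompletePositivity

theorem complex_inner_self_nonneg {E : Type*} [NormedAddCommGroup E] [InnerProductSpace ℂ E]
    (x : E) : 0 ≤ ⟪x, x⟫_ℂ := by
  exact Complex.nonneg_iff.2 ⟨inner_self_nonneg (𝕜 := ℂ), (inner_self_im (𝕜 := ℂ) x).symm⟩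

/-- Orthogonal decomposition of a self-adjoint element into positive and negative part. -/
theorem exists_pos_sub_pos {A : Type*} [NonUnitalCStarAlgebra A] [PartialOrder A]
    [StarOrderedRing A] {c : A} (hc : IsSelfAdjoint c) :
    ∃ p q : A, 0 ≤ p ∧ 0 ≤ q ∧ c = p - q ∧ q * p = 0 :=
  ⟨c⁺, c⁻, CFC.posPart_nonneg c, CFC.negPart_nonneg c, (CFC.posPart_sub_negPart c hc).symm,
    CFC.negPart_mul_posPart c⟩

theorem nonneg_exists_star_mul_self {A : Type*} [NonUnitalCStarAlgebra A] [PartialOrder A]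
    [StarOrderedRing A] {c : A} (hc : 0 ≤ c) : ∃ d, c = star d * d :=
  CStarAlgebra.nonneg_iff_eq_star_mul_self.1 hc

variable {H : Type*} [NormedAddCommGroup H] [InnerProductSpace ℂ H] [CompleteSpace H]
  {n : Type*} [Fintype n]

/-- The sesquilinear form on `Hⁿ` of an operator matrix. -/
def matForm (c : CStarMatrix n n (H →L[ℂ] H)) (ξ η : n → H) : ℂ :=
  ∑ i, ∑ j, ⟪ξ i, c i j (η j)⟫_ℂ

theorem matForm_sub (c d : CStarMatrix n n (H →L[ℂ] H)) (ξ η : n → H) :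
    matForm (c - d) ξ η = matForm c ξ η - matForm d ξ η := by
  simp [matForm, Finset.sum_sub_distrib]

theorem matForm_neg (c : CStarMatrix n n (H →L[ℂ] H)) (ξ η : n → H) :
    matForm (-c) ξ η = - matForm c ξ η := by
  simp [matForm]

theorem matForm_star (c : CStarMatrix n n (H →L[ℂ] H)) (ξ η : n → H) :
    matForm (star c) ξ η = starRingEnd ℂ (matForm c η ξ) := by
  simp only [matForm, map_sum, inner_conj_symm]
  rw [Finset.sum_comm]
  simp [CStarMatrix.star_apply, star_eq_adjoint, adjoint_inner_right]

theorem matForm_conj (c d : CStarMatrix n n (H →L[ℂ] H)) (ξ η : n → H) :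
    matForm (star d * c * d) ξ η =
      matForm c (fun i => ∑ j, d i j (ξ j)) (fun i => ∑ j, d i j (η j)) := by
  simp only [matForm, CStarMatrix.mul_apply, CStarMatrix.star_apply, _root_.sum_apply, map_sum,
    sum_inner, inner_sum, star_eq_adjoint, Finset.sum_mul]
  have rev3 (F : n → n → n → ℂ) : ∑ j, ∑ k, ∑ l, F j k l = ∑ l, ∑ k, ∑ j, F j k l :=
    (Finset.sum_congr rfl fun j _ => Finset.sum_comm).trans
      (Finset.sum_comm.trans (Finset.sum_congr rfl fun l _ => Finset.sum_comm))
  rw [Finset.sum_congr rfl fun i _ => rev3 _, Finset.sum_comm]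
  refine Finset.sum_congr rfl fun l _ => ?_
  rw [Finset.sum_comm]
  refine Finset.sum_congr rfl fun k _ => ?_
  rw [Finset.sum_comm]
  refine Finset.sum_congr rfl fun j _ => Finset.sum_congr rfl fun i _ => ?_
  exact adjoint_inner_right _ _ _

theorem eq_zero_of_matForm {c : CStarMatrix n n (H →L[ℂ] H)} (h : ∀ ξ, matForm c ξ ξ = 0) :
    c = 0 := by
  classical
  have h0 : ∀ ξ η, matForm c ξ η = 0 := by
    intro ξ η
    have h1 := h (ξ + η)
    have h2 := h (ξ + Complex.I • η)
    have e1 : matForm c (ξ + η) (ξ + η) = matForm c ξ ξ + matForm c ξ η + matForm c η ξ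
        + matForm c η η := by
      simp only [matForm, ← Finset.sum_add_distrib]
      refine Finset.sum_congr rfl fun i _ => Finset.sum_congr rfl fun j _ => ?_
      simp only [Pi.add_apply, map_add, inner_add_left, inner_add_right]; ring
    have e2 : matForm c (ξ + Complex.I • η) (ξ + Complex.I • η) = matForm c ξ ξ
        + Complex.I * matForm c ξ η - Complex.I * matForm c η ξ
        + matForm c η η := by
      simp only [matForm, ← Finset.sum_add_distrib, Finset.mul_sum, ← Finset.sum_sub_distrib]
      refine Finset.sum_congr rfl fun i _ => Finset.sum_congr rfl fun j _ => ?_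
      simp only [Pi.add_apply, Pi.smul_apply, map_add, map_smul, inner_add_left, inner_add_right,
        inner_smul_left, inner_smul_right, Complex.conj_I]
      linear_combination (-⟪η i, (c i j) (η j)⟫_ℂ) * Complex.I_sq
    rw [e1, h ξ, h η] at h1
    rw [e2, h ξ, h η] at h2
    have h3 : Complex.I * (matForm c ξ η - matForm c η ξ) = 0 := by linear_combination h2
    have h4 := (mul_eq_zero.1 h3).resolve_left Complex.I_ne_zero
    linear_combination (h1 + h4) / 2
  refine CStarMatrix.ext fun i j => ?_
  ext y
  refine ext_inner_left ℂ fun x => ?_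
  have := h0 (Pi.single i x) (Pi.single j y)
  rw [matForm, Finset.sum_eq_single i, Finset.sum_eq_single j] at this
  · simpa using this
  · intro b _ hb; simp [hb]
  · simp
  · intro b _ hb; simp [hb]
  · simp

theorem matForm_nonneg {c : CStarMatrix n n (H →L[ℂ] H)} (hc : 0 ≤ c) (ξ : n → H) :
    0 ≤ matForm c ξ ξ := by
  classical
  obtain ⟨d, rfl⟩ := nonneg_exists_star_mul_self hc
  have := matForm_conj 1 d ξ ξ
  rw [mul_one] at this
  rw [this, matForm]
  refine Finset.sum_nonneg fun i _ => ?_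
  rw [Finset.sum_eq_single i]
  · simp
  · intro j _ hj; simp [CStarMatrix.one_apply_ne hj.symm]
  · simp

/-- Positivity in the C*-algebra of operator matrices is positivity of the sesquilinear form. This
translates between the C*-algebraic order, in which complete positivity is defined, and inner
products. -/
theorem cstarMatrix_nonneg_iff {c : CStarMatrix n n (H →L[ℂ] H)} :
    0 ≤ c ↔ ∀ ξ, 0 ≤ matForm c ξ ξ := by
  refine ⟨fun hc => matForm_nonneg hc, fun h => ?_⟩
  have hsa : IsSelfAdjoint c := by
    rw [IsSelfAdjoint, ← sub_eq_zero]
    refine eq_zero_of_matForm fun ξ => ?_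
    rw [matForm_sub, matForm_star, sub_eq_zero]
    exact Complex.conj_eq_iff_im.2 (Complex.nonneg_iff.1 (h ξ)).2.symm
  obtain ⟨p, q, hp, hq, rfl, hqp⟩ := exists_pos_sub_pos hsa
  have hqs : star q = q := hq.isSelfAdjoint
  -- the negative part `q` vanishes, since `q (p - q) q = -q³`
  have hc : q * (p - q) * q = -(q * q * q) := by
    rw [mul_sub, hqp, zero_sub, neg_mul]
  have h3 : q * q * q = 0 := by
    refine eq_zero_of_matForm fun ξ => le_antisymm ?_ ?_
    · have := h fun i => ∑ j, q i j (ξ j)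
      rw [← matForm_conj, hqs, hc, matForm_neg] at this
      simpa using this
    · have := matForm_nonneg hq fun i => ∑ j, q i j (ξ j)
      rwa [← matForm_conj, hqs] at this
  have h2 : q * q = 0 := by
    rw [← CStarRing.star_mul_self_eq_zero_iff, star_mul, hqs, ← mul_assoc, h3, zero_mul]
  have h1 : q = 0 := by
    rw [← CStarRing.star_mul_self_eq_zero_iff, hqs, h2]
  rwa [h1, sub_zero]

variable {H₁ H₂ : Type*}
  [NormedAddCommGroup H₁] [InnerProductSpace ℂ H₁] [CompleteSpace H₁]
  [NormedAddCommGroup H₂] [InnerProductSpace ℂ H₂] [CompleteSpace H₂]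

theorem isCP_iff {T : (H₂ →L[ℂ] H₂) →ₗ[ℂ] (H₁ →L[ℂ] H₁)} :
    IsCP T ↔ ∀ (m : ℕ) (c : CStarMatrix (Fin m) (Fin m) (H₂ →L[ℂ] H₂)), 0 ≤ c → 0 ≤ c.map T := by
  constructor
  · rintro ⟨S, rfl⟩ m c hc
    exact S.map_cstarMatrix_nonneg' m c hc
  · intro h
    exact ⟨{ T with map_cstarMatrix_nonneg' := h }, rfl⟩

/-- Maps with a Kraus decomposition are completely positive. -/
theorem IsKraus.isCP {ι : Type*} {k : ι → H₁ →L[ℂ] H₂}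
    {T : (H₂ →L[ℂ] H₂) →ₗ[ℂ] (H₁ →L[ℂ] H₁)} (h : IsKraus k T) : IsCP T := by
  rw [isCP_iff]
  intro m c hc
  rw [cstarMatrix_nonneg_iff]
  intro ξ
  have h1 : HasSum (fun l => ∑ i, ∑ j, ⟪k l (ξ i), c i j (k l (ξ j))⟫_ℂ) (matForm (c.map T) ξ ξ) :=
    hasSum_sum fun i _ => hasSum_sum fun j _ => h.hasSum_inner (c i j) (ξ i) (ξ j)
  exact h1.nonneg fun l => cstarMatrix_nonneg_iff.1 hc fun i => k l (ξ i)

/-- The form of complete positivity in terms of the operators `aᵢ* aⱼ`. -/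
theorem IsCP.nonneg_sum {T : (H₂ →L[ℂ] H₂) →ₗ[ℂ] (H₁ →L[ℂ] H₁)} (hT : IsCP T)
    (a : n → H₂ →L[ℂ] H₂) (ξ : n → H₁) :
    0 ≤ ∑ i, ∑ j, ⟪ξ i, T (adjoint (a i) ∘L a j) (ξ j)⟫_ℂ := by
  obtain ⟨S, rfl⟩ := hT
  obtain ⟨c, hcij⟩ : ∃ c : CStarMatrix n n (H₂ →L[ℂ] H₂), ∀ i j, c i j = adjoint (a i) ∘L a j :=
    ⟨CStarMatrix.ofMatrix fun i j => adjoint (a i) ∘L a j, fun _ _ => rfl⟩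
  have hc : 0 ≤ c := by
    rw [cstarMatrix_nonneg_iff]
    intro η
    have : matForm c η η = ⟪∑ i, a i (η i), ∑ j, a j (η j)⟫_ℂ := by
      simp only [sum_inner, inner_sum, matForm]
      refine Finset.sum_comm.trans <| Finset.sum_congr rfl fun i _ =>
        Finset.sum_congr rfl fun j _ => ?_
      rw [hcij, comp_apply, adjoint_inner_right]
    rw [this]
    exact complex_inner_self_nonneg _
  have := cstarMatrix_nonneg_iff.1 (S.map_cstarMatrix_nonneg c hc) ξ
  simp only [matForm, CStarMatrix.map_apply, hcij] at this
  exact this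

/-- Completely positive maps are positive. -/
theorem IsCP.map_nonneg {T : (H₂ →L[ℂ] H₂) →ₗ[ℂ] (H₁ →L[ℂ] H₁)} (hT : IsCP T)
    {a : H₂ →L[ℂ] H₂} (ha : 0 ≤ a) : 0 ≤ T a := by
  obtain ⟨S, rfl⟩ := hT
  exact _root_.map_nonneg S ha

end CompletePositivity

/-! ### Kraus decompositions of normal completely positive maps -/

section KrausTheorem

theorem nonneg_iff_inner {E : Type*} [NormedAddCommGroup E] [InnerProductSpace ℂ E]
    [CompleteSpace E] {a : E →L[ℂ] E} : 0 ≤ a ↔ ∀ x, 0 ≤ ⟪x, a x⟫_ℂ := by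
  rw [nonneg_iff_isPositive, isPositive_iff_complex]
  refine forall_congr' fun x => ?_
  rw [Complex.nonneg_iff, ← inner_conj_symm x (a x)]
  simp only [RCLike.re_to_complex, Complex.conj_re, Complex.conj_im]
  constructor
  · rintro ⟨h1, h2⟩
    refine ⟨h2, ?_⟩
    rw [← h1]; simp
  · rintro ⟨h1, h2⟩
    exact ⟨Complex.ext (by simp) (by simpa [eq_comm] using h2), h1⟩

theorem _root_.Orthonormal.countable {E ι : Type*} [NormedAddCommGroup E] [InnerProductSpace ℂ E]
    [TopologicalSpace.SeparableSpace E] {v : ι → E} (hv : Orthonormal ℂ v) : Countable ι := by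
  refine Pairwise.countable_of_isOpen_disjoint (s := fun i => Metric.ball (v i) (1 / 2)) ?_
    (fun i => Metric.isOpen_ball) (fun i => ⟨v i, Metric.mem_ball_self (by norm_num)⟩)
  intro i j hij
  refine Metric.ball_disjoint_ball ?_
  rw [dist_eq_norm]
  have h : ‖v i - v j‖ ^ 2 = 2 := by
    rw [@norm_sub_sq ℂ, hv.1 i, hv.1 j, hv.2 hij]; norm_num
  nlinarith [norm_nonneg (v i - v j)]

variable {H₁ H₂ : Type*}
  [NormedAddCommGroup H₁] [InnerProductSpace ℂ H₁] [CompleteSpace H₁]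
  [NormedAddCommGroup H₂] [InnerProductSpace ℂ H₂] [CompleteSpace H₂]

/-- The projection `∑ᵢ |vᵢ⟩⟨vᵢ|` onto the span of finitely many members of an orthonormal
family. -/
def finProj {E ι : Type*} [NormedAddCommGroup E] [InnerProductSpace ℂ E] (v : ι → E)
    (s : Finset ι) : E →L[ℂ] E :=
  ∑ i ∈ s, ketBra (v i) (v i)

section FinProj

variable {E ι : Type*} [NormedAddCommGroup E] [InnerProductSpace ℂ E] {v : ι → E}

theorem finProj_apply (s : Finset ι) (x : E) : finProj v s x = ∑ i ∈ s, ⟪v i, x⟫_ℂ • v i := by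
  simp [finProj, _root_.sum_apply]

theorem inner_finProj (s : Finset ι) (x y : E) :
    ⟪x, finProj v s y⟫_ℂ = ∑ i ∈ s, ⟪x, v i⟫_ℂ * ⟪v i, y⟫_ℂ := by
  simp [finProj_apply, mul_comm]

theorem inner_finProj_self_le (hv : Orthonormal ℂ v) (s : Finset ι) (x : E) :
    ⟪x, finProj v s x⟫_ℂ ≤ ⟪x, x⟫_ℂ := by
  rw [inner_finProj, inner_self_eq_norm_sq_to_K]
  have h1 : ∑ i ∈ s, ⟪x, v i⟫_ℂ * ⟪v i, x⟫_ℂ = ((∑ i ∈ s, ‖⟪v i, x⟫_ℂ‖ ^ 2 : ℝ) : ℂ) := by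
    push_cast
    refine Finset.sum_congr rfl fun i _ => ?_
    rw [← inner_conj_symm, ← Complex.normSq_eq_conj_mul_self, Complex.normSq_eq_norm_sq]
    push_cast; rfl
  rw [h1]
  have := hv.sum_inner_products_le (s := s) x
  calc ((∑ i ∈ s, ‖⟪v i, x⟫_ℂ‖ ^ 2 : ℝ) : ℂ) ≤ ((‖x‖ ^ 2 : ℝ) : ℂ) := by exact_mod_cast this
    _ = _ := by push_cast; rfl

theorem norm_finProj_apply_le (hv : Orthonormal ℂ v) (s : Finset ι) (x : E) :
    ‖finProj v s x‖ ≤ ‖x‖ := by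
  have h1 : ⟪finProj v s x, finProj v s x⟫_ℂ = ⟪x, finProj v s x⟫_ℂ := by
    conv_lhs => rw [inner_finProj]
    rw [inner_finProj]
    refine Finset.sum_congr rfl fun i hi => ?_
    congr 1
    rw [finProj_apply, hv.inner_left_sum _ hi, inner_conj_symm]
  have h2 : ‖finProj v s x‖ ^ 2 ≤ ‖x‖ * ‖finProj v s x‖ := by
    rw [← inner_self_eq_norm_sq (𝕜 := ℂ), h1]
    exact re_inner_le_norm _ _
  rcases (norm_nonneg (finProj v s x)).eq_or_lt with h0 | h0
  · rw [← h0]; positivity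
  · nlinarith

theorem tendsto_inner_finProj [CompleteSpace E] (b : HilbertBasis ι ℂ E) (x y : E) :
    Tendsto (fun s => ⟪x, finProj b s y⟫_ℂ) atTop (𝓝 ⟪x, y⟫_ℂ) := by
  simp only [inner_finProj]
  exact b.hasSum_inner_mul_inner x y

end FinProj

/-- Kraus operators can be indexed by the natural numbers, padding with zeros. -/
theorem IsKraus.nat {κ : Type*} [Countable κ] {k : κ → H₁ →L[ℂ] H₂}
    {T : (H₂ →L[ℂ] H₂) →ₗ[ℂ] (H₁ →L[ℂ] H₁)} (h : IsKraus k T) :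
    ∃ k' : ℕ → H₁ →L[ℂ] H₂, IsKraus k' T ∧ ∀ n, k' n = 0 ∨ ∃ i, k' n = k i := by
  obtain ⟨f, hf⟩ := exists_injective_nat κ
  have h0 : ∀ n ∉ Set.range f, Function.extend f k 0 n = 0 := fun n hn => by
    rw [Function.extend_apply' _ _ _ (by simpa using hn)]; rfl
  refine ⟨Function.extend f k 0, fun a ξ ψ => ?_, fun n => ?_⟩
  · rw [← hf.hasSum_iff (fun n hn => by simp [h0 n hn])]
    simpa [Function.comp_def, hf.extend_apply] using h a ξ ψ
  · by_cases hn : n ∈ Set.range f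
    · obtain ⟨i, rfl⟩ := hn
      exact Or.inr ⟨i, hf.extend_apply _ _ _⟩
    · exact Or.inl (h0 n hn)

theorem IsCP.map_adjoint {T : (H₂ →L[ℂ] H₂) →ₗ[ℂ] (H₁ →L[ℂ] H₁)} (hT : IsCP T)
    (a : H₂ →L[ℂ] H₂) : T (adjoint a) = adjoint (T a) := by
  obtain ⟨S, rfl⟩ := hT
  exact map_star S a

/-- The operator-valued kernel `(η, η') ↦ T |η⟩⟨η'|` of a completely positive map is positive
semidefinite: with a unit vector `e`, it is `T (a_η* a_η')` for `a_η = |e⟩⟨η|`. -/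
theorem IsCP.posSemidef {T : (H₂ →L[ℂ] H₂) →ₗ[ℂ] (H₁ →L[ℂ] H₁)} (hT : IsCP T) [Nontrivial H₂] :
    (Matrix.of fun η η' : H₂ => T (ketBra η η') : Matrix H₂ H₂ (H₁ →L[ℂ] H₁)).PosSemidef := by
  refine (List.TFAE.out RKHS.posSemidef_tfae 0 2).2 ?_
  refine ⟨?_, fun vv => ?_⟩
  · ext η η' : 1
    rw [Matrix.conjTranspose_apply]
    simp [star_eq_adjoint, ← hT.map_adjoint]
  · obtain ⟨e, he⟩ := exists_norm_eq H₂ zero_le_one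
    have := hT.nonneg_sum (n := vv.support) (fun i => ketBra e (i : H₂)) (fun i => vv i)
    have h2 : ∀ i j : H₂, adjoint (ketBra e i) ∘L ketBra e j = ketBra i j := by
      intro i j
      ext x
      simp [he]
    simp only [h2] at this
    have h3 : (vv.sum fun x w => vv.sum fun x' w' =>
        ⟪(Matrix.of fun η η' : H₂ => T (ketBra η η')) x' x w, w'⟫_ℂ) = starRingEnd ℂ
        (∑ i : vv.support, ∑ j : vv.support,
          ⟪vv i, T (ketBra (i : H₂) (j : H₂)) (vv j)⟫_ℂ) := by
      simp only [Finsupp.sum, map_sum, inner_conj_symm]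
      rw [Finset.sum_comm, ← Finset.sum_coe_sort]
      refine Finset.sum_congr rfl fun i _ => ?_
      rw [← Finset.sum_coe_sort]
      rfl
    rw [h3]
    rw [RCLike.conj_re]
    exact (Complex.nonneg_iff.1 this).1

/-- A completely positive map agrees on rank one operators with a Kraus sum. The Kraus operators
are the adjoints of the elements of an orthonormal basis of the reproducing kernel Hilbert space
with kernel `(η, η') ↦ T |η⟩⟨η'|`, which consists of bounded operators `H₂ → H₁`. -/
theorem IsCP.exists_kraus_rankOne {T : (H₂ →L[ℂ] H₂) →ₗ[ℂ] (H₁ →L[ℂ] H₁)} (hT : IsCP T)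
    [TopologicalSpace.SeparableSpace H₁] [TopologicalSpace.SeparableSpace H₂]
    [Nontrivial H₂] : ∃ k : ℕ → H₁ →L[ℂ] H₂,
      ∀ η η' ξ ψ, HasSum (fun i => ⟪k i ξ, ketBra η η' (k i ψ)⟫_ℂ) ⟪ξ, T (ketBra η η') ψ⟫_ℂ := by
  let K : Matrix H₂ H₂ (H₁ →L[ℂ] H₁) := Matrix.of fun η η' : H₂ => T (ketBra η η')
  have : Fact K.PosSemidef := ⟨hT.posSemidef⟩
  have hK : RKHS.kernel (RKHS.OfKernel K) = K := RKHS.OfKernel.kernel_ofKernel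
  have hKa (x y : H₂) : RKHS.kernel (RKHS.OfKernel K) x y = T (ketBra x y) := by rw [hK]; rfl
  have hKn (x : H₂) : ‖RKHS.kernel (RKHS.OfKernel K) x x‖ ≤ ‖T 1‖ * ‖x‖ ^ 2 := by
    rw [hKa]
    have h0 : 0 ≤ ketBra x x := nonneg_iff_inner.2 fun y => by
      simp only [InnerProductSpace.rankOne_apply, inner_smul_right]
      rw [← inner_conj_symm x y, mul_comm, Complex.mul_conj]
      exact_mod_cast Complex.normSq_nonneg _
    have h1 : 0 ≤ ((‖x‖ ^ 2 : ℝ) : ℂ) • (1 : H₂ →L[ℂ] H₂) - ketBra x x :=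
      nonneg_iff_inner.2 fun y => by
        simp only [sub_apply, smul_apply, InnerProductSpace.rankOne_apply,
          inner_sub_right, inner_smul_right]
        rw [show (1 : H₂ →L[ℂ] H₂) y = y from rfl, ← inner_conj_symm x y, mul_comm (starRingEnd ℂ _), Complex.mul_conj,
          inner_self_eq_norm_sq_to_K, Complex.normSq_eq_norm_sq, sub_nonneg]
        have h2 : ‖⟪y, x⟫_ℂ‖ ^ 2 ≤ ‖x‖ ^ 2 * ‖y‖ ^ 2 := by
          rw [← mul_pow, mul_comm]
          gcongr
          exact norm_inner_le_norm _ _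
        calc ((‖⟪y, x⟫_ℂ‖ ^ 2 : ℝ) : ℂ) ≤ ((‖x‖ ^ 2 * ‖y‖ ^ 2 : ℝ) : ℂ) := by exact_mod_cast h2
          _ = _ := by push_cast; rfl
    have h2 := hT.map_nonneg h1
    rw [map_sub, map_smul, sub_nonneg] at h2
    refine (CStarAlgebra.norm_le_norm_of_nonneg_of_le (hT.map_nonneg h0) h2).trans ?_
    rw [norm_smul, mul_comm]
    simp
  set L := RKHS.OfKernel K
  have hKL (x y : H₂) (v : H₁) : RKHS.kernel L x y v = T (ketBra x y) v := by rw [hKa x y]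
  have hle (x : H₂) : √‖RKHS.kernel L x x‖ ≤ √‖T 1‖ * ‖x‖ := by
    rw [← Real.sqrt_sq (norm_nonneg x), ← Real.sqrt_mul (norm_nonneg _)]
    exact Real.sqrt_le_sqrt (hKn x)
  have hadd (x y : H₂) : RKHS.kerFun L (x + y) = RKHS.kerFun L x + RKHS.kerFun L y := by
    ext v z
    simp [RKHS.kerFun_apply, hKL, -InnerProductSpace.rankOne_apply]
  have hsmul (c : ℂ) (x : H₂) : RKHS.kerFun L (c • x) = (starRingEnd ℂ c) • RKHS.kerFun L x := by
    ext v z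
    simp [RKHS.kerFun_apply, hKL, -InnerProductSpace.rankOne_apply]
  let β : H₂ →SL[starRingEnd ℂ] (H₁ →L[ℂ] L) := LinearMap.mkContinuous
    { toFun := RKHS.kerFun L, map_add' := hadd, map_smul' := hsmul } (√‖T 1‖) fun x => by
      simpa [RKHS.norm_kerFun_eq_sqrt_norm_kernel] using hle x
  have hβ (x : H₂) : β x = RKHS.kerFun L x := rfl
  have hsep : TopologicalSpace.SeparableSpace L := by
    have h1 : TopologicalSpace.IsSeparable (Set.range fun p : H₂ × H₁ => β p.1 p.2) :=
      TopologicalSpace.isSeparable_range (by fun_prop)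
    have h2 := (h1.span (R := ℂ)).closure
    rw [← TopologicalSpace.isSeparable_univ_iff]
    refine h2.mono ?_
    have h3 := congr(($(RKHS.kerFun_dense L) : Set L))
    rw [Submodule.topologicalClosure_coe, Submodule.top_coe] at h3
    rw [← h3]
    refine closure_mono (Submodule.span_mono ?_)
    rintro z ⟨x, y, rfl⟩
    exact ⟨(x, y), rfl⟩
  obtain ⟨w, c, -⟩ := exists_hilbertBasis ℂ L
  have : Countable w := c.orthonormal.countable
  let A (g : L) : H₂ →L[ℂ] H₁ := LinearMap.mkContinuous
    { toFun := fun η => g η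
      map_add' := fun x y => ext_inner_left ℂ fun v => by
        simp [← RKHS.kerFun_inner, hadd, inner_add_left, inner_add_right]
      map_smul' := fun a x => ext_inner_left ℂ fun v => by
        simp [← RKHS.kerFun_inner, hsmul, inner_smul_left, inner_smul_right] }
    (‖g‖ * √‖T 1‖) fun x => by
      refine (RKHS.norm_apply_le g x).trans ?_
      rw [mul_assoc]
      gcongr
      exact hle x
  have hA (g : L) (η : H₂) : A g η = g η := rfl
  obtain ⟨f, hf⟩ := exists_injective_nat w
  have h0 : ∀ n ∉ Set.range f, Function.extend f (fun i => adjoint (A (c i))) 0 n = 0 :=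
    fun n hn => by
      rw [Function.extend_apply' _ _ _ (by simpa using hn)]; rfl
  refine ⟨Function.extend f (fun i => adjoint (A (c i))) 0, fun η η' ξ ψ => ?_⟩
  rw [← hf.hasSum_iff (fun n hn => by simp [h0 n hn])]
  have h := c.hasSum_inner_mul_inner (RKHS.kerFun L η ξ) (RKHS.kerFun L η' ψ)
  rw [← RKHS.kernel_inner, hKL, ← adjoint_inner_right, ← hT.map_adjoint] at h
  simpa [Function.comp_def, hf.extend_apply, adjoint_inner_right, adjoint_inner_left, hA,
    inner_smul_right, mul_comm] using h

/-- Normal completely positive maps have a Kraus decomposition. -/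
theorem IsCP.exists_kraus {T : (H₂ →L[ℂ] H₂) →ₗ[ℂ] (H₁ →L[ℂ] H₁)} (hT : IsCP T)
    (hn : IsNormalMap T) [TopologicalSpace.SeparableSpace H₁] [TopologicalSpace.SeparableSpace H₂]
    [Nontrivial H₂] : ∃ k : ℕ → H₁ →L[ℂ] H₂, IsKraus k T := by
  obtain ⟨k, hk⟩ := hT.exists_kraus_rankOne
  obtain ⟨w, b, -⟩ := exists_hilbertBasis ℂ H₂
  have hfin (F : Finset w) (a : H₂ →L[ℂ] H₂) (ξ ψ : H₁) :
      HasSum (fun i => ⟪k i ξ, finProj b F (a (k i ψ))⟫_ℂ) ⟪ξ, T (finProj b F ∘L a) ψ⟫_ℂ := by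
    have h1 : finProj b F ∘L a = ∑ j ∈ F, ketBra (b j) (adjoint a (b j)) := by
      ext x
      simp [finProj_apply, _root_.sum_apply, adjoint_inner_left]
    have h2 := hasSum_sum fun j (_ : j ∈ F) => hk (b j) (adjoint a (b j)) ξ ψ
    rw [h1]
    simpa [_root_.sum_apply, finProj_apply, adjoint_inner_left, inner_sum] using h2
  have hsq (ξ : H₁) : Summable fun i => ‖k i ξ‖ ^ 2 := by
    refine summable_of_sum_le (c := RCLike.re ⟪ξ, T 1 ξ⟫_ℂ) (fun i => by positivity) fun S => ?_
    have h1 : Tendsto (fun F => ∑ i ∈ S, RCLike.re ⟪k i ξ, finProj b F (k i ξ)⟫_ℂ) atTop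
        (𝓝 (∑ i ∈ S, ‖k i ξ‖ ^ 2)) := by
      refine tendsto_finsetSum _ fun i _ => ?_
      rw [← inner_self_eq_norm_sq (𝕜 := ℂ)]
      exact (RCLike.continuous_re.tendsto _).comp (tendsto_inner_finProj b _ _)
    refine le_of_tendsto' h1 fun F => ?_
    have hpos (x : H₂) : 0 ≤ ⟪x, finProj b F x⟫_ℂ := by
      rw [inner_finProj]
      refine Finset.sum_nonneg fun i _ => ?_
      rw [← inner_conj_symm, ← Complex.normSq_eq_conj_mul_self]
      exact_mod_cast Complex.normSq_nonneg _
    have h2 := (hfin F 1 ξ ξ).mapL (RCLike.reCLM (K := ℂ))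
    refine (sum_le_hasSum S (fun i _ => ?_) h2).trans ?_
    · exact (Complex.nonneg_iff.1 (hpos (k i ξ))).1
    · have h3 : 0 ≤ (1 : H₂ →L[ℂ] H₂) - finProj b F := nonneg_iff_inner.2 fun y => by
        rw [sub_apply, inner_sub_right, sub_nonneg]
        exact inner_finProj_self_le b.orthonormal F y
      have h4 := nonneg_iff_inner.1 (hT.map_nonneg h3) ξ
      rw [map_sub, sub_apply, inner_sub_right, sub_nonneg] at h4
      exact (Complex.le_def.1 h4).1
  refine ⟨k, fun a ξ ψ => ?_⟩
  simp only [inner_conjMap]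
  have hbd (F : Finset w) (i : ℕ) :
      ‖⟪k i ξ, finProj b F (a (k i ψ))⟫_ℂ‖ ≤ ‖a‖ * (‖k i ξ‖ * ‖k i ψ‖) := by
    calc _ ≤ ‖k i ξ‖ * ‖finProj b F (a (k i ψ))‖ := norm_inner_le_norm _ _
      _ ≤ ‖k i ξ‖ * (‖a‖ * ‖k i ψ‖) := by
        gcongr
        exact (norm_finProj_apply_le b.orthonormal F _).trans (le_opNorm _ _)
      _ = _ := by ring
  have hsum : Summable fun i => ‖a‖ * (‖k i ξ‖ * ‖k i ψ‖) :=
    (Summable.norm_mul_norm (hsq ξ) (hsq ψ)).mul_left _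
  have h1 : Tendsto (fun F => ∑' i, ⟪k i ξ, finProj b F (a (k i ψ))⟫_ℂ) atTop
      (𝓝 (∑' i, ⟪k i ξ, a (k i ψ)⟫_ℂ)) :=
    tendsto_tsum_of_dominated_convergence hsum (fun i => tendsto_inner_finProj b _ _)
      (Eventually.of_forall fun F i => hbd F i)
  have h2 : Tendsto (fun F => ⟪ξ, T (finProj b F ∘L a) ψ⟫_ℂ) atTop (𝓝 ⟪ξ, T a ψ⟫_ℂ) := by
    refine hn.tendsto (C := ‖a‖) (fun F => ?_) (fun x y => ?_) ξ ψ
    · exact opNorm_le_bound _ (norm_nonneg _) fun x =>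
        (norm_finProj_apply_le b.orthonormal F _).trans (le_opNorm _ _)
    · exact tendsto_inner_finProj b _ _
  simp only [fun F => (hfin F a ξ ψ).tsum_eq] at h1
  rw [tendsto_nhds_unique h2 h1]
  refine (Summable.of_norm_bounded hsum fun i => ?_).hasSum
  exact le_of_tendsto' (tendsto_inner_finProj b _ _).norm fun F => hbd F i

end KrausTheorem

/-! ### Calculus of Kraus decompositions and instruments -/

section KrausCalculus

variable {H₁ H₂ H₃ : Type*}
  [NormedAddCommGroup H₁] [InnerProductSpace ℂ H₁] [CompleteSpace H₁]
  [NormedAddCommGroup H₂] [InnerProductSpace ℂ H₂] [CompleteSpace H₂]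
  [NormedAddCommGroup H₃] [InnerProductSpace ℂ H₃] [CompleteSpace H₃]

theorem IsMapSum.unique {X : Type*} {T : X → (H₂ →L[ℂ] H₂) →ₗ[ℂ] (H₁ →L[ℂ] H₁)}
    {S S' : (H₂ →L[ℂ] H₂) →ₗ[ℂ] (H₁ →L[ℂ] H₁)} (h : IsMapSum T S) (h' : IsMapSum T S') :
    S = S' := by
  ext a ψ
  exact ext_inner_left ℂ fun ξ => (h a ξ ψ).unique (h' a ξ ψ)

theorem summable_inner_of_summable_norm_sq {ι : Type*} {k : ι → H₁ →L[ℂ] H₂}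
    (hk : ∀ ξ, Summable fun i => ‖k i ξ‖ ^ 2) (a : H₂ →L[ℂ] H₂) (ξ ψ : H₁) :
    Summable fun i => ⟪k i ξ, a (k i ψ)⟫_ℂ := by
  refine Summable.of_norm_bounded ((Summable.norm_mul_norm (hk ξ) (hk ψ)).mul_left ‖a‖) fun i => ?_
  calc _ ≤ ‖k i ξ‖ * ‖a (k i ψ)‖ := norm_inner_le_norm _ _
    _ ≤ ‖k i ξ‖ * (‖a‖ * ‖k i ψ‖) := by gcongr; exact le_opNorm _ _
    _ = _ := by ring

variable {T : (H₂ →L[ℂ] H₂) →ₗ[ℂ] (H₁ →L[ℂ] H₁)} {S : (H₃ →L[ℂ] H₃) →ₗ[ℂ] (H₂ →L[ℂ] H₂)}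

theorem IsKraus.comp_equiv {ι κ : Type*} {k : ι → H₁ →L[ℂ] H₂} (h : IsKraus k T) (e : κ ≃ ι) :
    IsKraus (k ∘ e) T := fun a ξ ψ => (e.hasSum_iff.2 (h a ξ ψ) :)

theorem isKraus_single (v : H₁ →L[ℂ] H₂) : IsKraus (fun _ : Unit => v) (conjMap v) :=
  fun a ξ ψ => by simp

/-- Kraus families of the members of a sum combine to a Kraus family of the sum. -/
theorem IsKraus.sigma {X : Type*} {ι : X → Type*} {k : ∀ x, ι x → H₁ →L[ℂ] H₂}
    {T : X → (H₂ →L[ℂ] H₂) →ₗ[ℂ] (H₁ →L[ℂ] H₁)} {S : (H₂ →L[ℂ] H₂) →ₗ[ℂ] (H₁ →L[ℂ] H₁)}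
    (h : ∀ x, IsKraus (k x) (T x)) (hS : IsMapSum T S) :
    IsKraus (fun p : Σ x, ι x => k p.1 p.2) S := by
  have hsq (ξ : H₁) : Summable fun p : Σ x, ι x => ‖k p.1 p.2 ξ‖ ^ 2 := by
    rw [summable_sigma_of_nonneg fun _ => by positivity]
    refine ⟨fun x => ((h x).hasSum_norm_sq ξ).summable, ?_⟩
    simp only [fun x => ((h x).hasSum_norm_sq ξ).tsum_eq]
    exact ((hS 1 ξ ξ).mapL (RCLike.reCLM (K := ℂ))).summable
  intro a ξ ψ
  simp only [inner_conjMap]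
  have h1 := summable_inner_of_summable_norm_sq (k := fun p : Σ x, ι x => k p.1 p.2) hsq a ξ ψ
  have h2 := h1.hasSum.sigma fun x => (h x).hasSum_inner a ξ ψ
  rw [← h2.unique (hS a ξ ψ)]
  exact h1.hasSum

/-- A partition of a Kraus family exhibits its map as a sum. -/
theorem IsKraus.isMapSum {X : Type*} {ι : X → Type*} {k : ∀ x, ι x → H₁ →L[ℂ] H₂}
    {T : X → (H₂ →L[ℂ] H₂) →ₗ[ℂ] (H₁ →L[ℂ] H₁)} {S : (H₂ →L[ℂ] H₂) →ₗ[ℂ] (H₁ →L[ℂ] H₁)}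
    (h : ∀ x, IsKraus (k x) (T x)) (hS : IsKraus (fun p : Σ x, ι x => k p.1 p.2) S) :
    IsMapSum T S :=
  fun a ξ ψ => (hS a ξ ψ).sigma fun x => h x a ξ ψ

theorem IsKraus.comp {ι κ : Type*} {k : ι → H₁ →L[ℂ] H₂} {l : κ → H₂ →L[ℂ] H₃}
    (hT : IsKraus k T) (hS : IsKraus l S) :
    IsKraus (fun p : ι × κ => l p.2 ∘L k p.1) (T ∘ₗ S) := by
  have hsq (ξ : H₁) : Summable fun p : ι × κ => ‖(l p.2 ∘L k p.1) ξ‖ ^ 2 := by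
    rw [summable_prod_of_nonneg fun _ => by positivity]
    refine ⟨fun i => (hS.hasSum_norm_sq (k i ξ)).summable, ?_⟩
    simp only [comp_apply, fun i => (hS.hasSum_norm_sq (k i ξ)).tsum_eq]
    exact ((hT.hasSum_inner (S 1) ξ ξ).mapL (RCLike.reCLM (K := ℂ))).summable
  intro a ξ ψ
  simp only [inner_conjMap]
  have h1 := summable_inner_of_summable_norm_sq (k := fun p : ι × κ => l p.2 ∘L k p.1) hsq a ξ ψ
  have h2 := h1.hasSum.prod_fiberwise fun i => hS.hasSum_inner a (k i ξ) (k i ψ)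
  rw [LinearMap.comp_apply, (hT.hasSum_inner (S a) ξ ψ).unique h2]
  exact h1.hasSum

theorem IsKraus.isInstrument {X : Type*} [Countable X] {ι : X → Type*} [∀ x, Countable (ι x)]
    {k : ∀ x, ι x → H₁ →L[ℂ] H₂} {T : X → (H₂ →L[ℂ] H₂) →ₗ[ℂ] (H₁ →L[ℂ] H₁)}
    {S : (H₂ →L[ℂ] H₂) →ₗ[ℂ] (H₁ →L[ℂ] H₁)}
    (h : ∀ x, IsKraus (k x) (T x)) (hS : IsMapSum T S) (h1 : S 1 = 1) : IsInstrument T where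
  cp x := (h x).isCP
  normal x := (h x).isNormalMap
  channel := ⟨S, ⟨(IsKraus.sigma h hS).isCP, (IsKraus.sigma h hS).isNormalMap, h1⟩, hS⟩

variable [TopologicalSpace.SeparableSpace H₁] [TopologicalSpace.SeparableSpace H₂]
  [TopologicalSpace.SeparableSpace H₃] [Nontrivial H₂] [Nontrivial H₃]

theorem IsInstrument.exists_kraus {X : Type*} {T : X → (H₂ →L[ℂ] H₂) →ₗ[ℂ] (H₁ →L[ℂ] H₁)}
    (hT : IsInstrument T) : ∃ k : X → ℕ → H₁ →L[ℂ] H₂, ∀ x, IsKraus (k x) (T x) :=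
  Classical.skolem.1 fun x => (hT.cp x).exists_kraus (hT.normal x)

/-- The composition of two instruments. -/
theorem IsInstrument.comp {X Y : Type*} [Countable X] [Countable Y]
    {T : X → (H₂ →L[ℂ] H₂) →ₗ[ℂ] (H₁ →L[ℂ] H₁)} {S : Y → (H₃ →L[ℂ] H₃) →ₗ[ℂ] (H₂ →L[ℂ] H₂)}
    (hT : IsInstrument T) (hS : IsInstrument S) :
    IsInstrument fun p : X × Y => T p.1 ∘ₗ S p.2 := by
  obtain ⟨k, hk⟩ := hT.exists_kraus
  obtain ⟨l, hl⟩ := hS.exists_kraus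
  obtain ⟨T', hT', hTT'⟩ := hT.channel
  obtain ⟨S', hS', hSS'⟩ := hS.channel
  have h1 := (IsKraus.sigma hk hTT').comp (IsKraus.sigma hl hSS')
  let e : (Σ _ : X × Y, ℕ × ℕ) ≃ (Σ _ : X, ℕ) × (Σ _ : Y, ℕ) :=
    { toFun := fun p => (⟨p.1.1, p.2.1⟩, ⟨p.1.2, p.2.2⟩)
      invFun := fun q => ⟨(q.1.1, q.2.1), (q.1.2, q.2.2)⟩
      left_inv := fun _ => rfl
      right_inv := fun _ => rfl }
  have h2 := h1.comp_equiv e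
  have h3 (p : X × Y) := (hk p.1).comp (hl p.2)
  refine IsKraus.isInstrument h3 (IsKraus.isMapSum h3 h2) ?_
  rw [LinearMap.comp_apply, hS'.unital, hT'.unital]

end KrausCalculus

/-! ### Characterisation of inner maps -/

section Inner

variable {H : Type*} [NormedAddCommGroup H] [InnerProductSpace ℂ H] [CompleteSpace H]

theorem isInner_of_isKraus {M : VonNeumannAlgebra H} {K₁ K₂ : Ancilla} {T : JointMap H K₁ K₂}
    {ι : Type} [Countable ι] {k : ι → Joint H K₁ →L[ℂ] Joint H K₂}
    (hk : ∀ i, k i ∈ mOperators M K₁ K₂) (hT : IsKraus k T) : IsInner M T :=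
  ⟨ι, inferInstance, k, hk, hT⟩

/-- An inner map fixes the commutant, up to the factor `T 1`. -/
theorem IsInner.map_commutant {M : VonNeumannAlgebra H} {K₁ K₂ : Ancilla} {T : JointMap H K₁ K₂}
    (hT : IsInner M T) {m : H →L[ℂ] H} (hm : m ∈ M.commutant) :
    T (opTensor m (.id ℂ K₂)) = opTensor m (.id ℂ K₁) ∘L T 1 := by
  obtain ⟨ι, _, k, hk, h⟩ := hT
  have h : IsKraus k T := h
  ext ψ
  refine ext_inner_left ℂ fun ξ => (h.hasSum_inner _ ξ ψ).unique ?_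
  rw [comp_apply, ← adjoint_inner_left]
  have e := h.hasSum_inner 1 (adjoint (opTensor m (.id ℂ K₁)) ξ) ψ
  convert! e using 2 with i
  have h1 := mem_mOperators_iff_commute.1 (hk i) (adjoint m)
    (star_mem hm : star m ∈ M.commutant)
  have h2 := congr($h1 ξ)
  simp only [comp_apply] at h2
  rw [opTensor_id_adjoint, h2, ← opTensor_id_adjoint, adjoint_inner_left]
  simp

/-- A Kraus operator of `T` intertwines `m₁` and `m₂`, if `T` behaves on `1, m₂, m₂*, m₂* m₂` like a
bimodule map: over all Kraus operators `k`, the positive operators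
`(k m₁ - m₂ k)* (k m₁ - m₂ k)` sum up to zero. -/
theorem IsKraus.commute_of_map {H₁ H₂ ι : Type*}
    [NormedAddCommGroup H₁] [InnerProductSpace ℂ H₁] [CompleteSpace H₁]
    [NormedAddCommGroup H₂] [InnerProductSpace ℂ H₂] [CompleteSpace H₂]
    {k : ι → H₁ →L[ℂ] H₂} {T : (H₂ →L[ℂ] H₂) →ₗ[ℂ] (H₁ →L[ℂ] H₁)} (hT : IsKraus k T)
    {m₁ : H₁ →L[ℂ] H₁} {m₂ : H₂ →L[ℂ] H₂} (h1 : T m₂ = m₁ ∘L T 1)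
    (h2 : T (adjoint m₂) = adjoint m₁ ∘L T 1)
    (h3 : T (adjoint m₂ ∘L m₂) = (adjoint m₁ ∘L m₁) ∘L T 1) (i : ι) :
    k i ∘L m₁ = m₂ ∘L k i := by
  ext ξ
  have hadj : T m₂ = T 1 ∘L m₁ := by
    have e := congr(adjoint $h2)
    rw [← hT.isCP.map_adjoint, adjoint_adjoint, adjoint_comp, adjoint_adjoint,
      ← hT.isCP.map_adjoint, show adjoint (1 : H₂ →L[ℂ] H₂) = 1 from star_one _] at e
    exact e
  have hc : m₁ ∘L T 1 = T 1 ∘L m₁ := h1.symm.trans hadj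
  have e1 := hT.hasSum_inner 1 (m₁ ξ) (m₁ ξ)
  have e2 := hT.hasSum_inner m₂ (m₁ ξ) ξ
  have e3 := hT.hasSum_inner (adjoint m₂) ξ (m₁ ξ)
  have e4 := hT.hasSum_inner (adjoint m₂ ∘L m₂) ξ ξ
  have e := ((e1.sub e2).sub e3).add e4
  have hz : ⟪m₁ ξ, T 1 (m₁ ξ)⟫_ℂ - ⟪m₁ ξ, T m₂ ξ⟫_ℂ - ⟪ξ, T (adjoint m₂) (m₁ ξ)⟫_ℂ
      + ⟪ξ, T (adjoint m₂ ∘L m₂) ξ⟫_ℂ = 0 := by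
    have c := congr($hc ξ)
    simp only [comp_apply] at c
    rw [h1, h2, h3]
    simp only [comp_apply, adjoint_inner_right, c]
    ring
  rw [hz] at e
  have hf (j : ι) : ⟪k j (m₁ ξ), (1 : H₂ →L[ℂ] H₂) (k j (m₁ ξ))⟫_ℂ - ⟪k j (m₁ ξ), m₂ (k j ξ)⟫_ℂ
      - ⟪k j ξ, adjoint m₂ (k j (m₁ ξ))⟫_ℂ + ⟪k j ξ, (adjoint m₂ ∘L m₂) (k j ξ)⟫_ℂ
      = ⟪k j (m₁ ξ) - m₂ (k j ξ), k j (m₁ ξ) - m₂ (k j ξ)⟫_ℂ := by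
    simp only [comp_apply, adjoint_inner_right, inner_sub_left, inner_sub_right]
    rw [show (1 : H₂ →L[ℂ] H₂) (k j (m₁ ξ)) = k j (m₁ ξ) from rfl]
    ring
  simp only [hf] at e
  have := (hasSum_zero_iff_of_nonneg fun j => complex_inner_self_nonneg _).1 e
  have h0 := congr_fun this i
  rw [Pi.zero_apply, inner_self_eq_zero, sub_eq_zero] at h0
  exact h0

theorem IsKraus.mem_mOperators_of_map {M : VonNeumannAlgebra H} {K₁ K₂ : Ancilla}
    {T : JointMap H K₁ K₂} {ι : Type*} {k : ι → Joint H K₁ →L[ℂ] Joint H K₂} (hT : IsKraus k T)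
    (h : ∀ m ∈ M.commutant, T (opTensor m (.id ℂ K₂)) = opTensor m (.id ℂ K₁) ∘L T 1) (i : ι) :
    k i ∈ mOperators M K₁ K₂ := by
  rw [mem_mOperators_iff_commute]
  intro m hm
  have ham : adjoint m ∈ M.commutant := (star_mem hm : star m ∈ M.commutant)
  refine hT.commute_of_map (h m hm) ?_ ?_ i
  · rw [opTensor_id_adjoint, opTensor_id_adjoint]
    exact h _ ham
  · simp only [opTensor_id_adjoint, opTensor_comp, id_comp]
    exact h _ (mul_mem ham hm)

/-- A normal completely positive map is `M`-inner if it behaves on `M' ⊗ 1` like a bimodule map. In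
contrast to the existence of Kraus operators in `M ⊗̄ B(K₁, K₂)`, this condition is evidently closed
under limits. -/
theorem isInner_of_map_commutant [TopologicalSpace.SeparableSpace H] [Nontrivial H]
    {M : VonNeumannAlgebra H} {K₁ K₂ : Ancilla} {T : JointMap H K₁ K₂} (hcp : IsCP T)
    (hn : IsNormalMap T)
    (h : ∀ m ∈ M.commutant, T (opTensor m (.id ℂ K₂)) = opTensor m (.id ℂ K₁) ∘L T 1) :
    IsInner M T := by
  obtain ⟨k, hk⟩ := hcp.exists_kraus hn
  exact isInner_of_isKraus (hk.mem_mOperators_of_map h) hk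

end Inner

/-! ### Instruments built from a contraction and its defect -/

section Defect

variable {H K₁ K₂ : Type*}
  [NormedAddCommGroup H] [InnerProductSpace ℂ H] [CompleteSpace H]
  [NormedAddCommGroup K₁] [InnerProductSpace ℂ K₁] [CompleteSpace K₁]
  [NormedAddCommGroup K₂] [InnerProductSpace ℂ K₂] [CompleteSpace K₂]

/-- The map `a ↦ (1 ⊗ ⟨f|) a (1 ⊗ |f⟩) ⊗ 1`, which replaces the ancilla `K₁` by an ancilla `K₂` in
the state `f`. -/
def replaceMap (H : Type*) [NormedAddCommGroup H] [InnerProductSpace ℂ H] [CompleteSpace H]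
    (K₁ : Type*) [NormedAddCommGroup K₁] [InnerProductSpace ℂ K₁] (f : K₂) :
    (HTensor H K₂ →L[ℂ] HTensor H K₂) →ₗ[ℂ] (HTensor H K₁ →L[ℂ] HTensor H K₁) where
  toFun a := opTensor (slice a f f) (.id ℂ K₁)
  map_add' a b := by
    rw [← opTensor_add_left]
    congr 1
    ext; simp [slice]
  map_smul' c a := by
    rw [RingHom.id_apply, ← opTensor_smul_left]
    congr 1
    ext; simp [slice]

theorem isKraus_replaceMap {ι : Type*} (b : HilbertBasis ι ℂ K₁) (f : K₂) :
    IsKraus (fun i => ket H f ∘L bra H (b i)) (replaceMap H K₁ f) := by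
  intro a ξ ψ
  have := hasSum_inner_bra b ξ (opTensor (slice a f f) (.id ℂ K₁) ψ)
  simp only [inner_conjMap]
  convert! this using 2 with i
  rw [bra_opTensor_id, slice_apply, bra, bra, adjoint_inner_right]
  rfl

theorem replaceMap_one {f : K₂} (hf : ‖f‖ = 1) : replaceMap H K₁ f 1 = 1 := by
  have : slice (1 : HTensor H K₂ →L[ℂ] HTensor H K₂) f f = .id ℂ H := by
    ext x
    simp [slice_apply, hf]
  rw [replaceMap, LinearMap.coe_mk, AddHom.coe_mk, this, opTensor_id]
  rfl

/-- The map `a ↦ ⟪f, a f⟫ 1`. -/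
def stateMap (K₁ : Type*) [NormedAddCommGroup K₁] [InnerProductSpace ℂ K₁] (f : K₂) :
    (K₂ →L[ℂ] K₂) →ₗ[ℂ] (K₁ →L[ℂ] K₁) where
  toFun a := ⟪f, a f⟫_ℂ • 1
  map_add' a b := by simp [add_smul]
  map_smul' c a := by simp [mul_smul]

theorem isKraus_stateMap {ι : Type*} (b : HilbertBasis ι ℂ K₁) (f : K₂) :
    IsKraus (fun i => ketBra f (b i)) (stateMap K₁ f) := by
  intro a ξ ψ
  simp only [inner_conjMap]
  have := (b.hasSum_inner_mul_inner ξ ψ).mul_left ⟪f, a f⟫_ℂ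
  convert! this using 2 with i
  · simp; ring
  · simp [stateMap]

theorem stateMap_one {f : K₂} (hf : ‖f‖ = 1) : stateMap K₁ f 1 = 1 := by
  simp [stateMap, hf]

variable (K₁) in
theorem exists_hilbertBasis_countable [TopologicalSpace.SeparableSpace K₁] :
    ∃ (w : Set K₁) (_ : Countable w), Nonempty (HilbertBasis w ℂ K₁) := by
  obtain ⟨w, b, -⟩ := exists_hilbertBasis ℂ K₁
  exact ⟨w, b.orthonormal.countable, ⟨b⟩⟩

end Defect

/-! ### Inner operations satisfy the axioms -/

section InnerAxioms

variable {H : Type*} [NormedAddCommGroup H] [InnerProductSpace ℂ H] [CompleteSpace H]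
  {M : VonNeumannAlgebra H} {K₁ K₂ K₃ : Ancilla}

theorem IsInner.comp {T : JointMap H K₁ K₂} {S : JointMap H K₂ K₃} (hT : IsInner M T)
    (hS : IsInner M S) : IsInner M (T ∘ₗ S) := by
  obtain ⟨ι, _, k, hk, hT⟩ := hT
  obtain ⟨κ, _, l, hl, hS⟩ := hS
  have h : IsKraus (fun p : ι × κ => l p.2 ∘L k p.1) (T ∘ₗ S) := IsKraus.comp hT hS
  exact ⟨ι × κ, inferInstance, _, fun p => comp_mem_mOperators (hl p.2) (hk p.1), h⟩

theorem IsInner.of_isMapSum {X : Type} [Countable X] {T : X → JointMap H K₁ K₂}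
    {S : JointMap H K₁ K₂} (hT : ∀ x, IsInner M (T x)) (hS : IsMapSum T S) : IsInner M S := by
  choose ι hι k hk hT using hT
  exact isInner_of_isKraus (fun p : Σ x, ι x => hk p.1 p.2) (IsKraus.sigma hT hS)

theorem isInner_conjMap {v : Joint H K₁ →L[ℂ] Joint H K₂} (hv : v ∈ mOperators M K₁ K₂) :
    IsInner M (conjMap v) :=
  isInner_of_isKraus (fun _ => hv) (isKraus_single v)

theorem isMapSum_single {H₁ H₂ : Type*}
    [NormedAddCommGroup H₁] [InnerProductSpace ℂ H₁] [CompleteSpace H₁]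
    [NormedAddCommGroup H₂] [InnerProductSpace ℂ H₂] [CompleteSpace H₂]
    (S : (H₂ →L[ℂ] H₂) →ₗ[ℂ] (H₁ →L[ℂ] H₁)) : IsMapSum (fun _ : Unit => S) S :=
  fun a ξ ψ => by simp

theorem IsChannel.isInstrument {H₁ H₂ : Type*}
    [NormedAddCommGroup H₁] [InnerProductSpace ℂ H₁] [CompleteSpace H₁]
    [NormedAddCommGroup H₂] [InnerProductSpace ℂ H₂] [CompleteSpace H₂]
    {S : (H₂ →L[ℂ] H₂) →ₗ[ℂ] (H₁ →L[ℂ] H₁)} (hS : IsChannel S) :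
    IsInstrument (fun _ : Unit => S) :=
  ⟨fun _ => hS.cp, fun _ => hS.normal, S, hS, isMapSum_single S⟩

theorem IsInstrument.isChannel {H₁ H₂ : Type*}
    [NormedAddCommGroup H₁] [InnerProductSpace ℂ H₁] [CompleteSpace H₁]
    [NormedAddCommGroup H₂] [InnerProductSpace ℂ H₂] [CompleteSpace H₂]
    {X : Type*} {T : X → (H₂ →L[ℂ] H₂) →ₗ[ℂ] (H₁ →L[ℂ] H₁)}
    {S : (H₂ →L[ℂ] H₂) →ₗ[ℂ] (H₁ →L[ℂ] H₁)} (hT : IsInstrument T) (hS : IsMapSum T S) :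
    IsChannel S := by
  obtain ⟨S', hS', h⟩ := hT.channel
  rwa [hS.unique h]

theorem isChannel_conjMap {H₁ H₂ : Type*}
    [NormedAddCommGroup H₁] [InnerProductSpace ℂ H₁] [CompleteSpace H₁]
    [NormedAddCommGroup H₂] [InnerProductSpace ℂ H₂] [CompleteSpace H₂]
    {v : H₁ →L[ℂ] H₂} (hv : adjoint v ∘L v = .id ℂ H₁) : IsChannel (conjMap v) :=
  ⟨(isKraus_single v).isCP, (isKraus_single v).isNormalMap, hv⟩

theorem isInnerInstrument_conjMap {v : Joint H K₁ →L[ℂ] Joint H K₂}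
    (hv : v ∈ mOperators M K₁ K₂) (h1 : adjoint v ∘L v = .id ℂ _) :
    IsInnerInstrument M (fun _ : Unit => conjMap v) :=
  ⟨(isChannel_conjMap h1).isInstrument, fun _ => isInner_conjMap hv⟩

theorem adjoint_comp_self_unitary (u : Joint H K₁ ≃ₗᵢ[ℂ] Joint H K₂) :
    adjoint (u.toContinuousLinearEquiv : Joint H K₁ →L[ℂ] Joint H K₂) ∘L
      (u.toContinuousLinearEquiv : Joint H K₁ →L[ℂ] Joint H K₂) = .id ℂ _ := by
  ext ξ
  refine ext_inner_left ℂ fun ψ => ?_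
  simp

theorem adjoint_unitary (u : Joint H K₁ ≃ₗᵢ[ℂ] Joint H K₂) :
    adjoint (u.toContinuousLinearEquiv : Joint H K₁ →L[ℂ] Joint H K₂) =
      (u.symm.toContinuousLinearEquiv : Joint H K₂ →L[ℂ] Joint H K₁) := by
  ext ξ
  refine ext_inner_left ℂ fun ψ => ?_
  rw [adjoint_inner_right]
  simpa using u.inner_map_map ψ (u.symm ξ)

theorem unitaryMap_eq (u : Joint H K₁ ≃ₗᵢ[ℂ] Joint H K₂) :
    unitaryMap u = conjMap (u.toContinuousLinearEquiv : Joint H K₁ →L[ℂ] Joint H K₂) := rfl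

/-- The agent can implement precisely the `M`-inner instruments. -/
def Agent.ImplementsInner (A : Agent H) (M : VonNeumannAlgebra H) : Prop :=
  ∀ (K₁ K₂ : Ancilla) (X : Type) [Countable X] (T : X → JointMap H K₁ K₂),
    A.Implementable T ↔ IsInnerInstrument M T

theorem isNormalState_vecFunctional {E : Type*} [NormedAddCommGroup E] [InnerProductSpace ℂ E]
    [CompleteSpace E] {ξ : E} (hξ : ‖ξ‖ = 1) : IsNormalState (vecFunctional ξ ξ) :=
  ⟨isNormalFunctional_vecFunctional ξ ξ, fun _ ha => nonneg_iff_inner.1 ha ξ, by simp [hξ]⟩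

theorem ext_of_inner_unit {E : Type*} [NormedAddCommGroup E] [InnerProductSpace ℂ E]
    {a b : E →L[ℂ] E} (h : ∀ ξ : E, ‖ξ‖ = 1 → ⟪ξ, a ξ⟫_ℂ = ⟪ξ, b ξ⟫_ℂ) : a = b := by
  refine ContinuousLinearMap.coe_injective ((ext_inner_map _ _).1 fun x => ?_)
  rw [← inner_conj_symm, ← inner_conj_symm ((b : E →ₗ[ℂ] E) x)]
  congr 1
  by_cases hx : x = 0
  · simp [hx]
  have hx' : (‖x‖ : ℂ) ≠ 0 := by simpa using hx
  have := h ((‖x‖ : ℂ)⁻¹ • x) (by simp [norm_smul, hx])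
  simpa [inner_smul_left, inner_smul_right, hx] using this

section Axioms

variable {A : Agent H} (hA : A.ImplementsInner M)
include hA

/-- Being inner is expressed by expectation values: `⟪ξ, T (m ⊗ 1) ξ⟫ = ⟪ξ, (m ⊗ 1) ξ⟫` for unit
vectors `ξ` and `m ∈ M'`. -/
theorem Agent.ImplementsInner.limits [TopologicalSpace.SeparableSpace H] [Nontrivial H] :
    A.Limits := by
  intro K₁ K₂
  have h1 : {T : {T : JointMap H K₁ K₂ // IsChannel T} | A.ImplementableChannel T.1} =
      ⋂ (m ∈ M.commutant) (ξ : Joint H K₁) (_ : ‖ξ‖ = 1),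
        {T | vecFunctional ξ ξ (T.1 (opTensor m (.id ℂ K₂))) =
          vecFunctional ξ ξ (opTensor m (.id ℂ K₁))} := by
    ext T
    simp only [Set.mem_iInter]
    constructor
    · intro hT m hm ξ hξ
      have h2 := (((hA _ _ _ _).1 hT).2 ()).map_commutant hm
      rw [T.2.unital] at h2
      exact congrArg _ (h2.trans (comp_id _))
    · intro h
      refine (hA _ _ _ _).2 ⟨T.2.isInstrument, fun _ =>
        isInner_of_map_commutant T.2.cp T.2.normal fun m hm => ?_⟩
      rw [T.2.unital]
      exact (ext_of_inner_unit fun ξ hξ => h m hm ξ hξ).trans (comp_id _).symm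
  rw [h1]
  let := expectationTopology (Joint H K₁) (Joint H K₂)
  refine isClosed_iInter fun m => isClosed_iInter fun hm => isClosed_iInter fun ξ =>
    isClosed_iInter fun hξ => isClosed_eq ?_ continuous_const
  exact continuous_iInf_dom (i := vecFunctional ξ ξ)
    (continuous_iInf_dom (i := isNormalState_vecFunctional hξ)
      (continuous_iInf_dom (i := opTensor m (.id ℂ K₂)) continuous_induced_dom))

theorem Agent.ImplementsInner.ancillaControl [TopologicalSpace.SeparableSpace H] [Nontrivial H] :
    A.AncillaControl := by
  intro K₁ K₂ X _ S hS T hT h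
  refine (hA _ _ _ _).2 ⟨hT, fun x => isInner_of_map_commutant (hT.cp x) (hT.normal x)
    fun m hm => ?_⟩
  have e1 := h x m (.id ℂ K₂)
  have e2 := h x (.id ℂ H) (.id ℂ K₂)
  rw [opTensor_id] at e2
  rw [e1, show (1 : Joint H K₂ →L[ℂ] Joint H K₂) = .id ℂ _ from rfl, e2, opTensor_comp]
  simp

theorem Agent.ImplementsInner.reversibility : A.Reversibility := by
  intro K₁ K₂ u hu
  have h1 := ((hA _ _ _ _).1 hu).2 ()
  have h2 := (isKraus_single _).mem_mOperators_of_map (M := M) (T := unitaryMap u)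
    (fun m hm => h1.map_commutant hm) ()
  have h3 := adjoint_mem_mOperators h2
  refine (hA _ _ _ _).2 ?_
  rw [adjoint_unitary] at h3
  exact isInnerInstrument_conjMap h3 (adjoint_comp_self_unitary u.symm)

theorem Agent.ImplementsInner.consistency [TopologicalSpace.SeparableSpace H] [Nontrivial H] :
    A.Consistency where
  comp T S hT hS := by
    rw [hA] at *
    exact ⟨hT.1.comp hS.1, fun p => (hT.2 p.1).comp (hS.2 p.2)⟩
  relabel e T hT := by
    rw [hA] at *
    obtain ⟨S, hS, h⟩ := hT.1.channel
    exact ⟨⟨fun y => hT.1.cp _, fun y => hT.1.normal _, S, hS,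
      fun a ξ ψ => (e.hasSum_iff.2 (h a ξ ψ) :)⟩, fun y => hT.2 _⟩
  discard T S hT hS := by
    rw [hA] at hT
    exact (hA _ _ _ _).2 ⟨(hT.1.isChannel hS).isInstrument, fun _ => .of_isMapSum hT.2 hS⟩

/-- The failure outcome is `a ↦ R (replaceMap a) R`, where `R² = 1 - ∑ T_y 1`. The operator `R` is in
`M ⊗̄ B(K₁)` since the `T_y 1` are. -/
theorem Agent.ImplementsInner.selectionCompleteness : A.SelectionCompleteness := by
  intro K₁ K₂ Y _ X _ T hT x hle
  have hin (y : Y) : IsInnerInstrument M (T y) := (hA _ _ _ _).1 (hT y)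
  set τ : Y → JointMap H K₁ K₂ := fun y => T y (x y)
  have hτ (y : Y) : IsInner M (τ y) := (hin y).2 _
  set D : Joint H K₁ →L[ℂ] Joint H K₁ := 1 - (∑ y, τ y) 1
  have hD : 0 ≤ D := sub_nonneg.2 hle
  set R := CFC.sqrt D
  have hR : 0 ≤ R := CFC.sqrt_nonneg D
  have hRR : R * R = D := CFC.sqrt_mul_sqrt_self D
  have hRM : R ∈ mOperators M K₁ K₁ := by
    rw [mem_mOperators_iff_commute]
    intro m hm
    have hc (y : Y) : Commute (τ y 1) (opTensor m (.id ℂ K₁)) := by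
      have e1 := (hτ y).map_commutant hm
      have e2 := (hτ y).map_commutant (star_mem hm : star m ∈ M.commutant)
      have e3 := congr(adjoint $e2)
      rw [← ((hin y).1.cp _).map_adjoint, adjoint_comp, ← ((hin y).1.cp _).map_adjoint] at e3
      simp only [star_eq_adjoint, opTensor_id_adjoint, adjoint_adjoint] at e3
      rw [show adjoint (1 : Joint H K₂ →L[ℂ] Joint H K₂) = 1 from star_one _] at e3
      exact e3.symm.trans e1
    have hcD : Commute D (opTensor m (.id ℂ K₁)) := by
      refine (Commute.one_left _).sub_left ?_
      rw [LinearMap.sum_apply]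
      exact Commute.sum_left _ _ _ fun y _ => hc y
    exact hcD.cfcₙ_nnreal _
  obtain ⟨f, hf⟩ := exists_norm_eq K₂ zero_le_one
  obtain ⟨w, _, ⟨b⟩⟩ := exists_hilbertBasis_countable K₁
  have hKr := (isKraus_single R).comp (isKraus_replaceMap (H := H) b f)
  let S : Option Y → JointMap H K₁ K₂ := fun o => o.elim (conjMap R ∘ₗ replaceMap H K₁ f) τ
  have hS : ∀ o, IsInner M (S o) := by
    rintro (_ | y)
    · refine isInner_of_isKraus (fun p => comp_mem_mOperators ?_ hRM) hKr
      have := opTensor_mem_mOperators (one_mem M) (ketBra f (b p.2 : K₁))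
      rw [opTensor_ketBra] at this
      simpa using! this
    · exact hτ y
  refine ⟨S, (hA _ _ _ _).2 ⟨?_, hS⟩, fun y => rfl⟩
  have hS' := hS
  choose ι hι k hk hSk using hS'
  refine IsKraus.isInstrument hSk (S := ∑ o, S o) (fun a ξ ψ => ?_) ?_
  · have := hasSum_fintype (fun o => ⟪ξ, S o a ψ⟫_ℂ)
    simpa [LinearMap.sum_apply, _root_.sum_apply, inner_sum] using this
  · have h0 : S none 1 = D := by
      change conjMap R (replaceMap H K₁ f 1) = D
      rw [replaceMap_one hf, conjMap_apply, hR.isSelfAdjoint.adjoint_eq, ← hRR]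
      rfl
    rw [LinearMap.sum_apply, Fintype.sum_option, h0]
    change D + ∑ y, τ y 1 = 1
    rw [← LinearMap.sum_apply]
    exact sub_add_cancel _ _

end Axioms

end InnerAxioms

/-! ### Partitions of Hilbert spaces into ranges of isometries -/

section Partition

variable {A B C D G : Type*}
  [NormedAddCommGroup A] [InnerProductSpace ℂ A] [CompleteSpace A]
  [NormedAddCommGroup B] [InnerProductSpace ℂ B] [CompleteSpace B]
  [NormedAddCommGroup C] [InnerProductSpace ℂ C] [CompleteSpace C]
  [NormedAddCommGroup D] [InnerProductSpace ℂ D] [CompleteSpace D]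
  [NormedAddCommGroup G] [InnerProductSpace ℂ G] [CompleteSpace G]

/-- `a : A → G` and `b : B → G` are isometries that exhibit `G` as the orthogonal sum of `A`
and `B`. -/
structure IsSplit (a : A →L[ℂ] G) (b : B →L[ℂ] G) : Prop where
  left : adjoint a ∘L a = .id ℂ A
  right : adjoint b ∘L b = .id ℂ B
  sum : a ∘L adjoint a + b ∘L adjoint b = .id ℂ G

namespace IsSplit

variable {a : A →L[ℂ] G} {b : B →L[ℂ] G}

theorem left_apply (h : IsSplit a b) (x : A) : adjoint a (a x) = x := congr($h.left x)

theorem right_apply (h : IsSplit a b) (x : B) : adjoint b (b x) = x := congr($h.right x)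

theorem sum_apply (h : IsSplit a b) (x : G) : a (adjoint a x) + b (adjoint b x) = x :=
  congr($h.sum x)

theorem left_right_apply (h : IsSplit a b) (x : B) : adjoint a (b x) = 0 := by
  have := congr(adjoint a $(h.sum_apply (b x)))
  rw [h.right_apply, map_add, h.left_apply] at this
  simpa using this

theorem right_left_apply (h : IsSplit a b) (x : A) : adjoint b (a x) = 0 := by
  have := congr(adjoint b $(h.sum_apply (a x)))
  rw [h.left_apply, map_add, h.right_apply] at this
  simpa using this

/-- Refining the second summand of a decomposition. -/
theorem sum_comp_apply {c : C →L[ℂ] B} {d : D →L[ℂ] B} (h : IsSplit a b) (h' : IsSplit c d) (x : G) :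
    a (adjoint a x) + (b (c (adjoint c (adjoint b x))) + b (d (adjoint d (adjoint b x)))) = x := by
  rw [← map_add, h'.sum_apply, h.sum_apply]

end IsSplit

/-- An operator with `u* u = 1` and `u u* = 1`, as a unitary equivalence. -/
def unitaryOf (u : A →L[ℂ] B) (h : adjoint u ∘L u = .id ℂ A) (h' : u ∘L adjoint u = .id ℂ B) :
    A ≃ₗᵢ[ℂ] B where
  toLinearEquiv := LinearEquiv.ofLinearMap u (adjoint u) (congr(($h' : B →ₗ[ℂ] B)))
    (congr(($h : A →ₗ[ℂ] A)))
  norm_map' x := by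
    have : ‖u x‖ ^ 2 = ‖x‖ ^ 2 := by
      rw [← inner_self_eq_norm_sq (𝕜 := ℂ), ← inner_self_eq_norm_sq (𝕜 := ℂ),
        ← adjoint_inner_right]
      have := congr($h x)
      simp only [comp_apply] at this
      rw [this]; rfl
    exact (sq_eq_sq₀ (norm_nonneg _) (norm_nonneg _)).1 this

/-- The unitary dilation of an isometry `V : A → B` between spaces `X = A ⊕ B ⊕ B` and
`Y = B ⊕ A ⊕ B`: with respect to these decompositions it is the block matrix with columns
`(V, 0, 0)`, `(1 - V V*, V*, 0)` and `(0, 0, 1)`. -/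
theorem exists_unitary_dilation {X Y B₁ B₂ : Type*}
    [NormedAddCommGroup X] [InnerProductSpace ℂ X] [CompleteSpace X]
    [NormedAddCommGroup Y] [InnerProductSpace ℂ Y] [CompleteSpace Y]
    [NormedAddCommGroup B₁] [InnerProductSpace ℂ B₁] [CompleteSpace B₁]
    [NormedAddCommGroup B₂] [InnerProductSpace ℂ B₂] [CompleteSpace B₂]
    {V : A →L[ℂ] B} (hV : adjoint V ∘L V = .id ℂ A)
    {i : A →L[ℂ] X} {s : B₁ →L[ℂ] X} (hi : IsSplit i s) {c : B →L[ℂ] B₁} {d : B →L[ℂ] B₁}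
    (hcd : IsSplit c d) {e : B →L[ℂ] Y} {s' : B₂ →L[ℂ] Y} (he : IsSplit e s') {r : A →L[ℂ] B₂}
    {t : B →L[ℂ] B₂} (hrt : IsSplit r t) :
    ∃ u : X ≃ₗᵢ[ℂ] Y, (u.toContinuousLinearEquiv : X →L[ℂ] Y) =
      e ∘L V ∘L adjoint i
        + (e ∘L (.id ℂ B - V ∘L adjoint V) + s' ∘L r ∘L adjoint V) ∘L adjoint c ∘L adjoint s
        + s' ∘L t ∘L adjoint d ∘L adjoint s := by
  have hVa (x : A) : adjoint V (V x) = x := congr($hV x)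
  set u := e ∘L V ∘L adjoint i
        + (e ∘L (.id ℂ B - V ∘L adjoint V) + s' ∘L r ∘L adjoint V) ∘L adjoint c ∘L adjoint s
        + s' ∘L t ∘L adjoint d ∘L adjoint s with hu
  have hua : adjoint u = i ∘L adjoint V ∘L adjoint e
        + s ∘L c ∘L ((.id ℂ B - V ∘L adjoint V) ∘L adjoint e + V ∘L adjoint r ∘L adjoint s')
        + s ∘L d ∘L adjoint t ∘L adjoint s' := by
    simp only [hu, map_add, map_sub, adjoint_comp, adjoint_adjoint, adjoint_id, comp_assoc]
  refine ⟨unitaryOf u ?_ ?_, rfl⟩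
  · rw [hua]
    ext x
    simp only [hu, comp_apply, add_apply, sub_apply, map_add, map_sub, he.left_apply,
      he.left_right_apply, he.right_left_apply, he.right_apply, hrt.left_apply, hrt.right_apply,
      hrt.left_right_apply, hrt.right_left_apply, hVa, map_zero, id_apply, add_zero, zero_add,
      sub_self]
    conv_rhs => rw [← hi.sum_comp_apply hcd x]
    abel
  · rw [hua]
    ext x
    simp only [hu, comp_apply, add_apply, sub_apply, map_add, map_sub, hi.left_apply,
      hi.left_right_apply, hi.right_left_apply, hi.right_apply, hcd.left_apply, hcd.right_apply,
      hcd.left_right_apply, hcd.right_left_apply, hVa, map_zero, id_apply, add_zero, zero_add,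
      sub_self]
    conv_rhs => rw [← he.sum_comp_apply hrt x]
    abel

/-! Infinite-dimensional separable Hilbert spaces. -/

theorem exists_hilbertBasis_nat [TopologicalSpace.SeparableSpace G]
    (hG : ¬ FiniteDimensional ℂ G) : Nonempty (HilbertBasis ℕ ℂ G) := by
  obtain ⟨w, _, ⟨b⟩⟩ := exists_hilbertBasis_countable G
  have : Infinite w := by
    by_contra h
    rw [not_infinite_iff_finite] at h
    have := Fintype.ofFinite w
    exact hG b.toOrthonormalBasis.toBasis.finiteDimensional_of_finite
  obtain ⟨e⟩ := nonempty_equiv_of_countable (α := ℕ) (β := w)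
  refine ⟨HilbertBasis.mk (v := b ∘ e) (b.orthonormal.comp _ e.injective) ?_⟩
  rw [e.surjective.range_comp]
  exact b.dense_span.ge

theorem nonempty_linearIsometryEquiv [TopologicalSpace.SeparableSpace G]
    [TopologicalSpace.SeparableSpace A] (hG : ¬ FiniteDimensional ℂ G)
    (hA : ¬ FiniteDimensional ℂ A) : Nonempty (A ≃ₗᵢ[ℂ] G) := by
  obtain ⟨b⟩ := exists_hilbertBasis_nat hG
  obtain ⟨c⟩ := exists_hilbertBasis_nat hA
  exact ⟨c.repr.trans b.repr.symm⟩

/-- An infinite-dimensional separable Hilbert space is the sum of any separable space and any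
separable infinite-dimensional space. -/
theorem exists_isSplit [TopologicalSpace.SeparableSpace G] [TopologicalSpace.SeparableSpace A]
    [TopologicalSpace.SeparableSpace B] (hG : ¬ FiniteDimensional ℂ G)
    (hB : ¬ FiniteDimensional ℂ B) : ∃ (a : A →L[ℂ] G) (b : B →L[ℂ] G), IsSplit a b := by
  have hs : TopologicalSpace.SeparableSpace (WithLp 2 (A × B)) :=
    (WithLp.prodContinuousLinearEquiv 2 ℂ A B).symm.toHomeomorph.surjective.denseRange.separableSpace
      (WithLp.prodContinuousLinearEquiv 2 ℂ A B).symm.continuous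
  have hd : ¬ FiniteDimensional ℂ (WithLp 2 (A × B)) := fun h =>
    hB (FiniteDimensional.of_surjective
      ((LinearMap.snd ℂ A B) ∘ₗ (WithLp.linearEquiv 2 ℂ (A × B)).toLinearMap)
      (fun y => ⟨WithLp.toLp 2 (0, y), rfl⟩))
  obtain ⟨Φ⟩ := nonempty_linearIsometryEquiv hG hd
  let a : A →L[ℂ] G := (Φ.toContinuousLinearEquiv : _ →L[ℂ] G) ∘L
    ((WithLp.prodContinuousLinearEquiv 2 ℂ A B).symm : A × B →L[ℂ] WithLp 2 (A × B)) ∘L .inl ℂ A B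
  let b : B →L[ℂ] G := (Φ.toContinuousLinearEquiv : _ →L[ℂ] G) ∘L
    ((WithLp.prodContinuousLinearEquiv 2 ℂ A B).symm : A × B →L[ℂ] WithLp 2 (A × B)) ∘L .inr ℂ A B
  have ha (x : G) : adjoint a x = (Φ.symm x).fst := ext_inner_left ℂ fun y => by
    rw [adjoint_inner_right, ← Φ.symm.inner_map_map]
    simp [a]
  have hb (x : G) : adjoint b x = (Φ.symm x).snd := ext_inner_left ℂ fun y => by
    rw [adjoint_inner_right, ← Φ.symm.inner_map_map]
    simp [b]
  refine ⟨a, b, ?_, ?_, ?_⟩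
  · ext x; simp [ha]; simp [a]
  · ext x; simp [hb]; simp [b]
  · ext x
    simp only [add_apply, comp_apply, ha, hb, id_apply, a, b]
    apply Φ.symm.injective
    rw [map_add]
    change Φ.symm (Φ _) + Φ.symm (Φ _) = _
    rw [Φ.symm_apply_apply, Φ.symm_apply_apply]
    apply (WithLp.equiv 2 _).injective
    ext <;> simp

end Partition

/-! ### Stinespring isometries -/

section Stinespring

variable {E₁ E₂ L : Type*}
  [NormedAddCommGroup E₁] [InnerProductSpace ℂ E₁] [CompleteSpace E₁]
  [NormedAddCommGroup E₂] [InnerProductSpace ℂ E₂] [CompleteSpace E₂]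
  [NormedAddCommGroup L] [InnerProductSpace ℂ L]

/-- The Stinespring isometry `V = ∑ᵢ kᵢ ⊗ |bᵢ⟩` of a unital map with Kraus operators `kᵢ`. -/
theorem IsKraus.exists_isometry {ι : Type*} (b : HilbertBasis ι ℂ L) {k : ι → E₁ →L[ℂ] E₂}
    {T : (E₂ →L[ℂ] E₂) →ₗ[ℂ] (E₁ →L[ℂ] E₁)} (hT : IsKraus k T) (h1 : T 1 = 1) :
    ∃ V : E₁ →L[ℂ] HTensor E₂ L, adjoint V ∘L V = .id ℂ E₁ ∧ ∀ i ξ, bra E₂ (b i) (V ξ) = k i ξ := by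
  have hs (ξ : E₁) : HasSum (fun i => ‖k i ξ‖ ^ 2) (‖ξ‖ ^ 2) := by
    have := hT.hasSum_norm_sq ξ
    rwa [h1, show (1 : E₁ →L[ℂ] E₁) ξ = ξ from rfl, inner_self_eq_norm_sq] at this
  have hm (ξ : E₁) : Memℓp (fun i => k i ξ) 2 := by
    refine memℓp_gen ?_
    simpa using (hs ξ).summable
  let V₀ : E₁ →ₗᵢ[ℂ] lp (fun _ : ι => E₂) 2 :=
    { toFun ξ := ⟨fun i => k i ξ, hm ξ⟩
      map_add' ξ ψ := by ext i; exact map_add (k i) ξ ψ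
      map_smul' c ξ := by ext i; simp
      norm_map' ξ := by
        have h2 := lp.hasSum_norm (p := 2) (by simp) (⟨fun i => k i ξ, hm ξ⟩ : lp (fun _ : ι => E₂) 2)
        have h3 := (hs ξ).unique (by simpa using h2)
        exact ((sq_eq_sq₀ (norm_nonneg _) (norm_nonneg _)).1 h3).symm }
  refine ⟨((coordEquiv E₂ b).symm.toContinuousLinearEquiv : _ →L[ℂ] HTensor E₂ L) ∘L
    V₀.toContinuousLinearMap, ?_, fun i ξ => ?_⟩
  · ext ξ
    refine ext_inner_left ℂ fun ψ => ?_
    simp [adjoint_inner_right]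
  · rw [← coordEquiv_apply]
    simp [V₀]

theorem IsKraus.conjMap_isometry {ι : Type*} {b : HilbertBasis ι ℂ L} {k : ι → E₁ →L[ℂ] E₂}
    {T : (E₂ →L[ℂ] E₂) →ₗ[ℂ] (E₁ →L[ℂ] E₁)} (hT : IsKraus k T) {V : E₁ →L[ℂ] HTensor E₂ L}
    (hV : ∀ i ξ, bra E₂ (b i) (V ξ) = k i ξ) (a : E₂ →L[ℂ] E₂) :
    conjMap V (opTensor a (.id ℂ L)) = T a := by
  ext ψ
  refine ext_inner_left ℂ fun ξ => ?_
  rw [inner_conjMap]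
  refine (hasSum_inner_bra b _ _).unique ?_
  simpa [bra_opTensor_id, hV] using hT.hasSum_inner a ξ ψ

end Stinespring

section Assoc

variable {H K L H' K' L' : Type*}
  [NormedAddCommGroup H] [InnerProductSpace ℂ H]
  [NormedAddCommGroup K] [InnerProductSpace ℂ K]
  [NormedAddCommGroup L] [InnerProductSpace ℂ L]
  [NormedAddCommGroup H'] [InnerProductSpace ℂ H']
  [NormedAddCommGroup K'] [InnerProductSpace ℂ K']
  [NormedAddCommGroup L'] [InnerProductSpace ℂ L']

variable (H K L) in
/-- The associator as a bounded operator. -/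
abbrev assocCLM : HTensor (HTensor H K) L →L[ℂ] HTensor H (HTensor K L) :=
  (HTensor.assoc H K L).toContinuousLinearEquiv

variable (H K L) in
/-- The inverse associator as a bounded operator. -/
abbrev assocInv : HTensor H (HTensor K L) →L[ℂ] HTensor (HTensor H K) L :=
  (HTensor.assoc H K L).symm.toContinuousLinearEquiv

theorem HTensor.clm_ext₃ {E : Type*} [NormedAddCommGroup E] [NormedSpace ℂ E]
    {f g : HTensor (HTensor H K) L →L[ℂ] E}
    (h : ∀ x y z, f (tmulL (tmulL x y) z) = g (tmulL (tmulL x y) z)) : f = g := by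
  refine HTensor.clm_ext fun ζ z => ?_
  have : f ∘L (tmulL (H := HTensor H K)).flip z = g ∘L (tmulL (H := HTensor H K)).flip z :=
    HTensor.clm_ext fun x y => h x y z
  exact congr($this ζ)

/-- Naturality of the associator. -/
theorem assocCLM_comp_opTensor (a : H →L[ℂ] H') (b : K →L[ℂ] K') (c : L →L[ℂ] L') :
    assocCLM H' K' L' ∘L opTensor (opTensor a b) c =
      opTensor a (opTensor b c) ∘L assocCLM H K L :=
  HTensor.clm_ext₃ fun x y z => by simp

theorem opTensor_comp_assocInv (a : H →L[ℂ] H') (b : K →L[ℂ] K') (c : L →L[ℂ] L') :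
    opTensor (opTensor a b) c ∘L assocInv H K L =
      assocInv H' K' L' ∘L opTensor a (opTensor b c) := by
  ext ζ
  apply (HTensor.assoc H' K' L').injective
  have := congr($(assocCLM_comp_opTensor a b c) ((HTensor.assoc H K L).symm ζ))
  simpa using this

theorem adjoint_assocCLM [CompleteSpace H] [CompleteSpace K] :
    adjoint (assocCLM H K L) = assocInv H K L := by
  ext ξ
  refine ext_inner_left ℂ fun ψ => ?_
  rw [adjoint_inner_right]
  simpa using (HTensor.assoc H K L).inner_map_map ψ ((HTensor.assoc H K L).symm ξ)

end Assoc

section StinespringInner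

variable {H : Type*} [NormedAddCommGroup H] [InnerProductSpace ℂ H] [CompleteSpace H]
  {M : VonNeumannAlgebra H} {K₁ K₂ L : Ancilla}

theorem ampliate_eq (a : Joint H K₁ →L[ℂ] Joint H K₁) :
    ampliate L a = assocCLM H K₁ L ∘L opTensor a (.id ℂ L) ∘L assocInv H K₁ L := rfl

/-- The Stinespring isometry of a map with Kraus operators in `M ⊗̄ B(K₁, K₂)` belongs to
`M ⊗̄ B(K₁, K₂ ⊗ L)`. -/
theorem assocCLM_comp_mem_mOperators {ι : Type*} {b : HilbertBasis ι ℂ L}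
    {k : ι → Joint H K₁ →L[ℂ] Joint H K₂} (hk : ∀ i, k i ∈ mOperators M K₁ K₂)
    {V : Joint H K₁ →L[ℂ] HTensor (Joint H K₂) L}
    (hV : ∀ i ξ, bra (Joint H K₂) (b i) (V ξ) = k i ξ) :
    assocCLM H K₂ L ∘L V ∈ mOperators M K₁ (K₂.tensor L) := by
  rw [mem_mOperators_iff_commute]
  intro m hm
  have h1 : V ∘L opTensor m (.id ℂ K₁) = opTensor (opTensor m (.id ℂ K₂)) (.id ℂ L) ∘L V := by
    ext ξ
    refine (coordEquiv (Joint H K₂) b).injective (lp.ext (funext fun i => ?_))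
    have := congr($(mem_mOperators_iff_commute.1 (hk i) m hm) ξ)
    simpa [coordEquiv_apply, hV, bra_opTensor_id] using this
  have h2 := assocCLM_comp_opTensor m (.id ℂ K₂) (.id ℂ L)
  rw [opTensor_id] at h2
  rw [comp_assoc, h1, ← comp_assoc, h2, comp_assoc]

theorem adjoint_assocCLM_comp (V : Joint H K₁ →L[ℂ] HTensor (Joint H K₂) L) :
    adjoint (assocCLM H K₂ L ∘L V) ∘L (assocCLM H K₂ L ∘L V) = adjoint V ∘L V := by
  ext ξ
  refine ext_inner_left ℂ fun ψ => ?_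
  simp [adjoint_comp]

theorem conjMap_assocCLM_comp_ampliate (V : Joint H K₁ →L[ℂ] HTensor (Joint H K₂) L)
    (a : Joint H K₂ →L[ℂ] Joint H K₂) :
    conjMap (assocCLM H K₂ L ∘L V) (ampliate L a) = conjMap V (opTensor a (.id ℂ L)) := by
  ext ξ
  refine ext_inner_left ℂ fun ψ => ?_
  rw [inner_conjMap, inner_conjMap]
  simp [ampliate]

end StinespringInner

/-! ### Sequence spaces as ancillas -/

section Sequences

/-- The canonical basis of `ℓ²(Z)`. -/
def stdBasis (Z : Type) : HilbertBasis Z ℂ (lp (fun _ : Z => ℂ) 2) :=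
  HilbertBasis.ofRepr (.refl ℂ _)

theorem HilbertBasis.separableSpace {ι G : Type*} [Countable ι] [NormedAddCommGroup G]
    [InnerProductSpace ℂ G] (b : HilbertBasis ι ℂ G) : TopologicalSpace.SeparableSpace G := by
  rw [← TopologicalSpace.isSeparable_univ_iff]
  have h1 : TopologicalSpace.IsSeparable (Set.range b) := (Set.countable_range b).isSeparable
  have h2 := (h1.span (R := ℂ)).closure
  have h3 := congr(($b.dense_span : Set G))
  rw [Submodule.topologicalClosure_coe, Submodule.top_coe] at h3
  rwa [h3] at h2

/-- The ancilla `ℓ²(Z)`. -/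
def ellTwo (Z : Type) [Countable Z] [Nonempty Z] : Ancilla where
  carrier := lp (fun _ : Z => ℂ) 2
  separableSpace := HilbertBasis.separableSpace (stdBasis Z)
  nontrivial := ⟨stdBasis Z (Classical.arbitrary Z), 0, fun h => by
    simpa [h] using (stdBasis Z).orthonormal.1 (Classical.arbitrary Z)⟩

/-- The canonical basis of the ancilla `ℓ²(Z)`. -/
def ellTwoBasis (Z : Type) [Countable Z] [Nonempty Z] : HilbertBasis Z ℂ (ellTwo Z) :=
  stdBasis Z

theorem not_finiteDimensional_ellTwo : ¬ FiniteDimensional ℂ (ellTwo ℕ) := fun _ =>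
  not_finite_iff_infinite.2 (inferInstanceAs (Infinite ℕ))
    (ellTwoBasis ℕ).orthonormal.linearIndependent.finite

theorem not_finiteDimensional_tensor (K : Ancilla) :
    ¬ FiniteDimensional ℂ (K.tensor (ellTwo ℕ)) := by
  intro h
  obtain ⟨y, hy⟩ := exists_norm_eq K zero_le_one
  refine not_finiteDimensional_ellTwo
    (FiniteDimensional.of_injective (tmulL (K := ellTwo ℕ) y).toLinearMap ?_)
  refine (injective_iff_map_eq_zero _).2 fun z hz => ?_
  have := norm_tmulL y z
  rw [show tmulL y z = 0 from hz, hy, norm_zero, one_mul] at this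
  exact norm_eq_zero.1 this.symm

end Sequences

/-! ### Unitary dilations of inner channels -/

section Dilation

variable {H : Type*} [NormedAddCommGroup H] [InnerProductSpace ℂ H] [CompleteSpace H]

theorem IsSplit.opTensor {A B G : Type*}
    [NormedAddCommGroup A] [InnerProductSpace ℂ A] [CompleteSpace A]
    [NormedAddCommGroup B] [InnerProductSpace ℂ B] [CompleteSpace B]
    [NormedAddCommGroup G] [InnerProductSpace ℂ G] [CompleteSpace G]
    {a : A →L[ℂ] G} {b : B →L[ℂ] G} (h : IsSplit a b) :
    IsSplit (opTensor (.id ℂ H) a) (opTensor (.id ℂ H) b) where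
  left := by rw [opTensor_adjoint, opTensor_comp, h.left, adjoint_id, id_comp, opTensor_id]
  right := by rw [opTensor_adjoint, opTensor_comp, h.right, adjoint_id, id_comp, opTensor_id]
  sum := by
    rw [opTensor_adjoint, opTensor_adjoint, opTensor_comp, opTensor_comp, adjoint_id, id_comp,
      ← opTensor_add_right, h.sum, opTensor_id]

/-- There is a unit vector `Ω` such that the orthogonal complement of `K ⊗ Ω` in `K ⊗ ℓ²` is again
isomorphic to `K ⊗ ℓ²`. -/
theorem exists_isSplit_ket (K : Ancilla) : ∃ (Ω : ellTwo ℕ)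
    (s : K.tensor (ellTwo ℕ) →L[ℂ] K.tensor (ellTwo ℕ)), ‖Ω‖ = 1 ∧ IsSplit (ket K Ω) s := by
  obtain ⟨α, s₀, h⟩ := exists_isSplit (A := ℂ) not_finiteDimensional_ellTwo
    not_finiteDimensional_ellTwo
  have h1 : ‖α 1‖ = 1 := by
    have h2 := h.left_apply 1
    have h3 : ⟪α 1, α 1⟫_ℂ = 1 := by
      rw [← adjoint_inner_right, h2]; simp
    have h4 := congr(RCLike.re $h3)
    rw [inner_self_eq_norm_sq] at h4
    exact (sq_eq_sq₀ (norm_nonneg _) zero_le_one).1 (by simpa using h4)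
  have h2 : α ∘L adjoint α = ketBra (α 1) (α 1) := by
    ext x
    have h3 : adjoint α x = ⟪α 1, x⟫_ℂ • (1 : ℂ) := by
      rw [← adjoint_inner_right]; simp
    rw [comp_apply, h3, map_smul]
    simp
  refine ⟨α 1, opTensor (.id ℂ K) s₀, h1, ?_, h.opTensor.right, ?_⟩
  · rw [adjoint_ket, bra_comp_ket, inner_self_eq_norm_sq_to_K, h1]
    simp
  · have h3 := opTensor_ketBra (.id ℂ K) (α 1) (α 1)
    rw [id_comp] at h3
    rw [adjoint_ket, ← h3, ← h2, opTensor_adjoint, opTensor_comp, adjoint_id, id_comp,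
      ← opTensor_add_right, h.sum, opTensor_id]

variable {M : VonNeumannAlgebra H} {K₁ K₂ : Ancilla}

theorem id_opTensor_mem_mOperators (b : K₁ →L[ℂ] K₂) :
    opTensor (.id ℂ H) b ∈ mOperators M K₁ K₂ :=
  opTensor_mem_mOperators (one_mem M) b

theorem sub_mem_mOperators {k l : Joint H K₁ →L[ℂ] Joint H K₂} (hk : k ∈ mOperators M K₁ K₂)
    (hl : l ∈ mOperators M K₁ K₂) : k - l ∈ mOperators M K₁ K₂ := by
  rw [mem_mOperators_iff_commute] at *
  intro m hm
  rw [sub_comp, comp_sub, hk m hm, hl m hm]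

/-- The block matrix of `exists_unitary_dilation` is an `M`-operator if the isometry `W` is and the
decompositions come from the ancillas. -/
theorem dilation_mem_mOperators {N X X' Y Y' : Ancilla} {W : Joint H K₁ →L[ℂ] Joint H N}
    (hW : W ∈ mOperators M K₁ N) (i : K₁ →L[ℂ] X) (s : X' →L[ℂ] X) (c d : N →L[ℂ] X')
    (e : N →L[ℂ] Y) (s' : Y' →L[ℂ] Y) (r : K₁ →L[ℂ] Y') (t : N →L[ℂ] Y') :
    opTensor (.id ℂ H) e ∘L W ∘L adjoint (opTensor (.id ℂ H) i)
      + (opTensor (.id ℂ H) e ∘L (.id ℂ _ - W ∘L adjoint W)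
          + opTensor (.id ℂ H) s' ∘L opTensor (.id ℂ H) r ∘L adjoint W) ∘L
        adjoint (opTensor (.id ℂ H) c) ∘L adjoint (opTensor (.id ℂ H) s)
      + opTensor (.id ℂ H) s' ∘L opTensor (.id ℂ H) t ∘L
        adjoint (opTensor (.id ℂ H) d) ∘L adjoint (opTensor (.id ℂ H) s) ∈ mOperators M X Y := by
  have hc := fun {K K' : Ancilla} (b : K →L[ℂ] K') => id_opTensor_mem_mOperators (M := M) b
  have hc' := fun {K K' : Ancilla} (b : K →L[ℂ] K') => adjoint_mem_mOperators (hc b)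
  have hW' := adjoint_mem_mOperators hW
  refine add_mem_mOperators (add_mem_mOperators ?_ ?_) ?_
  · exact comp_mem_mOperators (hc _) (comp_mem_mOperators hW (hc' _))
  · refine comp_mem_mOperators (add_mem_mOperators (comp_mem_mOperators (hc _) ?_) ?_)
      (comp_mem_mOperators (hc' _) (hc' _))
    · refine sub_mem_mOperators ?_ (comp_mem_mOperators hW hW')
      have := hc (.id ℂ N)
      rwa [opTensor_id] at this
    · exact comp_mem_mOperators (hc _) (comp_mem_mOperators (hc _) hW')
  · exact comp_mem_mOperators (hc _) (comp_mem_mOperators (hc _)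
      (comp_mem_mOperators (hc' _) (hc' _)))

/-- An inner channel has a dilation by a unitary `M`-operator. -/
theorem IsInner.exists_dilation {T : JointMap H K₁ K₂} (hT : IsInner M T) (h1 : T 1 = 1) :
    ∃ (L : Ancilla) (Ω : L) (u : Joint H (K₁.tensor L) ≃ₗᵢ[ℂ] Joint H (K₂.tensor L)), ‖Ω‖ = 1 ∧
      (u.toContinuousLinearEquiv : Joint H (K₁.tensor L) →L[ℂ] Joint H (K₂.tensor L)) ∈
        mOperators M (K₁.tensor L) (K₂.tensor L) ∧
      ∀ a, T a = conjMap (ketMap Ω) (unitaryMap u (ampliate L a)) := by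
  obtain ⟨ι, _, k₀, hk₀, hT₀⟩ := hT
  obtain ⟨k, hT, hk'⟩ := IsKraus.nat hT₀
  have hk (n : ℕ) : k n ∈ mOperators M K₁ K₂ := by
    obtain h | ⟨i, h⟩ := hk' n
    · rw [h, mem_mOperators_iff_slice]
      intro e f
      have : slice (0 : Joint H K₁ →L[ℂ] Joint H K₂) e f = 0 := by ext; simp [slice_apply]
      rw [this]
      exact zero_mem M
    · exact h ▸ hk₀ i
  let L := ellTwo ℕ
  obtain ⟨V, hV1, hV⟩ := hT.exists_isometry (ellTwoBasis ℕ) h1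
  set W := assocCLM H K₂ L ∘L V with hW
  have hWM : W ∈ mOperators M K₁ (K₂.tensor L) := assocCLM_comp_mem_mOperators hk hV
  have hW1 : adjoint W ∘L W = .id ℂ _ := (adjoint_assocCLM_comp V).trans hV1
  obtain ⟨Ω, s, hΩ, hi⟩ := exists_isSplit_ket K₁
  obtain ⟨e₀, e₁, he⟩ := exists_isSplit (A := L) not_finiteDimensional_ellTwo
    not_finiteDimensional_ellTwo
  obtain ⟨c, d, hcd⟩ := exists_isSplit (A := K₂.tensor L) (not_finiteDimensional_tensor K₁)
    (not_finiteDimensional_tensor K₂)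
  obtain ⟨r, t, hrt⟩ := exists_isSplit (A := K₁) (not_finiteDimensional_tensor K₂)
    (not_finiteDimensional_tensor K₂)
  have hI : IsSplit (ketMap (H := H) (K := K₁) Ω) (opTensor (.id ℂ H) s) := hi.opTensor
  have hE := (he.opTensor (H := K₂)).opTensor (H := H)
  set E := opTensor (.id ℂ H) (opTensor (.id ℂ K₂) e₀)
  obtain ⟨u, hu⟩ := exists_unitary_dilation hW1 hI (hcd.opTensor (H := H)) hE
    (hrt.opTensor (H := H))
  have huI : (u.toContinuousLinearEquiv : _ →L[ℂ] Joint H (K₂.tensor L)) ∘L ketMap Ω = E ∘L W := by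
    rw [hu]
    ext ξ
    simp [hI.left_apply, hI.right_left_apply]
  have hEa (a : Joint H K₂ →L[ℂ] Joint H K₂) :
      conjMap E (ampliate L a) = ampliate L a := by
    have e1 := opTensor_comp_assocInv (.id ℂ H) (.id ℂ K₂) e₀
    have e2 := assocCLM_comp_opTensor (.id ℂ H) (.id ℂ K₂) e₀
    rw [opTensor_id] at e1 e2
    have e3 : ampliate L a ∘L E = E ∘L ampliate L a := by
      rw [ampliate_eq, comp_assoc, comp_assoc, ← e1, ← comp_assoc (opTensor a _), opTensor_comp,
        ← comp_assoc E, ← e2, comp_assoc (assocCLM _ _ _), ← comp_assoc (opTensor _ e₀),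
        opTensor_comp]
      simp only [id_comp, comp_id]
      rfl
    rw [conjMap_apply, e3, ← comp_assoc, hE.left, id_comp]
  refine ⟨L, Ω, u, hΩ, ?_, fun a => ?_⟩
  · rw [hu]
    exact dilation_mem_mOperators hWM _ s c d _ _ r t
  · rw [unitaryMap_eq, ← LinearMap.comp_apply, conjMap_comp, huI, ← conjMap_comp,
      LinearMap.comp_apply, hEa, hW, conjMap_assocCLM_comp_ampliate]
    exact (hT.conjMap_isometry hV a).symm

theorem Agent.ImplementsInner.dilations {A : Agent H} (hA : A.ImplementsInner M) :
    A.Dilations := by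
  intro K₁ K₂ T hT
  have hT' := (hA _ _ _ _).1 hT
  obtain ⟨S, hS, h⟩ := hT'.1.channel
  have h1 : T 1 = 1 := by
    rw [(isMapSum_single T).unique h]
    exact hS.unital
  obtain ⟨L, Ω, u, hΩ, hu, h⟩ := (hT'.2 ()).exists_dilation h1
  exact ⟨L, L, Ω, u, hΩ, (hA _ _ _ _).2
    (isInnerInstrument_conjMap hu (adjoint_comp_self_unitary u)), h⟩

theorem Agent.ImplementsInner.satisfiesAxioms [TopologicalSpace.SeparableSpace H] [Nontrivial H]
    {A : Agent H} (hA : A.ImplementsInner M) : A.SatisfiesAxioms where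
  consistency := hA.consistency
  limits := hA.limits
  ancillaControl := hA.ancillaControl
  reversibility := hA.reversibility
  dilations := hA.dilations
  selectionCompleteness := hA.selectionCompleteness

end Dilation

/-! ### Kraus operators as compressions of a dilation -/

section RadonNikodym

variable {E₁ E₂ L : Type*}
  [NormedAddCommGroup E₁] [InnerProductSpace ℂ E₁] [CompleteSpace E₁]
  [NormedAddCommGroup E₂] [InnerProductSpace ℂ E₂] [CompleteSpace E₂]
  [NormedAddCommGroup L] [InnerProductSpace ℂ L] [CompleteSpace L]

/-- A linear functional `F` with `|F v| ≤ ‖Q v‖` is of the form `⟪f, Q ·⟫` with `‖f‖ ≤ 1`. -/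
theorem exists_eq_inner_of_norm_le {V : Type*} [AddCommGroup V] [Module ℂ V] (F : V →ₗ[ℂ] ℂ)
    (Q : V →ₗ[ℂ] L) (h : ∀ v, ‖F v‖ ≤ ‖Q v‖) : ∃ f : L, ‖f‖ ≤ 1 ∧ ∀ v, F v = ⟪f, Q v⟫_ℂ := by
  have hker : LinearMap.ker Q ≤ LinearMap.ker F := fun v hv => by
    have := h v
    rw [LinearMap.mem_ker.1 hv, norm_zero] at this
    exact norm_le_zero_iff.1 this
  let g₀ : LinearMap.range Q →ₗ[ℂ] ℂ :=
    (LinearMap.ker Q).liftQ F hker ∘ₗ (LinearMap.quotKerEquivRange Q).symm.toLinearMap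
  have hg₀ (v : V) : g₀ ⟨Q v, v, rfl⟩ = F v := by
    have : (LinearMap.quotKerEquivRange Q).symm ⟨Q v, v, rfl⟩ = (LinearMap.ker Q).mkQ v := by
      rw [LinearEquiv.symm_apply_eq]; rfl
    simp only [g₀, LinearMap.comp_apply, LinearEquiv.coe_coe, this]
    exact Submodule.liftQ_apply _ _ _
  let g : LinearMap.range Q →L[ℂ] ℂ := g₀.mkContinuous 1 (by
    rintro ⟨_, v, rfl⟩
    rw [hg₀, one_mul]
    exact h v)
  obtain ⟨G, hG, hn⟩ := exists_extension_norm_eq (LinearMap.range Q) g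
  refine ⟨(InnerProductSpace.toDual ℂ L).symm G, ?_, fun v => ?_⟩
  · rw [LinearIsometryEquiv.norm_map, hn]
    exact LinearMap.mkContinuous_norm_le _ zero_le_one _
  · rw [InnerProductSpace.toDual_symm_apply, hG ⟨Q v, v, rfl⟩]
    exact (hg₀ v).symm

theorem opTensor_ketBra_left (e e' : E₂) : opTensor (ketBra e e') (.id ℂ L) =
    tmulL (K := L) e ∘L adjoint (tmulL (K := L) e') :=
  HTensor.clm_ext fun x z => by
    refine HTensor.ext_inner fun x' z' => ?_
    have h1 : adjoint (tmulL (K := L) e') (tmulL x z) = ⟪e', x⟫_ℂ • z :=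
      ext_inner_left ℂ fun w => by
        rw [adjoint_inner_right, inner_tmulL, inner_smul_right]
    simp [h1]

/-- If `T = B* (· ⊗ 1) B`, then every Kraus operator of `T` is of the form `(1 ⊗ ⟨f|) B` with
`‖f‖ ≤ 1`. This is the Radon–Nikodym theorem for completely positive maps of rank one. -/
theorem IsKraus.exists_eq_bra_comp {ι : Type*} {k : ι → E₁ →L[ℂ] E₂}
    {T : (E₂ →L[ℂ] E₂) →ₗ[ℂ] (E₁ →L[ℂ] E₁)} (hT : IsKraus k T) {B : E₁ →L[ℂ] HTensor E₂ L}
    (hB : ∀ a, T a = conjMap B (opTensor a (.id ℂ L))) (i : ι) :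
    ∃ f : L, ‖f‖ ≤ 1 ∧ k i = bra E₂ f ∘L B := by
  let F (i : ι) : (E₁ × E₂ →₀ ℂ) →ₗ[ℂ] ℂ := Finsupp.linearCombination ℂ fun p => ⟪p.2, k i p.1⟫_ℂ
  let Q : (E₁ × E₂ →₀ ℂ) →ₗ[ℂ] L :=
    Finsupp.linearCombination ℂ fun p => adjoint (tmulL (K := L) p.2) (B p.1)
  have key (v : E₁ × E₂ →₀ ℂ) : HasSum (fun i => ⟪F i v, F i v⟫_ℂ) ⟪Q v, Q v⟫_ℂ := by
    have h1 (p q : E₁ × E₂) :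
        HasSum (fun i => ⟪v p • ⟪p.2, k i p.1⟫_ℂ, v q • ⟪q.2, k i q.1⟫_ℂ⟫_ℂ)
          ⟪v p • adjoint (tmulL (K := L) p.2) (B p.1), v q • adjoint (tmulL (K := L) q.2) (B q.1)⟫_ℂ := by
      have h2 := (hT.hasSum_inner (ketBra p.2 q.2) p.1 q.1).mul_left (starRingEnd ℂ (v p) * v q)
      rw [hB, inner_conjMap, opTensor_ketBra_left, comp_apply, ← adjoint_inner_left] at h2
      convert! h2 using 2 with i
      · simp; ring
      · rw [inner_smul_left, inner_smul_right, mul_assoc]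
    have h3 := hasSum_sum (s := v.support) fun p _ => hasSum_sum (s := v.support) fun q _ => h1 p q
    simp only [← inner_sum, ← sum_inner] at h3
    exact h3
  obtain ⟨f, hf, h⟩ := exists_eq_inner_of_norm_le (F i) Q fun v => by
    have h1 := (key v).mapL (RCLike.reCLM (K := ℂ))
    simp only [RCLike.reCLM_apply, inner_self_eq_norm_sq] at h1
    exact (sq_le_sq₀ (norm_nonneg _) (norm_nonneg _)).1
      (le_hasSum h1 i fun _ _ => sq_nonneg _)
  refine ⟨f, hf, ?_⟩
  ext ξ
  refine ext_inner_left ℂ fun e => ?_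
  have := h (Finsupp.single (ξ, e) 1)
  simp only [F, Q, Finsupp.linearCombination_single, one_smul] at this
  rw [this, comp_apply, inner_bra_right, adjoint_inner_right]

end RadonNikodym

/-- Two completely positive maps that add up to a unital map form an instrument. -/
theorem isInstrument_bool {E₁ E₂ ι κ : Type*} [Countable ι] [Countable κ]
    [NormedAddCommGroup E₁] [InnerProductSpace ℂ E₁] [CompleteSpace E₁]
    [NormedAddCommGroup E₂] [InnerProductSpace ℂ E₂] [CompleteSpace E₂]
    {T₁ T₂ : (E₂ →L[ℂ] E₂) →ₗ[ℂ] (E₁ →L[ℂ] E₁)} {k : ι → E₁ →L[ℂ] E₂} {l : κ → E₁ →L[ℂ] E₂}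
    (hk : IsKraus k T₁) (hl : IsKraus l T₂) (h : T₁ 1 + T₂ 1 = 1) :
    IsInstrument (fun x : Bool => bif x then T₁ else T₂) := by
  obtain ⟨k', hk', -⟩ := hk.nat
  obtain ⟨l', hl', -⟩ := hl.nat
  refine IsKraus.isInstrument (ι := fun _ => ℕ) (k := fun x => bif x then k' else l')
    (S := T₁ + T₂) ?_ (fun a ξ ψ => ?_) h
  · rintro (_ | _)
    · exact hl'
    · exact hk'
  · have := hasSum_fintype fun x : Bool => ⟪ξ, (bif x then T₁ else T₂) a ψ⟫_ℂ
    simpa [inner_add_right] using this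

/-! ### Selectively implementable operations -/

section Selective

variable {H : Type*} [NormedAddCommGroup H] [InnerProductSpace ℂ H] [CompleteSpace H]
  {K₁ K₂ K₃ : Ancilla} (A : Agent H)

/-- The operation `a ↦ k* a k` is implementable as one outcome of an instrument. -/
def Agent.Imp (k : Joint H K₁ →L[ℂ] Joint H K₂) : Prop :=
  ∃ (X : Type) (_ : Countable X) (T : X → JointMap H K₁ K₂) (x : X),
    A.Implementable T ∧ T x = conjMap k

variable {A} (hA : A.SatisfiesAxioms)
include hA

theorem Agent.SatisfiesAxioms.imp_comp {k : Joint H K₁ →L[ℂ] Joint H K₂}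
    {l : Joint H K₂ →L[ℂ] Joint H K₃} (hk : A.Imp k) (hl : A.Imp l) : A.Imp (l ∘L k) := by
  obtain ⟨X, _, T, x, hT, hx⟩ := hk
  obtain ⟨Y, _, S, y, hS, hy⟩ := hl
  exact ⟨X × Y, inferInstance, _, (x, y), hA.consistency.comp T S hT hS, by
    rw [hx, hy, conjMap_comp]⟩

/-- Contractions between ancillas are implementable. -/
theorem Agent.SatisfiesAxioms.imp_opTensor (b : K₁ →L[ℂ] K₂) (hb : ‖b‖ ≤ 1) :
    A.Imp (opTensor (.id ℂ H) b) := by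
  set D : K₁ →L[ℂ] K₁ := 1 - adjoint b ∘L b with hD'
  have hD : 0 ≤ D := nonneg_iff_inner.2 fun ξ => by
    have h1 : ⟪ξ, D ξ⟫_ℂ = ((‖ξ‖ ^ 2 - ‖b ξ‖ ^ 2 : ℝ) : ℂ) := by
      simp [D, adjoint_inner_right, inner_self_eq_norm_sq_to_K]
    rw [h1]
    have h2 : ‖b ξ‖ ≤ ‖ξ‖ := (b.le_of_opNorm_le hb ξ).trans_eq (one_mul _)
    have h3 : ‖b ξ‖ ^ 2 ≤ ‖ξ‖ ^ 2 := by gcongr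
    exact_mod_cast sub_nonneg.2 h3
  set R := CFC.sqrt D
  have hR : 0 ≤ R := CFC.sqrt_nonneg D
  have hRR : R ∘L R = D := CFC.sqrt_mul_sqrt_self D
  have hRa : adjoint R = R := hR.isSelfAdjoint.adjoint_eq
  obtain ⟨f, hf⟩ := exists_norm_eq K₂ zero_le_one
  obtain ⟨w, _, ⟨c⟩⟩ := exists_hilbertBasis_countable K₁
  have h1 : adjoint b ∘L b + D = 1 := add_sub_cancel _ _
  have hS := isInstrument_bool (isKraus_single b) ((isKraus_single R).comp (isKraus_stateMap c f))
    (by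
      rw [LinearMap.comp_apply, stateMap_one hf, conjMap_apply, conjMap_apply, hRa]
      refine Eq.trans ?_ h1
      rw [← hRR]
      rfl)
  have hT := isInstrument_bool (isKraus_single (opTensor (.id ℂ H) b))
    ((isKraus_single (opTensor (.id ℂ H) R)).comp (isKraus_replaceMap (H := H) c f))
    (by
      rw [LinearMap.comp_apply, replaceMap_one hf, conjMap_apply, conjMap_apply, opTensor_adjoint,
        opTensor_adjoint, hRa, adjoint_id]
      change opTensor (.id ℂ H) (adjoint b) ∘L opTensor (.id ℂ H) b +
        opTensor (.id ℂ H) R ∘L opTensor (.id ℂ H) R = 1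
      rw [opTensor_comp, opTensor_comp, id_comp, ← opTensor_add_right, hRR, h1]
      exact opTensor_id)
  refine ⟨Bool, inferInstance, _, true, hA.ancillaControl _ hS _ hT ?_, rfl⟩
  rintro (_ | _) a y
  · have h2 : slice (opTensor a y) f f = ⟪f, y f⟫_ℂ • a := by
      ext x
      simp [slice_apply]
    change conjMap (opTensor (.id ℂ H) R) (opTensor (slice (opTensor a y) f f) (.id ℂ K₁)) =
      opTensor a (conjMap R (⟪f, y f⟫_ℂ • 1))
    rw [h2, conjMap_apply, conjMap_apply, opTensor_adjoint, opTensor_comp, opTensor_comp,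
      adjoint_id, id_comp, comp_id, id_comp, opTensor_smul_left, ← opTensor_smul_right]
    congr 1
    ext
    simp
  · change conjMap (opTensor (.id ℂ H) b) (opTensor a y) = opTensor a (conjMap b y)
    rw [conjMap_apply, conjMap_apply, opTensor_adjoint, opTensor_comp, opTensor_comp, adjoint_id,
      id_comp, comp_id]

/-- The compressions `(1 ⊗ p) u (1 ⊗ q)` of unitaries `u` with implementable channel by operators
on the ancillas. Under the axioms these are the multiples of the Kraus operators of implementable
channels; that they form a linear space is less evident for this description, but closure under
adjoints and the common dilation of a Kraus family are immediate. -/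
def Agent.kraus (A : Agent H) (K₁ K₂ : Ancilla) : Set (Joint H K₁ →L[ℂ] Joint H K₂) :=
  {k | ∃ (L₁ L₂ : Ancilla) (u : Joint H L₁ ≃ₗᵢ[ℂ] Joint H L₂) (p : L₂ →L[ℂ] K₂) (q : K₁ →L[ℂ] L₁),
    A.ImplementableChannel (unitaryMap u) ∧
      k = opTensor (.id ℂ H) p ∘L (u.toContinuousLinearEquiv : Joint H L₁ →L[ℂ] Joint H L₂) ∘L
        opTensor (.id ℂ H) q}

/-- The Kraus operators of an implementable channel have a common dilation. -/
theorem Agent.SatisfiesAxioms.exists_dilation {T : JointMap H K₁ K₂}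
    (hT : A.ImplementableChannel T) {ι : Type*} {k : ι → Joint H K₁ →L[ℂ] Joint H K₂}
    (hk : IsKraus k T) :
    ∃ (L₁ L₂ : Ancilla) (u : Joint H L₁ ≃ₗᵢ[ℂ] Joint H L₂) (q : K₁ →L[ℂ] L₁),
      A.ImplementableChannel (unitaryMap u) ∧ ‖q‖ ≤ 1 ∧ ∀ i, ∃ p : L₂ →L[ℂ] K₂, ‖p‖ ≤ 1 ∧
        k i = opTensor (.id ℂ H) p ∘L (u.toContinuousLinearEquiv : Joint H L₁ →L[ℂ] Joint H L₂) ∘L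
          opTensor (.id ℂ H) q := by
  obtain ⟨L₁, L₂, Ω, u, hΩ, hu, h⟩ := hA.dilations T hT
  refine ⟨K₁.tensor L₁, K₂.tensor L₂, u, ket K₁ Ω, hu, ?_, fun i => ?_⟩
  · exact opNorm_le_bound _ zero_le_one fun x => by
      rw [norm_ket_apply_of_norm_eq_one hΩ, one_mul]
  · set U := (u.toContinuousLinearEquiv : Joint H (K₁.tensor L₁) →L[ℂ] Joint H (K₂.tensor L₂))
      with hU
    have hB (a : Joint H K₂ →L[ℂ] Joint H K₂) :
        T a = conjMap (assocInv H K₂ L₂ ∘L U ∘L ketMap Ω) (opTensor a (.id ℂ L₂)) := by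
      rw [h a, unitaryMap_eq]
      ext ψ
      refine ext_inner_left ℂ fun ξ => ?_
      rw [inner_conjMap, inner_conjMap, inner_conjMap, ← hU]
      have := (HTensor.assoc H K₂ L₂).symm.inner_map_map (U (ketMap Ω ξ))
        (ampliate L₂ a (U (ketMap Ω ψ)))
      rw [← this]
      simp [ampliate]
    obtain ⟨f, hf, hki⟩ := hk.exists_eq_bra_comp hB i
    refine ⟨bra K₂ f, ?_, ?_⟩
    · refine opNorm_le_bound _ zero_le_one fun ζ => (norm_bra_apply_le f ζ).trans ?_
      gcongr
    · have h2 : bra (Joint H K₂) f ∘L assocInv H K₂ L₂ = opTensor (.id ℂ H) (bra K₂ f) := by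
        have : bra (Joint H K₂) f = opTensor (.id ℂ H) (bra K₂ f) ∘L assocCLM H K₂ L₂ :=
          HTensor.clm_ext₃ fun x y z => by simp
        ext ζ
        simp [this]
      rw [hki, ← comp_assoc, h2]
      rfl

theorem Agent.SatisfiesAxioms.imp_of_isKraus {T : JointMap H K₁ K₂}
    (hT : A.ImplementableChannel T) {ι : Type*} {k : ι → Joint H K₁ →L[ℂ] Joint H K₂}
    (hk : IsKraus k T) (i : ι) : A.Imp (k i) := by
  obtain ⟨L₁, L₂, u, q, hu, hq, h⟩ := hA.exists_dilation hT hk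
  obtain ⟨p, hp, hi⟩ := h i
  rw [hi]
  exact hA.imp_comp (hA.imp_comp (hA.imp_opTensor q hq)
    ⟨Unit, inferInstance, _, (), hu, rfl⟩) (hA.imp_opTensor p hp)

theorem Agent.SatisfiesAxioms.mem_kraus_of_isKraus {T : JointMap H K₁ K₂}
    (hT : A.ImplementableChannel T) {ι : Type*} {k : ι → Joint H K₁ →L[ℂ] Joint H K₂}
    (hk : IsKraus k T) (i : ι) : k i ∈ A.kraus K₁ K₂ := by
  obtain ⟨L₁, L₂, u, q, hu, hq, h⟩ := hA.exists_dilation hT hk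
  obtain ⟨p, hp, hi⟩ := h i
  exact ⟨L₁, L₂, u, p, q, hu, hi⟩

/-- The Kraus operators of an implementable instrument form a Kraus family of an implementable
channel. -/
theorem Agent.SatisfiesAxioms.exists_channel {X : Type} [Countable X] {T : X → JointMap H K₁ K₂}
    (hT : A.Implementable T) {ι : X → Type*} {k : ∀ x, ι x → Joint H K₁ →L[ℂ] Joint H K₂}
    (hk : ∀ x, IsKraus (k x) (T x)) :
    ∃ S : JointMap H K₁ K₂, A.ImplementableChannel S ∧
      IsKraus (fun p : Σ x, ι x => k p.1 p.2) S := by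
  obtain ⟨S, -, h⟩ := (A.isInstrument hT).channel
  exact ⟨S, hA.consistency.discard T S hT h, IsKraus.sigma hk h⟩

end Selective

/-! ### The Kraus operators of an agent form a self-adjoint operator category -/

section KrausSpace

theorem IsKraus.add {E₁ E₂ ι κ : Type*}
    [NormedAddCommGroup E₁] [InnerProductSpace ℂ E₁] [CompleteSpace E₁]
    [NormedAddCommGroup E₂] [InnerProductSpace ℂ E₂] [CompleteSpace E₂]
    {T S : (E₂ →L[ℂ] E₂) →ₗ[ℂ] (E₁ →L[ℂ] E₁)} {k : ι → E₁ →L[ℂ] E₂} {l : κ → E₁ →L[ℂ] E₂}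
    (hk : IsKraus k T) (hl : IsKraus l S) : IsKraus (Sum.elim k l) (T + S) := by
  intro a ξ ψ
  rw [LinearMap.add_apply, add_apply, inner_add_right]
  exact HasSum.sum (hk a ξ ψ) (hl a ξ ψ)

variable {H : Type*} [NormedAddCommGroup H] [InnerProductSpace ℂ H] [CompleteSpace H]
  [TopologicalSpace.SeparableSpace H] [Nontrivial H]
  {K₁ K₂ K₃ : Ancilla} {A : Agent H} (hA : A.SatisfiesAxioms)

theorem adjoint_mem_kraus (hA : A.SatisfiesAxioms) {k : Joint H K₁ →L[ℂ] Joint H K₂}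
    (hk : k ∈ A.kraus K₁ K₂) : adjoint k ∈ A.kraus K₂ K₁ := by
  obtain ⟨L₁, L₂, u, p, q, hu, rfl⟩ := hk
  refine ⟨L₂, L₁, u.symm, adjoint q, adjoint p, hA.reversibility u hu, ?_⟩
  rw [adjoint_comp, adjoint_comp, opTensor_adjoint, opTensor_adjoint, adjoint_id, adjoint_unitary,
    comp_assoc]

theorem smul_mem_kraus (c : ℂ) {k : Joint H K₁ →L[ℂ] Joint H K₂} (hk : k ∈ A.kraus K₁ K₂) :
    c • k ∈ A.kraus K₁ K₂ := by
  obtain ⟨L₁, L₂, u, p, q, hu, rfl⟩ := hk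
  refine ⟨L₁, L₂, u, c • p, q, hu, ?_⟩
  rw [opTensor_smul_right, smul_comp]

include hA

theorem opTensor_mem_kraus (b : K₁ →L[ℂ] K₂) : opTensor (.id ℂ H) b ∈ A.kraus K₁ K₂ := by
  refine ⟨K₁, K₁, .refl ℂ _, b, .id ℂ _, ?_, ?_⟩
  · have h1 : unitaryMap (.refl ℂ (Joint H K₁)) = LinearMap.id := by
      ext a ξ
      refine ext_inner_left ℂ fun ψ => ?_
      rw [unitaryMap_eq, inner_conjMap]
      rfl
    refine hA.ancillaControl (fun _ : Unit => conjMap (.id ℂ K₁))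
      (isChannel_conjMap (by simp [adjoint_id])).isInstrument _
      (isChannel_conjMap (adjoint_comp_self_unitary _)).isInstrument fun x a c => ?_
    rw [h1]
    simp [adjoint_id]
  · rw [opTensor_id]
    rfl

/-- Small multiples of operators in `A.kraus` are implementable. -/
theorem exists_imp_smul {k : Joint H K₁ →L[ℂ] Joint H K₂} (hk : k ∈ A.kraus K₁ K₂) :
    ∃ r > 0, ∀ s : ℝ, 0 ≤ s → s ≤ r → A.Imp ((s : ℂ) • k) := by
  obtain ⟨L₁, L₂, u, p, q, hu, rfl⟩ := hk
  have hp : 0 < 1 + ‖p‖ := by positivity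
  have hq : 0 < 1 + ‖q‖ := by positivity
  refine ⟨(1 + ‖p‖)⁻¹ * (1 + ‖q‖)⁻¹, by positivity, fun s hs hs' => ?_⟩
  have h1 : A.Imp (opTensor (.id ℂ H) (((s * (1 + ‖q‖) : ℝ) : ℂ) • p)) := by
    refine hA.imp_opTensor _ ?_
    rw [norm_smul, Complex.norm_real, Real.norm_of_nonneg (by positivity)]
    calc _ ≤ (1 + ‖p‖)⁻¹ * (1 + ‖q‖)⁻¹ * (1 + ‖q‖) * (1 + ‖p‖) := by gcongr; linarith
      _ = 1 := by field_simp
  have h2 : A.Imp (opTensor (.id ℂ H) ((((1 + ‖q‖)⁻¹ : ℝ) : ℂ) • q)) := by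
    refine hA.imp_opTensor _ ?_
    rw [norm_smul, Complex.norm_real, Real.norm_of_nonneg (by positivity), inv_mul_le_iff₀ hq]
    linarith
  have h3 := hA.imp_comp (hA.imp_comp h2 ⟨Unit, inferInstance, _, (), hu, rfl⟩) h1
  convert! h3 using 1
  rw [opTensor_smul_right, opTensor_smul_right, comp_smul, comp_smul, smul_comp, smul_smul]
  congr 1
  push_cast
  have : (1 + ‖q‖ : ℂ) ≠ 0 := by exact_mod_cast hq.ne'
  field_simp

/-- Given Kraus operators for some of the outcomes of an implementable instrument, the sum channel
has a Kraus decomposition containing all of them. -/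
theorem exists_isKraus_of_implementable {X : Type} [Countable X] {T : X → JointMap H K₁ K₂}
    (hT : A.Implementable T) (s : Set X) {ι : X → Type}
    (k : ∀ x, ι x → Joint H K₁ →L[ℂ] Joint H K₂) (hk : ∀ x ∈ s, IsKraus (k x) (T x)) :
    ∃ (S : JointMap H K₁ K₂) (κ : Type) (l : κ → Joint H K₁ →L[ℂ] Joint H K₂),
      A.ImplementableChannel S ∧ IsKraus l S ∧ ∀ x ∈ s, ∀ i, ∃ j, l j = k x i := by
  have h (x : X) : ∃ (κ : Type) (l : κ → Joint H K₁ →L[ℂ] Joint H K₂), IsKraus l (T x) ∧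
      (x ∈ s → ∀ i, ∃ j, l j = k x i) := by
    by_cases hx : x ∈ s
    · exact ⟨ι x, k x, hk x hx, fun _ i => ⟨i, rfl⟩⟩
    · obtain ⟨l, hl⟩ := ((A.isInstrument hT).cp x).exists_kraus ((A.isInstrument hT).normal x)
      exact ⟨ℕ, l, hl, fun h => absurd h hx⟩
  choose κ l hl hls using h
  obtain ⟨S, hS, hlS⟩ := hA.exists_channel hT hl
  refine ⟨S, _, _, hS, hlS, fun x hx i => ?_⟩
  obtain ⟨j, hj⟩ := hls x hx i
  exact ⟨⟨x, j⟩, hj⟩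

/-- The Kraus operators of an implementable instrument belong to `A.kraus`. -/
theorem mem_kraus_of_implementable {X : Type} [Countable X] {T : X → JointMap H K₁ K₂}
    (hT : A.Implementable T) {x : X} {ι : Type} {k : ι → Joint H K₁ →L[ℂ] Joint H K₂}
    (hk : IsKraus k (T x)) (i : ι) : k i ∈ A.kraus K₁ K₂ := by
  obtain ⟨S, κ, l, hS, hl, h⟩ := exists_isKraus_of_implementable hA hT {x} (fun _ => k)
    (by rintro _ rfl; exact hk)
  obtain ⟨j, hj⟩ := h x rfl i
  exact hj ▸ hA.mem_kraus_of_isKraus hS hl j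

theorem mem_kraus_of_imp {k : Joint H K₁ →L[ℂ] Joint H K₂} (hk : A.Imp k) : k ∈ A.kraus K₁ K₂ := by
  obtain ⟨X, _, T, x, hT, hx⟩ := hk
  exact mem_kraus_of_implementable hA hT (hx ▸ isKraus_single k) ()

theorem mem_kraus_of_smul {k : Joint H K₁ →L[ℂ] Joint H K₂} {s : ℝ} (hs : 0 < s)
    (hk : (s : ℂ) • k ∈ A.kraus K₁ K₂) : k ∈ A.kraus K₁ K₂ := by
  have := smul_mem_kraus (s : ℂ)⁻¹ hk
  rwa [inv_smul_smul₀ (by exact_mod_cast hs.ne')] at this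

theorem comp_mem_kraus {k : Joint H K₁ →L[ℂ] Joint H K₂} {l : Joint H K₂ →L[ℂ] Joint H K₃}
    (hl : l ∈ A.kraus K₂ K₃) (hk : k ∈ A.kraus K₁ K₂) : l ∘L k ∈ A.kraus K₁ K₃ := by
  obtain ⟨r, hr, hkr⟩ := exists_imp_smul hA hk
  obtain ⟨s, hs, hls⟩ := exists_imp_smul hA hl
  have := mem_kraus_of_imp hA (hA.imp_comp (hkr r hr.le le_rfl) (hls s hs.le le_rfl))
  refine mem_kraus_of_smul hA (mul_pos hs hr) ?_
  rwa [comp_smul, smul_comp, smul_smul, mul_comm, ← Complex.ofReal_mul] at this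

/-- For a finite family of implementable operations `a ↦ k* a k` with `∑ k* k ≤ 1` there is an
instrument that implements all of them. -/
theorem exists_implementable_of_imp {Y : Type} [Fintype Y] {k : Y → Joint H K₁ →L[ℂ] Joint H K₂}
    (hk : ∀ y, A.Imp (k y)) (h1 : ∀ ξ, ∑ y, ‖k y ξ‖ ^ 2 ≤ ‖ξ‖ ^ 2) :
    ∃ S : Option Y → JointMap H K₁ K₂, A.Implementable S ∧ ∀ y, S (some y) = conjMap (k y) := by
  choose X hX T x hT hx using hk
  obtain ⟨S, hS, h⟩ := hA.selectionCompleteness T hT x (by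
    rw [← sub_nonneg]
    refine nonneg_iff_inner.2 fun ξ => ?_
    have h2 : ⟪ξ, (1 - (∑ y, T y (x y)) 1) ξ⟫_ℂ = ((‖ξ‖ ^ 2 - ∑ y, ‖k y ξ‖ ^ 2 : ℝ) : ℂ) := by
      have h3 (y : Y) : ⟪ξ, T y (x y) 1 ξ⟫_ℂ = (‖k y ξ‖ : ℂ) ^ 2 := by
        rw [hx, inner_conjMap]
        exact inner_self_eq_norm_sq_to_K _
      rw [sub_apply, inner_sub_right, LinearMap.sum_apply, _root_.sum_apply, inner_sum]
      simp only [h3]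
      rw [show (1 : Joint H K₁ →L[ℂ] Joint H K₁) ξ = ξ from rfl, inner_self_eq_norm_sq_to_K]
      simp
    rw [h2]
    exact_mod_cast sub_nonneg.2 (h1 ξ))
  exact ⟨S, hS, fun y => (h y).trans (hx y)⟩

/-- Small multiples of `k` and `l` are outcomes of one instrument, by selection-completeness. Hence
they are Kraus operators of one channel, `s k = (1 ⊗ p) u (1 ⊗ q)` and `s l = (1 ⊗ p') u (1 ⊗ q)`
with the same `u` and `q`, and the sum is `(1 ⊗ (p + p')) u (1 ⊗ q)`. -/
theorem add_mem_kraus {k l : Joint H K₁ →L[ℂ] Joint H K₂} (hk : k ∈ A.kraus K₁ K₂)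
    (hl : l ∈ A.kraus K₁ K₂) : k + l ∈ A.kraus K₁ K₂ := by
  obtain ⟨r, hr, hkr⟩ := exists_imp_smul hA hk
  obtain ⟨r', hr', hlr⟩ := exists_imp_smul hA hl
  set C := 1 + ‖k‖ + ‖l‖ with hC'
  have hC : 0 < C := by positivity
  set s := min (min r r') C⁻¹ with hs'
  have hs : 0 < s := lt_min (lt_min hr hr') (by positivity)
  have hsr : s ≤ r := (min_le_left _ _).trans (min_le_left _ _)
  have hsr' : s ≤ r' := (min_le_left _ _).trans (min_le_right _ _)
  have hsC : s * (‖k‖ + ‖l‖) ≤ 1 := by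
    calc _ ≤ C⁻¹ * C := by gcongr; exacts [min_le_right _ _, by linarith]
      _ = 1 := by field_simp
  let v : Bool → Joint H K₁ →L[ℂ] Joint H K₂ := fun y => bif y then (s : ℂ) • k else (s : ℂ) • l
  have hv : ∀ y, A.Imp (v y) := by
    rintro (_ | _)
    exacts [hlr s hs.le hsr', hkr s hs.le hsr]
  obtain ⟨S, hS, hSv⟩ := exists_implementable_of_imp hA hv fun ξ => by
    have h1 : ‖k ξ‖ ≤ ‖k‖ * ‖ξ‖ := le_opNorm _ _
    have h2 : ‖l ξ‖ ≤ ‖l‖ * ‖ξ‖ := le_opNorm _ _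
    have h3 : s * (‖k ξ‖ + ‖l ξ‖) ≤ ‖ξ‖ := by
      calc _ ≤ s * (‖k‖ * ‖ξ‖ + ‖l‖ * ‖ξ‖) := by gcongr
        _ = s * (‖k‖ + ‖l‖) * ‖ξ‖ := by ring
        _ ≤ 1 * ‖ξ‖ := by gcongr
        _ = _ := one_mul _
    have h4 : 0 ≤ s * ‖k ξ‖ := by positivity
    have h5 : 0 ≤ s * ‖l ξ‖ := by positivity
    simp only [v, Fintype.sum_bool, cond_true, cond_false, smul_apply, norm_smul,
      Complex.norm_real, Real.norm_of_nonneg hs.le]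
    calc _ ≤ (s * (‖k ξ‖ + ‖l ξ‖)) ^ 2 := by nlinarith
      _ ≤ _ := by gcongr
  obtain ⟨S', κ, w, hS', hw, h⟩ := exists_isKraus_of_implementable hA hS (Set.range some)
    (ι := fun _ => Unit) (fun o _ => o.elim 0 v) (by
      rintro _ ⟨y, rfl⟩
      rw [hSv]
      exact isKraus_single _)
  obtain ⟨L₁, L₂, u, q, hu, -, hwu⟩ := hA.exists_dilation hS' hw
  obtain ⟨i, hi⟩ := h (some true) ⟨true, rfl⟩ ()
  obtain ⟨j, hj⟩ := h (some false) ⟨false, rfl⟩ ()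
  obtain ⟨p, -, hp⟩ := hwu i
  obtain ⟨p', -, hp'⟩ := hwu j
  refine mem_kraus_of_smul hA hs ⟨L₁, L₂, u, p + p', q, hu, ?_⟩
  rw [opTensor_add_right, add_comp, ← hp, ← hp', hi, hj, smul_add]
  rfl

/-- Contractions in `A.kraus` are implementable. A multiple `k / √n` is, so there is an instrument with
`n` outcomes `a ↦ k* a k / n` each and one more outcome; discarding the outcome gives an implementable
channel with `k` among its Kraus operators. -/
theorem imp_of_mem_kraus {k : Joint H K₁ →L[ℂ] Joint H K₂} (hk : k ∈ A.kraus K₁ K₂)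
    (h1 : ‖k‖ ≤ 1) : A.Imp k := by
  obtain ⟨r, hr, hkr⟩ := exists_imp_smul hA hk
  obtain ⟨n, hn⟩ := exists_nat_gt (r⁻¹ ^ 2)
  have hn0 : (0 : ℝ) < n := (by positivity : (0 : ℝ) < r⁻¹ ^ 2).trans hn
  -- `n` copies of the operation with Kraus operator `k / √n`
  set s := (√n)⁻¹ with hs'
  have hs : s ^ 2 = (n : ℝ)⁻¹ := by rw [hs', inv_pow, Real.sq_sqrt hn0.le]
  have hsr : s ≤ r := by
    rw [hs', inv_le_comm₀ (by positivity) hr]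
    exact Real.le_sqrt_of_sq_le hn.le
  have hs0 : 0 ≤ s := by positivity
  obtain ⟨S, hS, hSk⟩ := exists_implementable_of_imp hA (Y := Fin n)
    (fun _ => hkr s hs0 hsr) fun ξ => by
      have h2 : ‖k ξ‖ ≤ ‖ξ‖ := (k.le_of_opNorm_le h1 ξ).trans_eq (one_mul _)
      simp only [smul_apply, norm_smul, Complex.norm_real, Real.norm_of_nonneg hs0, mul_pow, hs,
        Finset.sum_const, Finset.card_univ, Fintype.card_fin, nsmul_eq_mul]
      rw [mul_inv_cancel_left₀ hn0.ne']
      gcongr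
  have hin := A.isInstrument hS
  obtain ⟨l, hl⟩ := (hin.cp none).exists_kraus (hin.normal none)
  refine hA.imp_of_isKraus (hA.consistency.discard S (conjMap k + S none) hS fun a ξ ψ => ?_)
    ((isKraus_single k).add hl) (Sum.inl ())
  have h2 : ⟪ξ, (conjMap k + S none) a ψ⟫_ℂ = ∑ o, ⟪ξ, S o a ψ⟫_ℂ := by
    have h3 : (s : ℂ) * (s : ℂ) = (n : ℂ)⁻¹ := by
      have := congr((($hs : ℝ) : ℂ))
      push_cast at this
      rw [← this, sq]
    have h4 : (n : ℂ) ≠ 0 := by exact_mod_cast hn0.ne'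
    rw [LinearMap.add_apply, add_apply, inner_add_right, Fintype.sum_option, add_comm]
    simp only [hSk, inner_conjMap, smul_apply, map_smul, inner_smul_left, inner_smul_right,
      Finset.sum_const, Finset.card_univ, Fintype.card_fin, nsmul_eq_mul, Complex.conj_ofReal]
    rw [← mul_assoc (s : ℂ), h3, mul_inv_cancel_left₀ h4]
  rw [h2]
  exact hasSum_fintype _

end KrausSpace

/-! ### Density theorems -/

section Density

theorem starProjection_comp_of_invariant {G : Type*} [NormedAddCommGroup G]
    [InnerProductSpace ℂ G] [CompleteSpace G] (Q : Submodule ℂ G) [Q.HasOrthogonalProjection]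
    {t : G →L[ℂ] G} (h : ∀ ζ ∈ Q, t ζ ∈ Q) (h' : ∀ ζ ∈ Q, adjoint t ζ ∈ Q) :
    Q.starProjection ∘L t = t ∘L Q.starProjection := by
  ext ζ
  refine Submodule.eq_starProjection_of_mem_of_inner_eq_zero
    (h _ (Submodule.starProjection_apply_mem _ _)) fun w hw => ?_
  change ⟪t ζ - t (Q.starProjection ζ), w⟫_ℂ = 0
  rw [← map_sub, ← adjoint_inner_right]
  exact Submodule.starProjection_inner_eq_zero ζ _ (h' w hw)

/-- The double commutant theorem for cyclic subspaces: the closure of `(B ⊗ 1) v` is invariant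
under `B'' ⊗ 1`. -/
theorem opTensor_mem_closure_of_mem_centralizer {H L : Type*} [NormedAddCommGroup H]
    [InnerProductSpace ℂ H] [CompleteSpace H] [NormedAddCommGroup L] [InnerProductSpace ℂ L]
    [CompleteSpace L] (B : StarSubalgebra ℂ (H →L[ℂ] H)) (v : HTensor H L) {m : H →L[ℂ] H}
    (hm : m ∈ Set.centralizer (Set.centralizer (B : Set (H →L[ℂ] H)))) :
    opTensor m (.id ℂ L) v ∈ closure {ζ | ∃ a ∈ B, ζ = opTensor a (.id ℂ L) v} := by
  let P : Submodule ℂ (HTensor H L) :=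
    { carrier := {ζ | ∃ a ∈ B, ζ = opTensor a (.id ℂ L) v}
      add_mem' := by
        rintro _ _ ⟨a, ha, rfl⟩ ⟨b, hb, rfl⟩
        exact ⟨a + b, add_mem ha hb, by rw [opTensor_add_left, add_apply]⟩
      zero_mem' := ⟨0, zero_mem B, by
        rw [← zero_smul ℂ (0 : H →L[ℂ] H), opTensor_smul_left, zero_smul, zero_apply]⟩
      smul_mem' := by
        rintro c _ ⟨a, ha, rfl⟩
        exact ⟨c • a, SMulMemClass.smul_mem c ha, by rw [opTensor_smul_left, smul_apply]⟩ }
  change _ ∈ P.topologicalClosure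
  have hc : CompleteSpace P.topologicalClosure :=
    (Submodule.isClosed_topologicalClosure P).completeSpace_coe
  have hmaps (a : H →L[ℂ] H) (ha : a ∈ B) (ζ : HTensor H L) (hζ : ζ ∈ P.topologicalClosure) :
      opTensor a (.id ℂ L) ζ ∈ P.topologicalClosure := by
    have h1 (ζ : HTensor H L) (hζ : ζ ∈ P) : opTensor a (.id ℂ L) ζ ∈ P := by
      obtain ⟨b, hb, rfl⟩ := hζ
      refine ⟨a * b, mul_mem ha hb, ?_⟩
      rw [mul_def, ← comp_apply, opTensor_comp, comp_id]
    exact map_mem_closure (opTensor a (.id ℂ L)).continuous hζ h1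
  have hcomm : P.topologicalClosure.starProjection ∘L opTensor m (.id ℂ L) =
      opTensor m (.id ℂ L) ∘L P.topologicalClosure.starProjection := by
    rw [intertwines_iff_slice]
    intro f g
    refine hm _ fun a ha => ?_
    refine ((intertwines_iff_slice _ a a).1 ?_ f g).symm
    refine starProjection_comp_of_invariant _ (hmaps a ha) ?_
    rw [opTensor_id_adjoint]
    exact hmaps (adjoint a) (star_mem ha)
  have hv : v ∈ P.topologicalClosure := Submodule.le_topologicalClosure P
    ⟨1, one_mem B, by rw [show (1 : H →L[ℂ] H) = .id ℂ H from rfl, opTensor_id]; rfl⟩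
  have h3 := congr($hcomm v)
  rw [comp_apply, comp_apply, Submodule.starProjection_eq_self_iff.2 hv] at h3
  rw [← h3]
  exact Submodule.starProjection_apply_mem _ _

/-- The double commutant theorem, for weakly continuous functionals: a functional
`a ↦ ∑ ⟪yⱼ, a xⱼ⟫` that vanishes on a unital *-algebra vanishes on its double commutant. -/
theorem sum_inner_eq_zero_of_mem_centralizer {H : Type*} [NormedAddCommGroup H]
    [InnerProductSpace ℂ H] [CompleteSpace H] (B : StarSubalgebra ℂ (H →L[ℂ] H)) {J : Type*}
    [Fintype J] {x y : J → H} (h : ∀ a ∈ B, ∑ j, ⟪y j, a (x j)⟫_ℂ = 0) {m : H →L[ℂ] H}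
    (hm : m ∈ Set.centralizer (Set.centralizer (B : Set (H →L[ℂ] H)))) :
    ∑ j, ⟪y j, m (x j)⟫_ℂ = 0 := by
  classical
  have he := orthonormal_iff_ite.1 (EuclideanSpace.basisFun J ℂ).orthonormal
  generalize (EuclideanSpace.basisFun J ℂ : J → EuclideanSpace ℂ J) = e at he
  have key (a : H →L[ℂ] H) : ⟪∑ j, tmulL (y j) (e j),
      opTensor a (.id ℂ _) (∑ j, tmulL (x j) (e j))⟫_ℂ = ∑ j, ⟪y j, a (x j)⟫_ℂ := by
    simp only [map_sum, opTensor_tmulL, id_apply, sum_inner, inner_sum, inner_tmulL, he]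
    simp
  rw [← key]
  refine closure_minimal (t := {ζ | ⟪∑ j, tmulL (y j) (e j), ζ⟫_ℂ = 0}) ?_
    (isClosed_eq (by fun_prop) continuous_const) (opTensor_mem_closure_of_mem_centralizer B _ hm)
  rintro _ ⟨a, ha, rfl⟩
  exact (key a).trans (h a ha)

variable {E F : Type*}
  [NormedAddCommGroup E] [InnerProductSpace ℂ E] [CompleteSpace E]
  [NormedAddCommGroup F] [InnerProductSpace ℂ F] [CompleteSpace F]

theorem mem_strongClosure_of_forall_exists {C : Set (E →L[ℂ] F)} {k : E →L[ℂ] F}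
    (h : ∀ (s : Finset E) (ε : ℝ), 0 < ε → ∃ l ∈ C, ∀ ξ ∈ s, ‖l ξ - k ξ‖ < ε) :
    k ∈ strongClosure C := by
  have hb := hasBasis_pi fun ξ : E => Metric.nhds_basis_ball (x := k ξ)
  rw [← nhds_pi] at hb
  refine (mem_closure_iff_nhds_basis hb).2 fun ⟨I, r⟩ ⟨hI, hr⟩ => ?_
  obtain ⟨ε, hεr, hε⟩ := (((eventually_all_finite hI).2 fun i hi =>
    (eventually_lt_nhds (hr i hi)).filter_mono nhdsWithin_le_nhds).and
      (self_mem_nhdsWithin (a := (0 : ℝ)) (s := Set.Ioi 0))).exists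
  obtain ⟨l, hl, hlk⟩ := h hI.toFinset ε hε
  refine ⟨_, ⟨l, hl, rfl⟩, fun ξ hξ => ?_⟩
  rw [mem_ball_iff_norm]
  exact (hlk ξ (hI.mem_toFinset.2 hξ)).trans (hεr ξ hξ)

/-- If every functional `y ↦ ∑ ⟪ηⱼ, y ξⱼ⟫` that vanishes on `C` vanishes at `v`, then `v` can be
approximated by elements of `C` in the strong-* topology. -/
theorem exists_strongStar_approx (C : Submodule ℂ (E →L[ℂ] F)) {v : E →L[ℂ] F}
    (hv : ∀ (n : ℕ) (ξ : Fin n → E) (η : Fin n → F), (∀ y ∈ C, ∑ j, ⟪η j, y (ξ j)⟫_ℂ = 0) →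
      ∑ j, ⟪η j, v (ξ j)⟫_ℂ = 0)
    {n m : ℕ} (ξ : Fin n → E) (η : Fin m → F) {ε : ℝ} (hε : 0 < ε) :
    ∃ y ∈ C, (∀ j, ‖y (ξ j) - v (ξ j)‖ < ε) ∧ ∀ j, ‖adjoint y (η j) - adjoint v (η j)‖ < ε := by
  let Φ : (E →L[ℂ] F) →ₗ[ℝ] (Fin n → F) × (Fin m → E) :=
    { toFun y := (fun j => y (ξ j), fun j => adjoint y (η j))
      map_add' y z := by ext <;> simp
      map_smul' c y := by
        have : adjoint (c • y) = c • adjoint y := by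
          rw [← Complex.coe_smul, map_smulₛₗ]
          simp
        ext <;> simp [this] }
  let P := (C.restrictScalars ℝ).map Φ
  have hmem : Φ v ∈ closure (P : Set ((Fin n → F) × (Fin m → E))) := by
    by_contra hnot
    obtain ⟨f, u, hfu, huv⟩ := RCLike.geometric_hahn_banach_closed_point (𝕜 := ℂ)
      P.convex.closure isClosed_closure hnot
    -- the real part of the functional is bounded above on the real subspace `P`, hence vanishes there
    have h0 (y : E →L[ℂ] F) (hy : y ∈ C) : RCLike.re (f (Φ y)) = 0 := by
      by_contra hne
      have h1 := hfu (Φ ((u / RCLike.re (f (Φ y))) • y)) (subset_closure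
        ⟨_, C.smul_mem ((u / RCLike.re (f (Φ y)) : ℝ) : ℂ) hy, rfl⟩)
      rw [map_smul, map_smul_of_tower, RCLike.smul_re, div_mul_cancel₀ _ hne] at h1
      exact lt_irrefl _ h1
    have hu : 0 < RCLike.re (f (Φ v)) := by
      have := hfu 0 (subset_closure P.zero_mem)
      simp only [map_zero] at this
      exact this.trans huv
    let α (j : Fin n) : F := (InnerProductSpace.toDual ℂ F).symm
      (f ∘L .inl ℂ _ _ ∘L .single ℂ (fun _ : Fin n => F) j)
    let β (j : Fin m) : E := (InnerProductSpace.toDual ℂ E).symm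
      (f ∘L .inr ℂ _ _ ∘L .single ℂ (fun _ : Fin m => E) j)
    have hf (p : (Fin n → F) × (Fin m → E)) :
        f p = ∑ j, ⟪α j, p.1 j⟫_ℂ + ∑ j, ⟪β j, p.2 j⟫_ℂ := by
      obtain ⟨p, q⟩ := p
      have h1 : ((p, q) : (Fin n → F) × (Fin m → E)) =
          ∑ j, (Pi.single j (p j), 0) + ∑ j, (0, Pi.single j (q j)) := by
        ext i
        · simp [Prod.fst_sum, Finset.sum_apply]
        · simp [Prod.snd_sum, Finset.sum_apply]
      rw [h1, map_add, map_sum, map_sum]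
      simp only [α, β, InnerProductSpace.toDual_symm_apply]
      simp [Prod.fst_sum, Prod.snd_sum]
    let ξ' : Fin (n + m) → E := Fin.append ξ β
    let η' : Fin (n + m) → F := Fin.append α η
    have hre (y : E →L[ℂ] F) : RCLike.re (f (Φ y)) = RCLike.re (∑ j, ⟪η' j, y (ξ' j)⟫_ℂ) := by
      rw [hf, Fin.sum_univ_add, map_add, map_add]
      simp only [ξ', η', Fin.append_left, Fin.append_right, Φ, LinearMap.coe_mk, AddHom.coe_mk,
        adjoint_inner_right, map_sum]
      congr 1
      refine Finset.sum_congr rfl fun j _ => ?_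
      rw [← inner_conj_symm, RCLike.conj_re]
    have hzero := hv _ ξ' η' fun y hy => by
      have h1 := (hre y).symm.trans (h0 y hy)
      have h2 := (hre (Complex.I • y)).symm.trans (h0 _ (C.smul_mem _ hy))
      simp only [smul_apply, inner_smul_right, ← Finset.mul_sum] at h2
      refine Complex.ext h1 ?_
      simpa using h2
    rw [hre, hzero, map_zero] at hu
    exact lt_irrefl _ hu
  obtain ⟨_, ⟨y, hy, rfl⟩, hd⟩ := Metric.mem_closure_iff.1 hmem ε hε
  rw [dist_comm, dist_eq_norm, Prod.norm_def, max_lt_iff, pi_norm_lt_iff hε,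
    pi_norm_lt_iff hε] at hd
  refine ⟨y, hy, fun j => hd.1 j, fun j => hd.2 j⟩

end Density

/-! ### Approximation of isometries by contractions -/

section Kaplansky

variable {E F : Type*}
  [NormedAddCommGroup E] [InnerProductSpace ℂ E] [CompleteSpace E]
  [NormedAddCommGroup F] [InnerProductSpace ℂ F] [CompleteSpace F]

theorem isUnit_one_add_adjoint_comp (y : E →L[ℂ] F) : IsUnit (1 + adjoint y ∘L y) := by
  refine CStarAlgebra.isUnit_of_le 1 ?_ isStrictlyPositive_one
  refine le_add_of_nonneg_right (nonneg_iff_inner.2 fun ξ => ?_)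
  rw [comp_apply, adjoint_inner_right]
  exact complex_inner_self_nonneg _

/-- The energy identity `‖R ζ‖² + ‖y R ζ‖² = Re ⟪R ζ, ζ⟫` for the resolvent `R = (1 + y* y)⁻¹`. -/
theorem re_inner_resolvent {y : E →L[ℂ] F} {R : E →L[ℂ] E} (hR : (1 + adjoint y ∘L y) * R = 1)
    (ζ : E) : ‖R ζ‖ ^ 2 + ‖y (R ζ)‖ ^ 2 = RCLike.re ⟪R ζ, ζ⟫_ℂ := by
  have h1 : R ζ + adjoint y (y (R ζ)) = ζ := congr($hR ζ)
  conv_rhs => rw [← h1, h1]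
  conv_rhs => rw [← congr(RCLike.re ⟪R ζ, $h1⟫_ℂ)]
  rw [inner_add_right, adjoint_inner_right, map_add, inner_self_eq_norm_sq, inner_self_eq_norm_sq]

/-- The operator `2 y (1 + y* y)⁻¹` is a contraction. -/
theorem two_mul_norm_resolvent_le {y : E →L[ℂ] F} {R : E →L[ℂ] E}
    (hR : (1 + adjoint y ∘L y) * R = 1) (ζ : E) : 2 * ‖y (R ζ)‖ ≤ ‖ζ‖ := by
  have h1 := re_inner_resolvent hR ζ
  have h2 := re_inner_le_norm (𝕜 := ℂ) (R ζ) ζ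
  refine (sq_le_sq₀ (by positivity) (norm_nonneg _)).1 ?_
  nlinarith [sq_nonneg (‖ζ‖ - 2 * ‖R ζ‖)]

/-- The operator `y (1 + y* y)⁻¹ y*` is a contraction. -/
theorem norm_resolvent_adjoint_le {y : E →L[ℂ] F} {R : E →L[ℂ] E}
    (hR : (1 + adjoint y ∘L y) * R = 1) (χ : F) : ‖y (R (adjoint y χ))‖ ≤ ‖χ‖ := by
  have h1 := re_inner_resolvent hR (adjoint y χ)
  have h2 := re_inner_le_norm (𝕜 := ℂ) (y (R (adjoint y χ))) χ
  rw [adjoint_inner_right] at h1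
  by_contra! h
  nlinarith [norm_nonneg (y (R (adjoint y χ))), norm_nonneg χ, sq_nonneg ‖R (adjoint y χ)‖]

/-- An isometry `v` that is a weak limit of elements of `C` is a strong limit of contractions in
`C`. As in the proof of Kaplansky's density theorem, approximants `y` of `v` in the strong-*
topology are replaced by the contractions `2 y (1 + y* y)⁻¹`; for `y = v` this is `v`. -/
theorem mem_strongClosure_contractions (C : Submodule ℂ (E →L[ℂ] F))
    (B : StarSubalgebra ℂ (E →L[ℂ] E)) (hB : ∀ y ∈ C, adjoint y ∘L y ∈ B)
    (hC : ∀ y ∈ C, ∀ b ∈ B, y ∘L b ∈ C) {v : E →L[ℂ] F} (hiso : adjoint v ∘L v = .id ℂ E)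
    (hv : ∀ (n : ℕ) (ξ : Fin n → E) (η : Fin n → F), (∀ y ∈ C, ∑ j, ⟪η j, y (ξ j)⟫_ℂ = 0) →
      ∑ j, ⟪η j, v (ξ j)⟫_ℂ = 0) :
    v ∈ strongClosure {k | k ∈ C ∧ ‖k‖ ≤ 1} := by
  refine mem_strongClosure_of_forall_exists fun s ε hε => ?_
  obtain ⟨y, hy, hy1, hy2⟩ := exists_strongStar_approx C hv
    (fun j => (s.equivFin.symm j : E)) (fun j => v (s.equivFin.symm j : E))
    (show 0 < ε / 4 by positivity)
  obtain ⟨N, hN⟩ := isUnit_one_add_adjoint_comp y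
  set R : E →L[ℂ] E := N⁻¹.val with hR'
  have hR : (1 + adjoint y ∘L y) * R = 1 := by rw [← hN]; exact N.mul_inv
  set f : E →L[ℂ] F := (2 : ℂ) • (y ∘L R) with hf'
  have hf1 (ζ : E) : ‖f ζ‖ ≤ ‖ζ‖ := by
    have := two_mul_norm_resolvent_le hR ζ
    simpa [f, norm_smul] using this
  have hfn : ‖f‖ ≤ 1 := opNorm_le_bound _ zero_le_one fun ζ => by simpa using hf1 ζ
  -- `f ξ - v ξ = (y ξ - v ξ) + y R ((v* - y*) v ξ + y* (v - y) ξ)`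
  have hfv (ξ : E) (hξ : ξ ∈ s) : ‖f ξ - v ξ‖ ≤ 3 * (ε / 4) := by
    have h1 : ‖y ξ - v ξ‖ < ε / 4 := by simpa using hy1 (s.equivFin ⟨ξ, hξ⟩)
    have h2 : ‖adjoint y (v ξ) - adjoint v (v ξ)‖ < ε / 4 := by
      simpa using hy2 (s.equivFin ⟨ξ, hξ⟩)
    have h3 : adjoint v (v ξ) = ξ := congr($hiso ξ)
    have hRN : R (ξ + adjoint y (y ξ)) = ξ := by
      have : R * (1 + adjoint y ∘L y) = 1 := by rw [← hN]; exact N.inv_mul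
      exact congr($this ξ)
    have h4 : f ξ - v ξ = (y ξ - v ξ) - y (R (adjoint y (v ξ) - adjoint v (v ξ)))
        - y (R (adjoint y (y ξ - v ξ))) := by
      have h5 : y (R ξ) + y (R (adjoint y (y ξ))) = y ξ := by
        rw [← map_add, ← map_add, hRN]
      have hfa : f ξ = y (R ξ) + y (R ξ) := by simp [f, two_smul]
      rw [hfa, h3]
      simp only [map_sub]
      nth_rw 1 [eq_sub_of_add_eq h5]
      abel
    have h6 := two_mul_norm_resolvent_le hR (adjoint y (v ξ) - adjoint v (v ξ))
    have h7 := norm_resolvent_adjoint_le hR (y ξ - v ξ)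
    rw [h4]
    have h8 := norm_sub_le ((y ξ - v ξ) - y (R (adjoint y (v ξ) - adjoint v (v ξ))))
      (y (R (adjoint y (y ξ - v ξ))))
    have h9 := norm_sub_le (y ξ - v ξ) (y (R (adjoint y (v ξ) - adjoint v (v ξ))))
    linarith [norm_nonneg (y (R (adjoint y (v ξ) - adjoint v (v ξ))))]
  -- `R` is a norm limit of elements of `B`, by spectral permanence
  have hRB : R ∈ closure (B : Set (E →L[ℂ] E)) := by
    have hcl := B.isClosed_topologicalClosure
    have hNB : (N : E →L[ℂ] E) ∈ B.topologicalClosure := by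
      rw [hN]
      exact B.le_topologicalClosure (add_mem (one_mem B) (hB y hy))
    obtain ⟨N', hN'⟩ := (StarSubalgebra.coe_isUnit B.topologicalClosure
      (a := ⟨N, hNB⟩)).1 N.isUnit
    have h1 : N'⁻¹.val.1 = R := by
      have h2 : N'⁻¹.val.1 * N = 1 := by
        have := congrArg Subtype.val N'.inv_mul
        rwa [hN'] at this
      exact left_inv_eq_right_inv h2 N.mul_inv
    rw [← h1]
    exact N'⁻¹.val.2
  set c := 1 + ∑ ξ ∈ s, ‖ξ‖ with hc'
  have hc : 0 < c := by positivity
  set δ := ε / (16 * c) with hδ'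
  have hδ : 0 < δ := by positivity
  have hfC : f ∈ closure (C : Set (E →L[ℂ] F)) := by
    refine map_mem_closure (f := fun b : E →L[ℂ] E => (2 : ℂ) • (y ∘L b)) (by fun_prop) hRB ?_
    exact fun b hb => C.smul_mem _ (hC y hy b hb)
  obtain ⟨k₀, hk₀, hd⟩ := Metric.mem_closure_iff.1 hfC δ hδ
  rw [dist_comm, dist_eq_norm] at hd
  have hk₀n : ‖k₀‖ ≤ 1 + δ := by
    calc ‖k₀‖ = ‖f + (k₀ - f)‖ := by rw [add_sub_cancel]
      _ ≤ ‖f‖ + ‖k₀ - f‖ := norm_add_le _ _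
      _ ≤ _ := by linarith
  have h1δ : 0 < 1 + δ := by positivity
  set r : ℝ := (1 + δ)⁻¹ with hr'
  have hr : 0 < r := by positivity
  have hkn : ‖(r : ℂ) • k₀‖ ≤ 1 := by
    rw [norm_smul, Complex.norm_real, Real.norm_of_nonneg hr.le, hr', inv_mul_le_iff₀ h1δ]
    linarith
  refine ⟨(r : ℂ) • k₀, ⟨C.smul_mem _ hk₀, hkn⟩, fun ξ hξ => ?_⟩
  have hξc : ‖ξ‖ ≤ c := by
    have := Finset.single_le_sum (f := fun ξ : E => ‖ξ‖) (fun _ _ => norm_nonneg _) hξ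
    linarith
  have hrk : ‖(r : ℂ) • k₀ - k₀‖ ≤ δ := by
    have h1 : (r : ℂ) • k₀ - k₀ = ((r - 1 : ℝ) : ℂ) • k₀ := by
      push_cast
      rw [sub_smul, one_smul]
    have h2 : |r - 1| = δ * r := by
      have : r - 1 = -(δ * r) := by rw [hr']; field_simp; ring
      rw [this, abs_neg, abs_of_nonneg (by positivity)]
    rw [h1, norm_smul, Complex.norm_real, Real.norm_eq_abs, h2]
    calc δ * r * ‖k₀‖ ≤ δ * r * (1 + δ) := by gcongr
      _ = δ := by rw [hr']; field_simp
  have h1 : ‖(((r : ℂ) • k₀ - k₀) + (k₀ - f)) ξ‖ ≤ 2 * δ * c := by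
    refine (le_opNorm _ _).trans ?_
    gcongr
    exact (norm_add_le _ _).trans (by linarith)
  have h2 : 2 * δ * c = ε / 8 := by rw [hδ']; field_simp; norm_num
  calc ‖((r : ℂ) • k₀) ξ - v ξ‖ = ‖(((r : ℂ) • k₀ - k₀) + (k₀ - f)) ξ + (f ξ - v ξ)‖ := by
        congr 1
        simp only [add_apply, sub_apply]
        abel
    _ ≤ ε / 8 + 3 * (ε / 4) := (norm_add_le _ _).trans (add_le_add (h1.trans_eq h2) (hfv ξ hξ))
    _ < ε := by linarith

end Kaplansky

/-! ### The von Neumann algebra of an agent -/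

section AgentAlgebra

variable {H : Type*} [NormedAddCommGroup H] [InnerProductSpace ℂ H] [CompleteSpace H]
  [TopologicalSpace.SeparableSpace H] [Nontrivial H]
  {K₁ K₂ : Ancilla} {A : Agent H} (hA : A.SatisfiesAxioms)

include hA in
theorem zero_mem_kraus : (0 : Joint H K₁ →L[ℂ] Joint H K₂) ∈ A.kraus K₁ K₂ := by
  have := smul_mem_kraus 0 (opTensor_mem_kraus hA (0 : K₁ →L[ℂ] K₂))
  rwa [zero_smul] at this

/-- `A.kraus K₁ K₂` as a subspace. -/
def krausSpace (K₁ K₂ : Ancilla) : Submodule ℂ (Joint H K₁ →L[ℂ] Joint H K₂) where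
  carrier := A.kraus K₁ K₂
  add_mem' := add_mem_kraus hA
  zero_mem' := zero_mem_kraus hA
  smul_mem' c _ := smul_mem_kraus c

include hA in
theorem id_mem_kraus (K : Ancilla) : (1 : Joint H K →L[ℂ] Joint H K) ∈ A.kraus K K := by
  have := opTensor_mem_kraus hA (.id ℂ K)
  rwa [opTensor_id] at this

/-- `A.kraus K K` as a *-algebra. -/
def krausAlgebra (K : Ancilla) : StarSubalgebra ℂ (Joint H K →L[ℂ] Joint H K) where
  carrier := A.kraus K K
  add_mem' := add_mem_kraus hA
  mul_mem' := comp_mem_kraus hA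
  algebraMap_mem' c := by
    rw [Algebra.algebraMap_eq_smul_one]
    exact smul_mem_kraus c (id_mem_kraus hA K)
  star_mem' := adjoint_mem_kraus hA

/-- The *-algebra of all `a` on `H` such that all `a ⊗ |f⟩⟨e|` are Kraus operators of the agent. -/
def systemAlgebra : StarSubalgebra ℂ (H →L[ℂ] H) where
  carrier := {a | ∀ (K₁ K₂ : Ancilla) (f : K₂) (e : K₁), opTensor a (ketBra f e) ∈ A.kraus K₁ K₂}
  add_mem' ha hb K₁ K₂ f e := by
    rw [opTensor_add_left]
    exact add_mem_kraus hA (ha K₁ K₂ f e) (hb K₁ K₂ f e)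
  mul_mem' {a b} ha hb K₁ K₂ f e := by
    obtain ⟨g, hg⟩ := exists_norm_eq K₂ zero_le_one
    have := comp_mem_kraus hA (ha K₂ K₂ f g) (hb K₁ K₂ g e)
    rw [opTensor_comp] at this
    convert! this using 2
    ext x
    simp [hg]
  algebraMap_mem' c K₁ K₂ f e := by
    rw [Algebra.algebraMap_eq_smul_one, opTensor_smul_left]
    exact smul_mem_kraus c (opTensor_mem_kraus hA _)
  star_mem' {a} ha K₁ K₂ f e := by
    have := adjoint_mem_kraus hA (ha K₂ K₁ e f)
    rwa [opTensor_adjoint, InnerProductSpace.adjoint_rankOne] at this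

/-- The von Neumann algebra generated by the system algebra of the agent. -/
def agentAlgebra : VonNeumannAlgebra H :=
  (⟨StarSubalgebra.centralizer ℂ (systemAlgebra hA : Set (H →L[ℂ] H)), by simp⟩ :
    VonNeumannAlgebra H).commutant

theorem mem_agentAlgebra_iff {m : H →L[ℂ] H} : m ∈ agentAlgebra hA ↔
    m ∈ Set.centralizer (Set.centralizer (systemAlgebra hA : Set (H →L[ℂ] H))) := by
  rw [← SetLike.mem_coe, agentAlgebra, VonNeumannAlgebra.coe_commutant, VonNeumannAlgebra.coe_mk]
  simp

/-- The system algebra contains the slices of all Kraus operators of the agent, on any ancillas. -/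
theorem slice_mem_systemAlgebra {k : Joint H K₁ →L[ℂ] Joint H K₂} (hk : k ∈ A.kraus K₁ K₂)
    (e : K₂) (f : K₁) : slice k e f ∈ systemAlgebra hA := by
  intro L₁ L₂ g h
  have h1 := comp_mem_kraus hA (opTensor_mem_kraus hA (ketBra g e))
    (comp_mem_kraus hA hk (opTensor_mem_kraus hA (ketBra f h)))
  rw [opTensor_ketBra, opTensor_ketBra] at h1
  rw [opTensor_ketBra]
  exact h1

theorem mem_mOperators_of_mem_kraus {k : Joint H K₁ →L[ℂ] Joint H K₂}
    (hk : k ∈ A.kraus K₁ K₂) : k ∈ mOperators (agentAlgebra hA) K₁ K₂ :=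
  mem_mOperators_iff_slice.2 fun e f => (mem_agentAlgebra_iff hA).2
    (Set.subset_centralizer_centralizer (slice_mem_systemAlgebra hA hk e f))

/-- Weakly continuous functionals that vanish on the Kraus operators of the agent vanish on all
operators in `M ⊗̄ B(K₁, K₂)`. -/
theorem sum_inner_eq_zero_of_mem_mOperators {k : Joint H K₁ →L[ℂ] Joint H K₂}
    (hk : k ∈ mOperators (agentAlgebra hA) K₁ K₂) {n : ℕ} {ξ : Fin n → Joint H K₁}
    {η : Fin n → Joint H K₂} (h : ∀ y ∈ A.kraus K₁ K₂, ∑ j, ⟪η j, y (ξ j)⟫_ℂ = 0) :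
    ∑ j, ⟪η j, k (ξ j)⟫_ℂ = 0 := by
  have key (a : H →L[ℂ] H) (f : K₂) (e : K₁) : ∑ j, ⟪η j, opTensor a (ketBra f e) (ξ j)⟫_ℂ =
      ∑ j, ⟪bra H f (η j), a (bra H e (ξ j))⟫_ℂ := by
    refine Finset.sum_congr rfl fun j _ => ?_
    rw [opTensor_ketBra, comp_apply, comp_apply, ← adjoint_bra, adjoint_inner_right]
  have h1 : ∀ y ∈ (Submodule.span ℂ {c | ∃ a ∈ agentAlgebra hA, ∃ (f : K₂) (e : K₁),
      c = opTensor a (ketBra f e)} : Submodule ℂ (Joint H K₁ →L[ℂ] Joint H K₂)),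
      ∑ j, ⟪η j, y (ξ j)⟫_ℂ = 0 := by
    intro y hy
    induction hy using Submodule.span_induction with
    | mem y hy =>
      obtain ⟨a, ha, f, e, rfl⟩ := hy
      rw [key]
      refine sum_inner_eq_zero_of_mem_centralizer (systemAlgebra hA) (fun b hb => ?_)
        ((mem_agentAlgebra_iff hA).1 ha)
      rw [← key]
      exact h _ (hb K₁ K₂ f e)
    | zero => simp
    | add y z _ _ hy hz => simp [Finset.sum_add_distrib, hy, hz]
    | smul c y _ hy => simp [← Finset.mul_sum, hy]
  exact strongClosure_induction (P := fun g : Joint H K₁ → Joint H K₂ => ∑ j, ⟪η j, g (ξ j)⟫_ℂ = 0)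
    (isClosed_eq (by fun_prop) continuous_const) h1
    (mem_strongClosure_of_slice k (mem_mOperators_iff_slice.1 hk))

/-- Implementable instruments are inner. -/
theorem isInnerInstrument_of_implementable {X : Type} [Countable X] {T : X → JointMap H K₁ K₂}
    (hT : A.Implementable T) : IsInnerInstrument (agentAlgebra hA) T := by
  have hin := A.isInstrument hT
  refine ⟨hin, fun x => ?_⟩
  obtain ⟨k, hk⟩ := (hin.cp x).exists_kraus (hin.normal x)
  exact isInner_of_isKraus
    (fun i => mem_mOperators_of_mem_kraus hA (mem_kraus_of_implementable hA hT hk i)) hk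

/-! ### Implementability of inner instruments -/

include hA in
/-- An implementable operation `a ↦ k* a k` is dominated by an implementable channel, obtained by
discarding the outcome. -/
theorem exists_channel_ge_of_imp {k : Joint H K₁ →L[ℂ] Joint H K₂} (hk : A.Imp k) :
    ∃ S : JointMap H K₁ K₂, IsChannel S ∧ A.ImplementableChannel S ∧
      ∀ a, 0 ≤ a → conjMap k a ≤ S a := by
  obtain ⟨X, _, T, x, hT, hx⟩ := hk
  have hin := A.isInstrument hT
  obtain ⟨S, hS, hsum⟩ := hin.channel
  refine ⟨S, hS, hA.consistency.discard T S hT hsum, fun a ha => ?_⟩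
  rw [← sub_nonneg]
  refine nonneg_iff_inner.2 fun ξ => ?_
  rw [sub_apply, inner_sub_right, sub_nonneg, ← hx]
  exact le_hasSum (hsum a ξ ξ) x fun y _ => nonneg_iff_inner.1 ((hin.cp y).map_nonneg ha) ξ

include hA in
/-- If an isometry `v` is a strong limit of contractive Kraus operators `k` of the agent, then
`a ↦ v* a v` is a limit of implementable channels: the channels dominating `a ↦ k* a k` differ
from it by at most `‖a‖ (1 - k* k)`. -/
theorem implementableChannel_of_mem_strongClosure {v : Joint H K₁ →L[ℂ] Joint H K₂}
    (hiso : adjoint v ∘L v = .id ℂ _)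
    (hv : v ∈ strongClosure {k | k ∈ krausSpace hA K₁ K₂ ∧ ‖k‖ ≤ 1}) :
    A.ImplementableChannel (conjMap v) := by
  have hne := mem_closure_iff_comap_neBot.1 hv
  set s := (fun l : Joint H K₁ →L[ℂ] Joint H K₂ => (l : Joint H K₁ → Joint H K₂)) ''
    {k | k ∈ krausSpace hA K₁ K₂ ∧ ‖k‖ ≤ 1}
  set l := comap ((↑) : s → Joint H K₁ → Joint H K₂) (𝓝 v)
  choose k hk hkg using fun g : s => g.2
  choose S hS hSA hge using fun g : s =>
    exists_channel_ge_of_imp hA (imp_of_mem_kraus hA (hk g).1 (hk g).2)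
  have hlim (ξ : Joint H K₁) : Tendsto (fun g => k g ξ) l (𝓝 (v ξ)) := by
    have h1 : Tendsto (fun g : s => (g : Joint H K₁ → Joint H K₂)) l (𝓝 v) := tendsto_comap
    simp only [← hkg] at h1
    exact tendsto_pi_nhds.1 h1 ξ
  have hφ1 (φ : (Joint H K₁ →L[ℂ] Joint H K₁) →ₗ[ℂ] ℂ) (hφ : IsNormalState φ)
      (a : Joint H K₂ →L[ℂ] Joint H K₂) :
      Tendsto (fun g => φ (conjMap (k g) a)) l (𝓝 (φ (conjMap v a))) := by
    refine hφ.1.tendsto (C := ‖a‖) (fun g => ?_) fun ξ ψ => ?_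
    · refine opNorm_le_bound _ (norm_nonneg _) fun ξ => ?_
      have h1 : ‖adjoint (k g)‖ ≤ 1 := by rw [LinearIsometryEquiv.norm_map]; exact (hk g).2
      calc ‖adjoint (k g) (a (k g ξ))‖ ≤ 1 * (‖a‖ * (1 * ‖ξ‖)) :=
            le_of_opNorm_le_of_le _ h1 (le_opNorm_of_le _ (le_of_opNorm_le _ (hk g).2 ξ))
        _ = _ := by ring
    · simp only [inner_conjMap]
      exact (hlim ξ).inner ((a.continuous.tendsto _).comp (hlim ψ))
  have hpos (φ : (Joint H K₁ →L[ℂ] Joint H K₁) →ₗ[ℂ] ℂ) (hφ : IsNormalState φ)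
      (a : Joint H K₂ →L[ℂ] Joint H K₂) (ha : 0 ≤ a) :
      Tendsto (fun g => φ (S g a)) l (𝓝 (φ (conjMap v a))) := by
    have h1 : Tendsto (fun g => φ ((‖a‖ : ℂ) • (1 - conjMap (k g) 1))) l (𝓝 0) := by
      have h2 := ((hφ1 φ hφ 1).const_sub (φ 1)).const_mul (‖a‖ : ℂ)
      have h3 : conjMap v 1 = 1 := hiso
      simpa [h3] using h2
    have h2 : Tendsto (fun g => φ (S g a - conjMap (k g) a)) l (𝓝 0) := by
      refine squeeze_zero_norm (fun g => ?_) (tendsto_zero_iff_norm_tendsto_zero.1 h1)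
      have h3 : 0 ≤ S g a - conjMap (k g) a := sub_nonneg.2 (hge g a ha)
      have h4 : S g a - conjMap (k g) a ≤ (‖a‖ : ℂ) • (1 - conjMap (k g) 1) := by
        have h5 : a ≤ (‖a‖ : ℂ) • 1 := by
          have := (IsSelfAdjoint.of_nonneg ha).le_algebraMap_norm_self
          rw [Algebra.algebraMap_eq_smul_one] at this
          simpa using! this
        have h6 := hge g _ (sub_nonneg.2 h5)
        rw [map_sub, map_sub, map_smul, map_smul, (hS g).unital] at h6
        rw [smul_sub, sub_le_sub_iff]
        rw [sub_le_sub_iff] at h6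
        rw [add_comm (S g a), add_comm _ (conjMap (k g) a)]
        rw [add_comm (conjMap (k g) a)]
        exact h6
      refine CStarAlgebra.norm_le_norm_of_nonneg_of_le (hφ.2.1 _ h3) ?_
      rw [← sub_nonneg, ← map_sub]
      exact hφ.2.1 _ (sub_nonneg.2 h4)
    have h3 := h2.add (hφ1 φ hφ a)
    simpa using h3
  have hall (φ : (Joint H K₁ →L[ℂ] Joint H K₁) →ₗ[ℂ] ℂ) (hφ : IsNormalState φ)
      (a : Joint H K₂ →L[ℂ] Joint H K₂) :
      Tendsto (fun g => φ (S g a)) l (𝓝 (φ (conjMap v a))) := by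
    have ha : a ∈ Submodule.span ℂ {a : Joint H K₂ →L[ℂ] Joint H K₂ | 0 ≤ a} := by
      rw [CStarAlgebra.span_nonneg]; trivial
    induction ha using Submodule.span_induction with
    | mem a ha => exact hpos φ hφ a ha
    | zero => simp
    | add a b _ _ ha hb => simpa only [map_add] using ha.add hb
    | smul c a _ ha => simpa only [map_smul] using ha.const_smul c
  let := expectationTopology (Joint H K₁) (Joint H K₂)
  refine (hA.limits K₁ K₂).mem_of_tendsto (f := fun g => ⟨S g, hS g⟩) (b := l)
    (x := ⟨conjMap v, isChannel_conjMap hiso⟩) ?_ (Eventually.of_forall hSA)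
  simp only [nhds_iInf, tendsto_iInf, nhds_induced, tendsto_comap_iff]
  exact fun φ hφ a => hall φ hφ a

/-- Isometries in `M ⊗̄ B(K₁, K₂)` have implementable channels. -/
theorem implementableChannel_of_mem_mOperators {v : Joint H K₁ →L[ℂ] Joint H K₂}
    (hiso : adjoint v ∘L v = .id ℂ _) (hv : v ∈ mOperators (agentAlgebra hA) K₁ K₂) :
    A.ImplementableChannel (conjMap v) :=
  implementableChannel_of_mem_strongClosure hA hiso
    (mem_strongClosure_contractions (krausSpace hA K₁ K₂) (krausAlgebra hA K₁)
      (fun _ hy => comp_mem_kraus hA (adjoint_mem_kraus hA hy) hy)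
      (fun _ hy _ hb => comp_mem_kraus hA hy hb) hiso
      fun _ _ _ h => sum_inner_eq_zero_of_mem_mOperators hA hv h)

end AgentAlgebra

section Measurement

variable {E L : Type*}
  [NormedAddCommGroup E] [InnerProductSpace ℂ E] [CompleteSpace E]
  [NormedAddCommGroup L] [InnerProductSpace ℂ L] [CompleteSpace L]

/-- The map `a ↦ a ⊗ p`. -/
def tensorMap (E : Type*) [NormedAddCommGroup E] [InnerProductSpace ℂ E] (p : L →L[ℂ] L) :
    (E →L[ℂ] E) →ₗ[ℂ] (HTensor E L →L[ℂ] HTensor E L) where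
  toFun a := opTensor a p
  map_add' a b := opTensor_add_left a b p
  map_smul' c a := opTensor_smul_left c a p

/-- The diagonal projection onto the span of the basis vectors with index in `s`. -/
theorem exists_diagonal_projection {Z : Type*} (b : HilbertBasis Z ℂ L) (s : Set Z) :
    ∃ p : L →L[ℂ] L, adjoint p = p ∧ (∀ z ∈ s, p (b z) = b z) ∧ ∀ z ∉ s, p (b z) = 0 := by
  let Q := (Submodule.span ℂ (b '' s)).topologicalClosure
  have hc : CompleteSpace Q := (Submodule.isClosed_topologicalClosure _).completeSpace_coe
  refine ⟨Q.starProjection, (isSelfAdjoint_starProjection Q).adjoint_eq, fun z hz => ?_,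
    fun z hz => ?_⟩
  · exact Submodule.starProjection_eq_self_iff.2
      (Submodule.le_topologicalClosure _ (Submodule.subset_span ⟨z, hz, rfl⟩))
  · refine Submodule.eq_starProjection_of_mem_of_inner_eq_zero Q.zero_mem fun w hw => ?_
    rw [sub_zero]
    have h : Q ≤ LinearMap.ker (innerSL ℂ (b z)).toLinearMap := by
      refine Submodule.topologicalClosure_minimal _ (Submodule.span_le.2 ?_)
        (innerSL ℂ (b z)).isClosed_ker
      rintro _ ⟨z', hz', rfl⟩
      exact b.orthonormal.2 (by rintro rfl; exact hz hz')
    exact h hw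

/-- If `p` is the diagonal projection onto the span of the basis vectors `b (f i)`, then the operators
`1 ⊗ ⟨b (f i)|` are Kraus operators of `a ↦ a ⊗ p`. -/
theorem isKraus_tensorMap {Z κ : Type*} (b : HilbertBasis Z ℂ L) {f : κ → Z}
    (hf : Function.Injective f) {p : L →L[ℂ] L} (hp : adjoint p = p)
    (h1 : ∀ z ∈ Set.range f, p (b z) = b z) (h0 : ∀ z ∉ Set.range f, p (b z) = 0) :
    IsKraus (fun i => bra E (b (f i))) (tensorMap E p) := by
  intro a ξ ψ
  have h := hasSum_inner_bra b ξ (opTensor a p ψ)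
  simp only [bra_opTensor, hp] at h
  rw [← hf.hasSum_iff fun z hz => by
    rw [h0 z hz]
    have : bra E (0 : L) = 0 := by rw [bra, ket, map_zero, map_zero]
    simp [this]] at h
  simp only [inner_conjMap]
  convert! h using 2 with i
  simp [h1 (f i) ⟨i, rfl⟩]

theorem isKraus_tensorMap_id {Z : Type*} (b : HilbertBasis Z ℂ L) :
    IsKraus (fun z => bra E (b z)) (tensorMap E (.id ℂ L)) :=
  isKraus_tensorMap b Function.injective_id adjoint_id (fun _ _ => rfl)
    fun z hz => absurd ⟨z, rfl⟩ hz

theorem IsKraus.conjMap_comp {E₁ E₂ E₃ ι : Type*}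
    [NormedAddCommGroup E₁] [InnerProductSpace ℂ E₁] [CompleteSpace E₁]
    [NormedAddCommGroup E₂] [InnerProductSpace ℂ E₂] [CompleteSpace E₂]
    [NormedAddCommGroup E₃] [InnerProductSpace ℂ E₃] [CompleteSpace E₃]
    {T : (E₃ →L[ℂ] E₃) →ₗ[ℂ] (E₂ →L[ℂ] E₂)} {k : ι → E₂ →L[ℂ] E₃} (hT : IsKraus k T)
    (w : E₁ →L[ℂ] E₂) : IsKraus (fun i => k i ∘L w) (conjMap w ∘ₗ T) := by
  intro a ξ ψ
  rw [LinearMap.comp_apply, inner_conjMap]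
  simpa only [inner_conjMap, comp_apply] using hT a (w ξ) (w ψ)

end Measurement

section InnerImplementable

variable {H : Type*} [NormedAddCommGroup H] [InnerProductSpace ℂ H] [CompleteSpace H]
  [TopologicalSpace.SeparableSpace H] [Nontrivial H]
  {K₁ K₂ : Ancilla} {A : Agent H} (hA : A.SatisfiesAxioms)

include hA in
/-- The measurement of an ancilla with outcomes `x`, given by diagonal projections `pₓ` that sum to
`1`, is implementable. -/
theorem implementable_measurement (K : Ancilla) {X : Type} [Countable X] {ι : X → Type}
    [∀ x, Countable (ι x)] {L : Ancilla} (b : HilbertBasis (Σ x, ι x) ℂ L) :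
    ∃ R : X → JointMap H (K.tensor L) K, A.Implementable R ∧
      ∀ x, IsKraus (fun i : ι x => bra (Joint H K) (b ⟨x, i⟩) ∘L assocInv H K L) (R x) := by
  choose p hpa hp1 hp0 using fun x : X =>
    exists_diagonal_projection b (Set.range (Sigma.mk x : ι x → Σ x, ι x))
  have hinj (x : X) : Function.Injective (Sigma.mk x : ι x → Σ x, ι x) := sigma_mk_injective
  have hS : IsInstrument fun x => tensorMap K (p x) :=
    IsKraus.isInstrument (fun x => isKraus_tensorMap b (hinj x) (hpa x) (hp1 x) (hp0 x))
      (IsKraus.isMapSum (fun x => isKraus_tensorMap b (hinj x) (hpa x) (hp1 x) (hp0 x))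
        (isKraus_tensorMap_id b))
      opTensor_id
  have hR (x : X) := (isKraus_tensorMap (E := Joint H K) b (hinj x) (hpa x) (hp1 x)
    (hp0 x)).conjMap_comp (assocInv H K L)
  have hiso : adjoint (assocInv H K L) = assocCLM H K L := by
    rw [← adjoint_assocCLM, adjoint_adjoint]
  have hcancel : assocCLM H K L ∘L assocInv H K L = .id ℂ _ := by
    ext ζ; simp
  refine ⟨fun x => conjMap (assocInv H K L) ∘ₗ tensorMap (Joint H K) (p x), ?_, hR⟩
  refine hA.ancillaControl (fun x => tensorMap K (p x)) hS _ ?_ fun x a c => ?_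
  · refine IsKraus.isInstrument hR (IsKraus.isMapSum hR ((isKraus_tensorMap_id b).conjMap_comp _)) ?_
    change adjoint (assocInv H K L) ∘L opTensor (.id ℂ _) (.id ℂ _) ∘L assocInv H K L = .id ℂ _
    rw [opTensor_id, id_comp, hiso, hcancel]
  · change adjoint (assocInv H K L) ∘L opTensor (opTensor a c) (p x) ∘L assocInv H K L =
      opTensor a (opTensor c (p x))
    rw [opTensor_comp_assocInv, ← comp_assoc, hiso, hcancel, id_comp]

/-- Inner instruments are implementable: apply the Stinespring isometry of the sum channel and then
measure the outcome on the dilation space. -/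
theorem implementable_of_isInnerInstrument {X : Type} [Countable X] {T : X → JointMap H K₁ K₂}
    (hT : IsInnerInstrument (agentAlgebra hA) T) : A.Implementable T := by
  obtain ⟨hin, hinner⟩ := hT
  choose ι hι k hk hkT using hinner
  obtain ⟨S, hS, hsum⟩ := hin.channel
  have hkS : IsKraus (fun z : Σ x, ι x => k z.1 z.2) S := IsKraus.sigma hkT hsum
  have hne : Nonempty (Σ x, ι x) := by
    by_contra hempty
    rw [not_nonempty_iff] at hempty
    obtain ⟨ξ, hξ⟩ := exists_norm_eq (Joint H K₁) zero_le_one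
    have h1 := (hkS.hasSum_norm_sq ξ).unique hasSum_empty
    rw [hS.unital, show (1 : Joint H K₁ →L[ℂ] Joint H K₁) ξ = ξ from rfl,
      inner_self_eq_norm_sq, hξ] at h1
    norm_num at h1
  obtain ⟨L, ⟨b⟩⟩ : ∃ L : Ancilla, Nonempty (HilbertBasis (Σ x, ι x) ℂ L) :=
    ⟨ellTwo _, ⟨ellTwoBasis _⟩⟩
  obtain ⟨V, hV1, hV⟩ := hkS.exists_isometry b hS.unital
  obtain ⟨W, hWV⟩ : ∃ W : Joint H K₁ →L[ℂ] Joint H (K₂.tensor L), W = assocCLM H K₂ L ∘L V :=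
    ⟨_, rfl⟩
  have hWM : W ∈ mOperators (agentAlgebra hA) K₁ (K₂.tensor L) :=
    hWV ▸ assocCLM_comp_mem_mOperators (fun z : Σ x, ι x => hk z.1 z.2) hV
  have hW1 : adjoint W ∘L W = .id ℂ _ := by
    rw [hWV]
    exact (adjoint_assocCLM_comp V).trans hV1
  have hW : A.ImplementableChannel (conjMap W) := implementableChannel_of_mem_mOperators hA hW1 hWM
  obtain ⟨R, hR, hRk⟩ := implementable_measurement hA K₂ b
  have h1 := hA.consistency.relabel (Equiv.punitProd X).symm _ (hA.consistency.comp _ R hW hR)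
  have hTR (x : X) : T x = conjMap W ∘ₗ R x := by
    have h2 := (hRk x).conjMap_comp W
    have h3 (i : ι x) : (bra (Joint H K₂) (b ⟨x, i⟩) ∘L assocInv H K₂ L) ∘L W = k x i := by
      ext ξ
      simpa [hWV] using hV ⟨x, i⟩ ξ
    simp only [h3] at h2
    exact (hkT x).unique h2
  rw [funext hTR]
  exact h1

theorem implementsInner_agentAlgebra : A.ImplementsInner (agentAlgebra hA) :=
  fun _ _ _ _ _ => ⟨isInnerInstrument_of_implementable hA, implementable_of_isInnerInstrument hA⟩

end InnerImplementable

end AgentAxioms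

end

theorem mainTheorem7 {H : Type*} [NormedAddCommGroup H] [InnerProductSpace ℂ H] [CompleteSpace H]
    [TopologicalSpace.SeparableSpace H] [Nontrivial H] (A : AgentAxioms.Agent H) :
    A.SatisfiesAxioms ↔
      ∃ M : VonNeumannAlgebra H,
        ∀ (K₁ K₂ : AgentAxioms.Ancilla) (X : Type) [Countable X]
          (T : X → AgentAxioms.JointMap H K₁ K₂),
          A.Implementable T ↔ AgentAxioms.IsInnerInstrument M T := by
  exact ⟨fun hA => ⟨_, AgentAxioms.implementsInner_agentAlgebra hA⟩,
    fun ⟨_, hM⟩ => AgentAxioms.Agent.ImplementsInner.satisfiesAxioms hM⟩
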